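/- **Conventions.** A finite regular $\Delta$-complex of dimension at most $2$ is a finite $\Delta$-complex whose cells are vertices, edges and facets ($2$-simplices), in which the faces of any simplex are distinct. (Several edges may have the same endpoints, and several facets the same edges.) For an edge $e$, $\deg(e)$ is the number of facets containing $e$. A *weak tropical surface* is a connected finite regular $\Delta$-complex $\Delta$ of dimension at most $2$ with integers $\alpha(v,e)$ for every endpoint $v$ of an edge $e$, such that $\alpha(v,e)+\alpha(w,e)=\deg(e)$ for each edge $e$ with endpoints $v,w$. At a vertex $v$ the *local intersection matrix* $M_v$ is the symmetric matrix indexed by the edges containing $v$, with $(M_v)_{e,e'}=\#\{\text{facets containing both } e \text{ and } e'\}$ for $e\neq e'$ and $(M_v)_{e,e}=-\alpha(w,e)$, where $w$ is the endpoint of $e$ other than $v$. A *tropical surface* is a weak tropical surface such that every $M_v$ has exactly one positive eigenvalue, counted with multiplicity. For an edge $e$ with endpoints $v,w$, let $N_e^o\subset\Delta$ be the union of the interiors of $e$ and of the $d$ facets $f_1,\dots,f_d$ containing $e$, and let $\phi_e\colon N_e^o\to\mathbb R^{d+2}/\mathbb R\cdot(1,\dots,1,-\alpha(v,e),-\alpha(w,e))$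 be the map, affine on each simplex, that sends the vertex of $f_i$ opposite to $e$ to $\mathbf e_i$, $v$ to $\mathbf e_{d+1}$ and $w$ to $\mathbf e_{d+2}$, where $\mathbf e_1,\dots,\mathbf e_{d+2}$ are the images of the standard basis vectors. Let $\mathcal A$ be the sheaf of *linear functions* on $\Delta$, that is, of the continuous real functions that locally satisfy the following condition: a continuous function $\phi$ on an open set $U$ satisfies it if (i) on $U\cap f^o$, for every facet $f$ with interior $f^o$ (identified with the interior of a unimodular simplex in $\mathbb R^2$), $\phi$ is affine linear with integral slopes; and (ii) for every edge $e$ whose interior meets $U$, $\phi|_{U\cap N_e^o}=\ell\circ\phi_e$ for a linear $\ell\colon\mathbb R^{d+2}/\mathbb R\to\mathbb R$ with $\ell(\mathbf e_i)-\ell(\mathbf e_j)\in\mathbb Z$ for all $i,j$. The locally constant real functions form a subsheaf $\mathbb R\subset\mathcal A$; let $\mathcal D=\mathcal A/\mathbb R$ be the quotient sheaf of abelian groups. $\Delta$ is a *manifold with fins* if there are a subcomplex $\Sigma$ (the manifold) and subcomplexes $F_1,\dots,F_n$ (the fins, $n\ge 0$) such that $\Delta=\Sigma\cup F_1\cup\dots\cup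 F_n$; $\Sigma$ is homeomorphic to a connected $2$-dimensional topological manifold (without boundary); every $F_i$ is contractible and $F_i\cap\Sigma$ is a path (a single vertex being allowed as a path); and for $i>j$, $F_j\cap F_i$ is a subset of the endpoints of the path $F_i\cap\Sigma$. $\Delta$ is *connected through codimension $1$* if any two facets are joined by a chain of facets in which consecutive ones share an edge. **Lemma.** Let $\Delta$ be a tropical surface whose underlying $\Delta$-complex is a manifold with fins and which is connected through codimension $1$. For any decomposition $\Delta=\Sigma\cup F_1\cup\dots\cup F_n$ as above and any facet $s$ of $\Sigma$ with interior $U_s$, the group $H^0(U_s,\mathcal D)$ is isomorphic to $\mathbb Z^2$, and the restriction map $$H^0(\Delta,\mathcal D)\to H^0(U_s,\mathcal D)\cong\mathbb Z^2$$ is injective. -/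

import Mathlib

open CategoryTheory TopologicalSpace Opposite

universe u

/-! ### Regular Δ-complexes of dimension at most two -/

/-- A finite regular `Δ`-complex whose simplices have dimension at most two: `V`, `E`, `F` index the
vertices, edges and facets (2-simplices).  `edgeVert e k` is the `k`-th vertex of the edge `e`,
`faceVert f i` is the `i`-th vertex of the facet `f`, and `faceEdge f i` is the edge of `f` opposite
to its `i`-th vertex.  Different edges may have the same end points, and different facets may have
the same edges. -/
structure DeltaComplex where
  /-- the vertices -/
  V : Type u
  /-- the edges -/
  E : Type u
  /-- the facets -/
  F : Type u
  [finV : Fintype V]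
  [finE : Fintype E]
  [finF : Fintype F]
  /-- the end points of an edge -/
  edgeVert : E → Fin 2 → V
  /-- the vertices of a facet -/
  faceVert : F → Fin 3 → V
  /-- the edges of a facet, each indexed by the vertex opposite to it -/
  faceEdge : F → Fin 3 → E
  /-- the face relations -/
  edgeVert_faceEdge : ∀ f i k, edgeVert (faceEdge f i) k = faceVert f (i.succAbove k)
  /-- regularity for edges -/
  edgeVert_injective : ∀ e, Function.Injective (edgeVert e)
  /-- regularity for facets -/
  faceVert_injective : ∀ f, Function.Injective (faceVert f)

namespace DeltaComplex

attribute [instance] DeltaComplex.finV DeltaComplex.finE DeltaComplex.finF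

variable (K : DeltaComplex.{u})

/-- The disjoint union of one closed standard simplex for each cell. -/
abbrev Cells : Type u :=
  (Σ _ : K.V, stdSimplex ℝ (Fin 1)) ⊕ (Σ _ : K.E, stdSimplex ℝ (Fin 2)) ⊕
    (Σ _ : K.F, stdSimplex ℝ (Fin 3))

/-- The identifications that glue the sides of each standard simplex to the corresponding faces. -/
inductive Glue : K.Cells → K.Cells → Prop
  | edge (e : K.E) (k : Fin 2) (t : stdSimplex ℝ (Fin 1)) :
      Glue (.inr (.inl ⟨e, stdSimplex.map (fun _ => k) t⟩)) (.inl ⟨K.edgeVert e k, t⟩)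
  | facet (f : K.F) (i : Fin 3) (t : stdSimplex ℝ (Fin 2)) :
      Glue (.inr (.inr ⟨f, stdSimplex.map i.succAbove t⟩)) (.inr (.inl ⟨K.faceEdge f i, t⟩))

/-- The geometric realization, with the quotient topology. -/
def Realization : Type u := Quot K.Glue

instance : TopologicalSpace K.Realization := inferInstanceAs (TopologicalSpace (Quot K.Glue))

/-- The point of the realization given by a vertex. -/
def vertexPt (v : K.V) : K.Realization := Quot.mk _ (.inl ⟨v, stdSimplex.vertex 0⟩)

/-- The characteristic map of an edge, in barycentric coordinates. -/
def edgeMap (e : K.E) (t : stdSimplex ℝ (Fin 2)) : K.Realization := Quot.mk _ (.inr (.inl ⟨e, t⟩))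

/-- The characteristic map of a facet, in barycentric coordinates. -/
def facetMap (f : K.F) (t : stdSimplex ℝ (Fin 3)) : K.Realization := Quot.mk _ (.inr (.inr ⟨f, t⟩))

/-- A facet contains an edge. -/
def FacetContains (f : K.F) (e : K.E) : Prop := ∃ i, K.faceEdge f i = e

/-- An edge contains a vertex. -/
def EdgeContains (e : K.E) (v : K.V) : Prop := ∃ k, K.edgeVert e k = v

/-- The facets containing the edge `e`, each with the index of its vertex opposite to `e`
(which is unique, because the complex is regular). -/
abbrev Star (e : K.E) : Type u := {p : K.F × Fin 3 // K.faceEdge p.1 p.2 = e}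

noncomputable instance (e : K.E) : Fintype (K.Star e) := Fintype.ofFinite _

open Classical in
/-- The number of facets containing the edge `e`. -/
noncomputable def degree (e : K.E) : ℕ := Fintype.card {f : K.F // K.FacetContains f e}

/-- Any two facets are joined by a chain of facets in which consecutive ones share an edge. -/
def ConnectedThroughCodimOne : Prop :=
  ∀ f g : K.F,
    Relation.ReflTransGen (fun a b => ∃ e, K.FacetContains a e ∧ K.FacetContains b e) f g

/-- Subcomplexes: sets of cells closed under taking faces. -/
structure Subcomplex where
  /-- the vertices -/
  verts : Set K.V
  /-- the edges -/
  edges : Set K.E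
  /-- the facets -/
  facets : Set K.F
  edgeVert_mem : ∀ e ∈ edges, ∀ k, K.edgeVert e k ∈ verts
  faceEdge_mem : ∀ f ∈ facets, ∀ i, K.faceEdge f i ∈ edges

variable {K}

/-- The closed subset of the realization covered by a subcomplex. -/
def Subcomplex.carrier (S : K.Subcomplex) : Set K.Realization :=
  {x | (∃ v ∈ S.verts, x = K.vertexPt v) ∨ (∃ e ∈ S.edges, ∃ t, x = K.edgeMap e t) ∨
    ∃ f ∈ S.facets, ∃ t, x = K.facetMap f t}

/-- The intersection of two subcomplexes. -/
def Subcomplex.inter (S T : K.Subcomplex) : K.Subcomplex where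
  verts := S.verts ∩ T.verts
  edges := S.edges ∩ T.edges
  facets := S.facets ∩ T.facets
  edgeVert_mem e he k := ⟨S.edgeVert_mem e he.1 k, T.edgeVert_mem e he.2 k⟩
  faceEdge_mem f hf i := ⟨S.faceEdge_mem f hf.1 i, T.faceEdge_mem f hf.2 i⟩

/-- `S` is a path with end points `a` and `b`: it consists of pairwise distinct vertices
`p 0 = a, …, p m = b` and of edges `q 0, …, q (m - 1)`, where `q k` joins `p k` to `p (k + 1)`.
A single vertex is a path. -/
def Subcomplex.IsPath (S : K.Subcomplex) (a b : K.V) : Prop :=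
  ∃ (m : ℕ) (p : Fin (m + 1) → K.V) (q : Fin m → K.E),
    Function.Injective p ∧ p 0 = a ∧ p (Fin.last m) = b ∧
    (∀ k, Set.range (K.edgeVert (q k)) = {p k.castSucc, p k.succ}) ∧
    S.verts = Set.range p ∧ S.edges = Set.range q ∧ S.facets = ∅

/-- A connected topological manifold of dimension two (without boundary). -/
def IsConnectedTopologicalSurface (X : Type u) [TopologicalSpace X] : Prop :=
  ConnectedSpace X ∧ T2Space X ∧ SecondCountableTopology X ∧
    Nonempty (ChartedSpace (EuclideanSpace ℝ (Fin 2)) X)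

variable (K) in
/-- The structure of a manifold with fins: `K` is the union of the subcomplex `S`, the manifold, and
of the subcomplexes `fins i`, where `fins i` meets `S` in a path from `src i` to `tgt i`, and it
meets the fins with smaller index in at most the points `src i` and `tgt i`. -/
structure ManifoldWithFins where
  /-- the manifold -/
  S : K.Subcomplex
  /-- the number of fins -/
  n : ℕ
  /-- the fins -/
  fins : Fin n → K.Subcomplex
  /-- one end point of the intersection of a fin with the manifold -/
  src : Fin n → K.V
  /-- the other end point of the intersection of a fin with the manifold -/
  tgt : Fin n → K.V
  verts_cover : ∀ v, v ∈ S.verts ∨ ∃ i, v ∈ (fins i).verts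
  edges_cover : ∀ e, e ∈ S.edges ∨ ∃ i, e ∈ (fins i).edges
  facets_cover : ∀ f, f ∈ S.facets ∨ ∃ i, f ∈ (fins i).facets
  isSurface : IsConnectedTopologicalSurface S.carrier
  contractible : ∀ i, ContractibleSpace (fins i).carrier
  isPath : ∀ i, ((fins i).inter S).IsPath (src i) (tgt i)
  verts_inter : ∀ i j, j < i → ((fins j).inter (fins i)).verts ⊆ {src i, tgt i}
  edges_inter : ∀ i j, j < i → ((fins j).inter (fins i)).edges = ∅

variable (K)

/-- The interior of the facet `f`, as a subset of the realization. -/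
def facetInterior (f : K.F) : Set K.Realization := {x | ∃ t, (∀ i, 0 < t i) ∧ x = K.facetMap f t}

theorem isOpen_facetInterior (f : K.F) : IsOpen (K.facetInterior f) := by
  have hq : Topology.IsQuotientMap (Quot.mk K.Glue) := isQuotientMap_quot_mk
  -- The preimage in the disjoint union of the closed simplices is the open simplex of `f`.
  have key : Quot.mk K.Glue ⁻¹' K.facetInterior f =
      {c | ∃ t : stdSimplex ℝ (Fin 3), (∀ i, 0 < t i) ∧ c = .inr (.inr ⟨f, t⟩)} := by
    let P : K.Cells → Prop := fun c =>
      ∃ t : stdSimplex ℝ (Fin 3), (∀ i, 0 < t i) ∧ c = .inr (.inr ⟨f, t⟩)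
    have hP : ∀ a b, K.Glue a b → P a = P b := by
      intro a b hab
      cases hab with
      | edge e k t => simp [P]
      | facet g i t =>
        simp only [P, reduceCtorEq, and_false, exists_false, eq_iff_iff, iff_false,
          Sum.inr.injEq]
        rintro ⟨s, hs, h⟩
        cases h
        have h0 := hs i
        rw [stdSimplex.map_coe, FunOnFinite.linearMap_apply_apply] at h0
        simp [Fin.succAbove_ne] at h0
    ext c
    constructor
    · rintro ⟨t, ht, h⟩
      have : Quot.lift P hP (Quot.mk _ c) = Quot.lift P hP (K.facetMap f t) := by rw [h]
      change P c
      change P c = P (.inr (.inr ⟨f, t⟩)) at this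
      rw [this]
      exact ⟨t, ht, rfl⟩
    · rintro ⟨t, ht, rfl⟩
      exact ⟨t, ht, rfl⟩
  refine hq.isOpen_preimage.1 ?_
  rw [key]
  have : {c : K.Cells | ∃ t : stdSimplex ℝ (Fin 3), (∀ i, 0 < t i) ∧ c = .inr (.inr ⟨f, t⟩)} =
      Sum.inr '' (Sum.inr '' (Sigma.mk f '' {t : stdSimplex ℝ (Fin 3) | ∀ i, 0 < t i})) := by
    ext c
    constructor
    · rintro ⟨t, ht, rfl⟩
      exact ⟨_, ⟨_, ⟨t, ht, rfl⟩, rfl⟩, rfl⟩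
    · rintro ⟨_, ⟨_, ⟨t, ht, rfl⟩, rfl⟩, rfl⟩
      exact ⟨t, ht, rfl⟩
  rw [this]
  refine isOpenMap_inr _ (isOpenMap_inr _ (isOpenMap_sigmaMk _ ?_))
  simp only [Set.ofPred_forall]
  refine isOpen_iInter_of_finite fun i => isOpen_lt continuous_const ?_
  exact (continuous_apply i).comp continuous_subtype_val

/-- The realization as an object of the category of topological spaces. -/
abbrev top : TopCat.{u} := TopCat.of K.Realization

/-- The interior of the facet `f`, as an open subset of the realization. -/
def openFacet (f : K.F) : Opens K.top := ⟨K.facetInterior f, K.isOpen_facetInterior f⟩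

end DeltaComplex

/-! ### Tropical surfaces -/

/-- A weak tropical surface: a finite connected regular `Δ`-complex of dimension at most two with
integers `α e k`, the structure constant of the edge `e` at its end point `edgeVert e k`. -/
structure WeakTropicalSurface extends DeltaComplex.{u} where
  connected : ConnectedSpace toDeltaComplex.Realization
  /-- the structure constants -/
  α : E → Fin 2 → ℤ
  sum_α : ∀ e, α e 0 + α e 1 = toDeltaComplex.degree e

namespace WeakTropicalSurface

variable (T : WeakTropicalSurface.{u})

open Classical in
/-- The structure constant of an edge `e` containing `v` at the end point of `e` other than `v`. -/
noncomputable def otherα (v : T.V) (e : T.E) : ℤ :=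
  if T.edgeVert e 0 = v then T.α e 1 else T.α e 0

/-- The edges containing the vertex `v`. -/
abbrev EdgesAt (v : T.V) : Type u := {e : T.E // T.EdgeContains e v}

open Classical in
/-- The local intersection matrix at the vertex `v`. -/
noncomputable def localMatrix (v : T.V) : Matrix (T.EdgesAt v) (T.EdgesAt v) ℝ :=
  Matrix.of fun e e' =>
    if e = e' then -(T.otherα v e : ℝ)
    else (Fintype.card {f : T.F // T.FacetContains f e ∧ T.FacetContains f e'} : ℝ)

theorem isHermitian_localMatrix (v : T.V) : (T.localMatrix v).IsHermitian := by
  classical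
  ext e e'
  simp only [localMatrix, Matrix.conjTranspose_apply, Matrix.of_apply, star_trivial]
  by_cases h : e = e'
  · simp [h]
  · rw [if_neg h, if_neg (Ne.symm h), Nat.cast_inj]
    exact Fintype.card_congr (Equiv.subtypeEquivRight fun f => and_comm)

open Classical in
/-- Each local intersection matrix has exactly one positive eigenvalue, counted with
multiplicity. -/
def IsTropicalSurface : Prop :=
  ∀ v : T.V, ∃! i, 0 < (T.isHermitian_localMatrix v).eigenvalues i

/-! ### Linear functions -/

/-- The space of vectors with one coordinate for each facet containing `e` and one coordinate for
each end point of `e`. -/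
abbrev Vec (e : T.E) : Type u := T.Star e ⊕ Fin 2 → ℝ

/-- The vector with coordinates `1` at the facets and minus the structure constants at the
end points. -/
noncomputable def relVec (e : T.E) : T.Vec e := Sum.elim (fun _ => 1) (fun k => -(T.α e k : ℝ))

/-- The quotient of `Vec e` by the line generated by `relVec e`. -/
abbrev Target (e : T.E) : Type u := T.Vec e ⧸ Submodule.span ℝ {T.relVec e}

open Classical in
/-- The image in the quotient of a standard basis vector. -/
noncomputable def basisVec (e : T.E) (i : T.Star e ⊕ Fin 2) : T.Target e :=
  Submodule.Quotient.mk (Pi.single i 1)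

/-- The map from (the neighbourhood of) the edge `e` to `Target e`, on the edge itself. -/
noncomputable def φEdge (e : T.E) (t : stdSimplex ℝ (Fin 2)) : T.Target e :=
  ∑ k, t k • T.basisVec e (.inr k)

/-- The map from (the neighbourhood of) the edge `e` to `Target e`, on a facet containing `e`. -/
noncomputable def φFacet (e : T.E) (p : T.Star e) (t : stdSimplex ℝ (Fin 3)) : T.Target e :=
  t p.1.2 • T.basisVec e (.inl p) + ∑ k, t (p.1.2.succAbove k) • T.basisVec e (.inr k)

/-- The function `φ` on `U` is affine linear with integral slopes on the interior of `f`; here `y i`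
is the value of the affine function at the `i`-th vertex of `f`. -/
def LinearOnFacet {U : Opens T.top} (φ : U → ℝ) (f : T.F) : Prop :=
  ∃ y : Fin 3 → ℝ, (∀ i j, ∃ n : ℤ, y i - y j = n) ∧
    ∀ (t : stdSimplex ℝ (Fin 3)) (h : T.facetMap f t ∈ U), (∀ i, 0 < t i) →
      φ ⟨T.facetMap f t, h⟩ = ∑ i, t i * y i

/-- On the part of `U` in the union of the interiors of `e` and of the facets containing `e`, the
function `φ` is induced by a linear function with integral slopes on `Target e`. -/
def LinearAtEdge {U : Opens T.top} (φ : U → ℝ) (e : T.E) : Prop :=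
  ∃ l : T.Target e →ₗ[ℝ] ℝ, (∀ i j, ∃ n : ℤ, l (T.basisVec e i) - l (T.basisVec e j) = n) ∧
    (∀ (t : stdSimplex ℝ (Fin 2)) (h : T.edgeMap e t ∈ U), (∀ k, 0 < t k) →
      φ ⟨T.edgeMap e t, h⟩ = l (T.φEdge e t)) ∧
    ∀ (p : T.Star e) (t : stdSimplex ℝ (Fin 3)) (h : T.facetMap p.1.1 t ∈ U), (∀ i, 0 < t i) →
      φ ⟨T.facetMap p.1.1 t, h⟩ = l (T.φFacet e p t)

/-- The interior of the edge `e` meets `U`. -/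
def EdgeMeets (U : Opens T.top) (e : T.E) : Prop :=
  ∃ t : stdSimplex ℝ (Fin 2), (∀ k, 0 < t k) ∧ T.edgeMap e t ∈ U

/-- The linearity condition, before imposing locality. -/
def linearPrelocal : TopCat.PrelocalPredicate (fun _ : T.top => ℝ) where
  pred {U} φ := Continuous φ ∧ (∀ f, T.LinearOnFacet φ f) ∧
    ∀ e, T.EdgeMeets U e → T.LinearAtEdge φ e
  res {U V} i φ := by
    rintro ⟨hc, hf, he⟩
    refine ⟨hc.comp (Opens.isOpenEmbedding_of_le i.le).continuous, fun f => ?_, fun e hm => ?_⟩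
    · obtain ⟨y, hy, h⟩ := hf f
      exact ⟨y, hy, fun t ht => h t (i.le ht)⟩
    · obtain ⟨l, hl, h1, h2⟩ := he e (hm.imp fun t ht => ⟨ht.1, i.le ht.2⟩)
      exact ⟨l, hl, fun t ht => h1 t (i.le ht), fun p t ht => h2 p t (i.le ht)⟩

/-- The linear functions: functions that satisfy the linearity condition locally. -/
def linear : TopCat.LocalPredicate (fun _ : T.top => ℝ) := T.linearPrelocal.sheafify

end WeakTropicalSurface

/-! ### Sheaves of groups of real functions -/

/-- The locally constant functions. -/
def locConst (X : TopCat.{u}) : TopCat.LocalPredicate (fun _ : X => ℝ) where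
  pred {U} φ := IsLocallyConstant φ
  res i φ h := h.comp_continuous (Opens.isOpenEmbedding_of_le i.le).continuous
  locality {U} φ h := by
    rw [IsLocallyConstant.iff_exists_open]
    intro x
    obtain ⟨V, hV, i, h⟩ := h x
    obtain ⟨W, hW, hx, hc⟩ := (IsLocallyConstant.iff_exists_open _).1 h ⟨x, hV⟩
    have hVU := Opens.isOpenEmbedding_of_le i.le
    refine ⟨(fun y : V => i y) '' W, hVU.isOpenMap _ hW, ⟨_, hx, rfl⟩, ?_⟩
    rintro _ ⟨y, hy, rfl⟩
    exact hc y hy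

/-- A local condition on real functions that defines a group of functions on each open set. -/
structure IsAddGroupPredicate {X : TopCat.{u}} (P : TopCat.LocalPredicate (fun _ : X => ℝ)) :
    Prop where
  zero : ∀ U : Opens X, P.pred (fun _ : U => (0 : ℝ))
  add : ∀ (U : Opens X) (φ ψ : U → ℝ), P.pred φ → P.pred ψ → P.pred (fun x => φ x + ψ x)
  neg : ∀ (U : Opens X) (φ : U → ℝ), P.pred φ → P.pred (fun x => -φ x)

namespace IsAddGroupPredicate

variable {X : TopCat.{u}} {P Q : TopCat.LocalPredicate (fun _ : X => ℝ)}

/-- The group of sections on `U`. -/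
def sections (h : IsAddGroupPredicate P) (U : Opens X) : AddSubgroup (U → ℝ) where
  carrier := {φ | P.pred φ}
  zero_mem' := h.zero U
  add_mem' := fun {φ ψ} h1 h2 => h.add U φ ψ h1 h2
  neg_mem' := fun {φ} h1 => h.neg U φ h1

/-- The presheaf of groups of sections, with the restriction of functions. -/
def presheaf (h : IsAddGroupPredicate P) : TopCat.Presheaf AddCommGrpCat.{u} X where
  obj U := AddCommGrpCat.of (h.sections U.unop)
  map i := AddCommGrpCat.ofHom
    { toFun := fun φ => ⟨fun x => φ.1 (i.unop x), P.res i.unop φ.1 φ.2⟩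
      map_zero' := rfl
      map_add' := fun _ _ => rfl }

/-- The sheaf of groups of sections. -/
def sheaf (h : IsAddGroupPredicate P) : TopCat.Sheaf AddCommGrpCat.{u} X :=
  ⟨h.presheaf, by
    refine (TopCat.Presheaf.isSheaf_iff_isSheaf_comp (CategoryTheory.forget AddCommGrpCat.{u}) _).2 ?_
    exact TopCat.subpresheafToTypes.isSheaf P⟩

/-- The inclusion of a sheaf of functions in a larger one. -/
def inclusion (hP : IsAddGroupPredicate P) (hQ : IsAddGroupPredicate Q)
    (hPQ : ∀ (U : Opens X) (φ : U → ℝ), P.pred φ → Q.pred φ) : hP.sheaf ⟶ hQ.sheaf :=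
  ⟨{ app := fun U => AddCommGrpCat.ofHom
      (X := hP.sections U.unop) (Y := hQ.sections U.unop)
      { toFun := fun φ => ⟨φ.1, hPQ _ φ.1 φ.2⟩
        map_zero' := rfl
        map_add' := fun _ _ => rfl }
     naturality := fun _ _ _ => rfl }⟩

end IsAddGroupPredicate

theorem isAddGroupPredicate_locConst (X : TopCat.{u}) : IsAddGroupPredicate (locConst X) where
  zero _ := IsLocallyConstant.const 0
  add _ _ _ h1 h2 := h1.add h2
  neg _ _ h := h.neg

namespace WeakTropicalSurface

variable (T : WeakTropicalSurface.{u})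

theorem pred_zero (U : Opens T.top) : T.linearPrelocal.pred (fun _ : U => (0 : ℝ)) := by
  refine ⟨continuous_const, fun f => ⟨0, fun _ _ => ⟨0, by simp⟩, by simp⟩,
    fun e _ => ⟨0, fun _ _ => ⟨0, by simp⟩, by simp, by simp⟩⟩

theorem pred_neg {U : Opens T.top} {φ : U → ℝ} (h : T.linearPrelocal.pred φ) :
    T.linearPrelocal.pred (fun x => -φ x) := by
  obtain ⟨hc, hf, he⟩ := h
  refine ⟨hc.neg, fun f => ?_, fun e hm => ?_⟩
  · obtain ⟨y, hy, h⟩ := hf f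
    refine ⟨-y, fun i j => ?_, fun t ht h0 => by simp [h t ht h0]⟩
    obtain ⟨n, hn⟩ := hy i j
    exact ⟨-n, by push_cast; rw [← hn]; simp only [Pi.neg_apply]; ring⟩
  · obtain ⟨l, hl, h1, h2⟩ := he e hm
    refine ⟨-l, fun i j => ?_, fun t ht h0 => by simp [h1 t ht h0],
      fun p t ht h0 => by simp [h2 p t ht h0]⟩
    obtain ⟨n, hn⟩ := hl i j
    exact ⟨-n, by push_cast; rw [← hn]; simp only [LinearMap.neg_apply]; ring⟩

theorem pred_add {U : Opens T.top} {φ ψ : U → ℝ} (h : T.linearPrelocal.pred φ)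
    (h' : T.linearPrelocal.pred ψ) : T.linearPrelocal.pred (fun x => φ x + ψ x) := by
  obtain ⟨hc, hf, he⟩ := h
  obtain ⟨hc', hf', he'⟩ := h'
  refine ⟨hc.add hc', fun f => ?_, fun e hm => ?_⟩
  · obtain ⟨y, hy, h⟩ := hf f
    obtain ⟨y', hy', h'⟩ := hf' f
    refine ⟨y + y', fun i j => ?_, fun t ht h0 => by
      simp [h t ht h0, h' t ht h0, mul_add, Finset.sum_add_distrib]⟩
    obtain ⟨n, hn⟩ := hy i j
    obtain ⟨n', hn'⟩ := hy' i j
    exact ⟨n + n', by push_cast; rw [← hn, ← hn']; simp only [Pi.add_apply]; ring⟩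
  · obtain ⟨l, hl, h1, h2⟩ := he e hm
    obtain ⟨l', hl', h1', h2'⟩ := he' e hm
    refine ⟨l + l', fun i j => ?_, fun t ht h0 => by simp [h1 t ht h0, h1' t ht h0],
      fun p t ht h0 => by simp [h2 p t ht h0, h2' p t ht h0]⟩
    obtain ⟨n, hn⟩ := hl i j
    obtain ⟨n', hn'⟩ := hl' i j
    exact ⟨n + n', by push_cast; rw [← hn, ← hn']; simp only [LinearMap.add_apply]; ring⟩

theorem isAddGroupPredicate_linear : IsAddGroupPredicate T.linear where
  zero U := TopCat.PrelocalPredicate.sheafifyOf (T.pred_zero U)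
  add U φ ψ h h' := by
    intro x
    obtain ⟨V, hV, i, h⟩ := h x
    obtain ⟨V', hV', i', h'⟩ := h' x
    exact ⟨V ⊓ V', ⟨hV, hV'⟩, Opens.infLELeft _ _ ≫ i,
      T.pred_add (T.linearPrelocal.res (Opens.infLELeft V V') _ h)
        (T.linearPrelocal.res (Opens.infLERight V V') _ h')⟩
  neg U φ h := by
    intro x
    obtain ⟨V, hV, i, h⟩ := h x
    exact ⟨V, hV, i, T.pred_neg h⟩

theorem card_star (e : T.E) : Fintype.card (T.Star e) = T.degree e := by
  classical
  unfold DeltaComplex.degree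
  refine Fintype.card_of_bijective
    (f := fun p : T.Star e => (⟨p.1.1, p.1.2, p.2⟩ : {f // T.FacetContains f e})) ⟨?_, ?_⟩
  · rintro ⟨⟨f, i⟩, hi⟩ ⟨⟨g, j⟩, hj⟩ h
    obtain rfl : f = g := congrArg Subtype.val h
    have hij : i = j := by
      by_contra hne
      -- The edges opposite to different vertices of a facet have different end points.
      have hr : Set.range (fun k => T.faceVert f (i.succAbove k)) =
          Set.range (fun k => T.faceVert f (j.succAbove k)) := by
        simp only [← T.edgeVert_faceEdge]
        rw [show T.faceEdge f i = e from hi, show T.faceEdge f j = e from hj]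
      obtain ⟨k, hk⟩ := Fin.exists_succAbove_eq hne
      have hm : T.faceVert f i ∈ Set.range (fun k => T.faceVert f (j.succAbove k)) :=
        ⟨k, by simp [hk]⟩
      rw [← hr] at hm
      obtain ⟨k', hk'⟩ := hm
      exact Fin.succAbove_ne i k' (T.faceVert_injective f hk')
    subst hij
    rfl
  · rintro ⟨f, i, hi⟩
    exact ⟨⟨(f, i), hi⟩, rfl⟩

theorem pred_const (U : Opens T.top) (c : ℝ) : T.linearPrelocal.pred (fun _ : U => c) := by
  classical
  refine ⟨continuous_const, fun f => ⟨fun _ => c, fun _ _ => ⟨0, by simp⟩, fun t _ _ => ?_⟩,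
    fun e _ => ?_⟩
  · rw [← Finset.sum_mul]
    have : ∑ i, t i = 1 := t.2.2
    rw [this, one_mul]
  · let l₀ : T.Vec e →ₗ[ℝ] ℝ := c • ∑ i, LinearMap.proj i
    have hl₀ : Submodule.span ℝ {T.relVec e} ≤ LinearMap.ker l₀ := by
      rw [Submodule.span_singleton_le_iff_mem, LinearMap.mem_ker]
      have h := T.sum_α e
      rw [← T.card_star e] at h
      have h' : (T.α e 0 : ℝ) + T.α e 1 = Fintype.card (T.Star e) := by exact_mod_cast h
      have h0 : ∑ i, T.relVec e i = 0 := by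
        simp only [relVec, Fintype.sum_sum_type, Sum.elim_inl, Sum.elim_inr, Fin.sum_univ_two,
          Finset.sum_const, Finset.card_univ, nsmul_eq_mul, mul_one]
        rw [← h']
        ring
      simp [l₀, LinearMap.sum_apply, h0, -Fintype.sum_sum_type]
    let l : T.Target e →ₗ[ℝ] ℝ := (Submodule.span ℝ {T.relVec e}).liftQ l₀ hl₀
    have hb : ∀ i, l (T.basisVec e i) = c := by
      intro i
      change l₀ (Pi.single i 1) = c
      simp [l₀, LinearMap.sum_apply, -Fintype.sum_sum_type]
    refine ⟨l, fun i j => ⟨0, by simp [hb]⟩, fun t _ _ => ?_, fun p t _ _ => ?_⟩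
    · have : ∑ i, t i = 1 := t.2.2
      simp only [φEdge, map_sum, map_smul, hb, smul_eq_mul]
      rw [← Finset.sum_mul, this, one_mul]
    · have : ∑ i, t i = 1 := t.2.2
      rw [Fin.sum_univ_succAbove _ p.1.2] at this
      simp only [φFacet, map_add, map_sum, map_smul, hb, smul_eq_mul]
      rw [← Finset.sum_mul, ← add_mul, this, one_mul]

theorem linear_of_locConst (U : Opens T.top) (φ : U → ℝ) (h : (locConst T.top).pred φ) :
    T.linear.pred φ := by
  intro x
  obtain ⟨W, hW, hx, hc⟩ := (IsLocallyConstant.iff_exists_open φ).1 h x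
  refine ⟨⟨Subtype.val '' W, U.isOpen.isOpenMap_subtype_val W hW⟩, ⟨x, hx, rfl⟩,
    homOfLE (by rintro _ ⟨y, -, rfl⟩; exact y.2), ?_⟩
  convert! T.pred_const _ (φ x) using 1
  funext ⟨_, y, hy, rfl⟩
  exact hc y hy

/-- The sheaf of linear functions. -/
def sheafA : TopCat.Sheaf AddCommGrpCat.{u} T.top := T.isAddGroupPredicate_linear.sheaf

/-- The sheaf of locally constant real functions. -/
def sheafR : TopCat.Sheaf AddCommGrpCat.{u} T.top := (isAddGroupPredicate_locConst T.top).sheaf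

/-- The inclusion of the locally constant functions in the linear functions. -/
def incl : T.sheafR ⟶ T.sheafA :=
  (isAddGroupPredicate_locConst T.top).inclusion T.isAddGroupPredicate_linear T.linear_of_locConst

/-- The quotient of the sheaf of linear functions by the locally constant functions, formed in the
category of sheaves of abelian groups. -/
noncomputable def sheafD : TopCat.Sheaf AddCommGrpCat.{u} T.top := Limits.cokernel T.incl

/-- The group of sections of the quotient sheaf over `U`. -/
noncomputable abbrev H0D (U : Opens T.top) : AddCommGrpCat.{u} := T.sheafD.presheaf.obj (op U)

/-- The restriction from the global sections of the quotient sheaf to its sections over `U`. -/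
noncomputable def restrict (U : Opens T.top) : T.H0D ⊤ →+ T.H0D U :=
  (T.sheafD.presheaf.map (homOfLE (le_top : U ≤ ⊤)).op).hom

end WeakTropicalSurface

/-! ### Symmetric matrices with one positive eigenvalue -/

/-! A section of $\mathcal D$ is locally a linear function up to constants, so it has a well-defined
integral slope $c(e)$ along each oriented edge (`exists_cocycle`). Affineness on the facets makes
$c$ a cocycle. Factoring through $\phi_e$ near each edge makes $c$ balanced: at every vertex $v$ the
vector of slopes of the edges leaving $v$ lies in the kernel of $M_v$. A section with vanishing
slopes is zero (`eq_zero_of_hasSlopes`), so injectivity reduces to `eq_zero_of_zeroFacet`: a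
balanced cocycle that vanishes on one facet of $\Sigma$ vanishes everywhere.

On $\Sigma$ this is a nodal domain argument. Regard the edges at $v$ as the nodes of the link and
the facets at $v$ as its arcs. The part of the link in $\Sigma$ is a cycle, and each fin through $v$
adds a branch. The matrix $M_v$ has nonnegative entries off the diagonal and exactly one positive
eigenvalue, so a kernel vector cannot have two separated negative parts of the kind excluded by
`Matrix.nodal_contradiction`. Suppose $c$ vanishes on one facet of $\Sigma$ but not on its neighbour
across $e$. The row of $e$ then forces $e$ into a fin, and the nodal argument gives another such
edge at an end point of $e$ in the same fin (`IsTransition.exists_ne`). Both lie on the path in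
which the fin meets $\Sigma$, and the last such edge on the path gives a contradiction
(`zeroFacet_of_adjacent`). The ordering of the fins guarantees that, at an inner vertex of this
path, every other fin meets the cycle in at most one edge.

The local topology of $\Sigma$ comes from charts. A punctured disc is connected, which makes the
links connected. Winding numbers show that an edge lies in exactly two facets.

On a fin $F$ the cocycle has a potential, since $F$ is contractible; it is constant on the path
$F\cap\Sigma$. A maximum principle (`eq_zero_of_local_max`) shows that a local maximum off $\Sigma$
is attained at all neighbours, so the maximum and, by symmetry, the minimum over the fin are the
value on the path. If the principle failed at $v$, there would be a positive vector $x$ with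
$M_vx\le 0$, which makes $M_v$ negative semidefinite. Connectedness through codimension one enters
here: whatever $v$ cuts off from $\Sigma$ hangs on edges without facets, and their structure
constants have a known sign.

Over the interior of a facet, sections are affine functions with integral slopes modulo constants,
hence $\mathbb Z^2$. -/

open Matrix in
-- Take for `u` the eigenvector of the positive eigenvalue in an orthonormal eigenbasis. For `z`
-- orthogonal to `u` the form is a sum of nonpositive terms, eigenvalue times squared coefficient;
-- if the sum is zero, every coefficient at a nonzero eigenvalue vanishes.
theorem Matrix.IsHermitian.exists_of_existsUnique_pos {ι : Type*} [Fintype ι] [DecidableEq ι]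
    {M : Matrix ι ι ℝ} (hM : M.IsHermitian) (h : ∃! i, 0 < hM.eigenvalues i) :
    ∃ u : ι → ℝ, 0 < u ⬝ᵥ M *ᵥ u ∧ ∀ z, u ⬝ᵥ z = 0 →
      z ⬝ᵥ M *ᵥ z ≤ 0 ∧ (z ⬝ᵥ M *ᵥ z = 0 → M *ᵥ z = 0) := by
  obtain ⟨i₀, hi₀, huniq⟩ := h
  set b := hM.eigenvectorBasis with hb
  set l := hM.eigenvalues with hl
  have hbM : ∀ j, M *ᵥ (b j).ofLp = l j • (b j).ofLp := hM.mulVec_eigenvectorBasis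
  have hinner : ∀ i j, (b i).ofLp ⬝ᵥ (b j).ofLp = if i = j then 1 else 0 := by
    intro i j
    have := orthonormal_iff_ite.1 b.orthonormal i j
    rw [← this, EuclideanSpace.inner_eq_star_dotProduct, dotProduct_comm]
    simp
  have hrepr : ∀ z : ι → ℝ, z = ∑ i, ((b i).ofLp ⬝ᵥ z) • (b i).ofLp := by
    intro z
    have := b.sum_repr' (WithLp.toLp 2 z)
    have h2 := congrArg WithLp.ofLp this
    simp only [WithLp.ofLp_sum, WithLp.ofLp_smul] at h2
    refine h2.symm.trans (Finset.sum_congr rfl fun i _ => ?_)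
    rw [EuclideanSpace.inner_eq_star_dotProduct]
    simp [dotProduct_comm]
  refine ⟨(b i₀).ofLp, ?_, fun z hz => ?_⟩
  · rw [hbM, dotProduct_smul, hinner]
    simpa using hi₀
  · have hMz : M *ᵥ z = ∑ i, (((b i).ofLp ⬝ᵥ z) * l i) • (b i).ofLp := by
      conv_lhs => rw [hrepr z]
      rw [mulVec_sum]
      refine Finset.sum_congr rfl fun i _ => ?_
      rw [mulVec_smul, hbM, smul_smul]
    have hq : z ⬝ᵥ M *ᵥ z = ∑ i, l i * ((b i).ofLp ⬝ᵥ z) ^ 2 := by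
      rw [hMz, dotProduct_sum]
      refine Finset.sum_congr rfl fun i _ => ?_
      rw [dotProduct_smul, dotProduct_comm z, smul_eq_mul]
      ring
    have hle : ∀ i, l i * ((b i).ofLp ⬝ᵥ z) ^ 2 ≤ 0 := by
      intro i
      by_cases hi : i = i₀
      · simp [hi, hz]
      · exact mul_nonpos_of_nonpos_of_nonneg (not_lt.1 fun h => hi (huniq i h)) (sq_nonneg _)
    refine ⟨hq ▸ Finset.sum_nonpos fun i _ => hle i, fun h0 => ?_⟩
    rw [hq, Finset.sum_eq_zero_iff_of_nonpos fun i _ => hle i] at h0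
    rw [hMz]
    refine Finset.sum_eq_zero fun i _ => ?_
    have := h0 i (Finset.mem_univ i)
    rcases mul_eq_zero.1 this with h | h
    · simp [h]
    · simp [pow_eq_zero_iff two_ne_zero |>.1 h]

open Matrix in
/-- A matrix with nonnegative entries off the diagonal that maps a positive vector to a nonpositive
vector is negative semidefinite. -/
theorem Matrix.dotProduct_mulVec_nonpos_of_mulVec_nonpos {ι : Type*} [Fintype ι]
    {M : Matrix ι ι ℝ} (hM : ∀ i j, M i j = M j i) (hoff : ∀ i j, i ≠ j → 0 ≤ M i j)
    {x : ι → ℝ} (hx : ∀ i, 0 < x i) (hMx : ∀ i, (M *ᵥ x) i ≤ 0) (z : ι → ℝ) :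
    z ⬝ᵥ M *ᵥ z ≤ 0 := by
  -- Up to the term in `M *ᵥ x`, the form is minus a sum of squares weighted by the entries of `M`.
  -- The diagonal entries, whose sign is unknown, drop out because their squares are zero.
  have key : ∑ i, ∑ j, M i j * x i * x j * (z i / x i - z j / x j) ^ 2 =
      2 * (∑ i, (z i) ^ 2 / x i * (M *ᵥ x) i - z ⬝ᵥ M *ᵥ z) := by
    have e1 : ∑ i, ∑ j, M i j * x i * x j * (z i / x i - z j / x j) ^ 2 =
        ∑ i, (z i) ^ 2 / x i * ∑ j, M i j * x j + ∑ i, ∑ j, (z j) ^ 2 / x j * (M j i * x i)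
          - 2 * ∑ i, ∑ j, z i * (M i j * z j) := by
      simp only [Finset.mul_sum, ← Finset.sum_add_distrib, ← Finset.sum_sub_distrib]
      refine Finset.sum_congr rfl fun i _ => Finset.sum_congr rfl fun j _ => ?_
      have := (hx i).ne'
      have := (hx j).ne'
      rw [hM j i]
      field_simp
      ring
    rw [e1, Finset.sum_comm (f := fun i j => (z j) ^ 2 / x j * (M j i * x i))]
    simp only [dotProduct, mulVec, Finset.mul_sum]
    simp only [mul_sub, Finset.mul_sum, ← Finset.sum_sub_distrib, ← Finset.sum_add_distrib]
    exact Finset.sum_congr rfl fun i _ => Finset.sum_congr rfl fun j _ => by ring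
  have h1 : 0 ≤ ∑ i, ∑ j, M i j * x i * x j * (z i / x i - z j / x j) ^ 2 := by
    refine Finset.sum_nonneg fun i _ => Finset.sum_nonneg fun j _ => ?_
    by_cases hij : i = j
    · simp [hij]
    · have := hoff i j hij
      have := hx i
      have := hx j
      positivity
  have h2 : ∑ i, (z i) ^ 2 / x i * (M *ᵥ x) i ≤ 0 :=
    Finset.sum_nonpos fun i _ => mul_nonpos_of_nonneg_of_nonpos
      (div_nonneg (sq_nonneg _) (hx i).le) (hMx i)
  linarith

open Matrix in
/-- A nodal domain theorem: a vector in the kernel of a symmetric matrix with one positive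
eigenvalue and nonnegative entries off the diagonal cannot have two non-adjacent negative parts
that are told apart by zeros. -/
theorem Matrix.nodal_contradiction {ι : Type*} [Fintype ι]
    {M : Matrix ι ι ℝ} (hM : ∀ i j, M i j = M j i) (hoff : ∀ i j, i ≠ j → 0 ≤ M i j)
    {u : ι → ℝ} (hu : ∀ z, u ⬝ᵥ z = 0 → z ⬝ᵥ M *ᵥ z ≤ 0 ∧ (z ⬝ᵥ M *ᵥ z = 0 → M *ᵥ z = 0))
    {x : ι → ℝ} (hMx : M *ᵥ x = 0) (R : ι → Prop)
    (hsep : ∀ j k, x j < 0 → R j → x k < 0 → ¬ R k → M j k = 0)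
    {e b : ι} (he : x e = 0) (heR : ∃ j, x j < 0 ∧ R j ∧ M e j ≠ 0)
    (hb : x b = 0) (hbR : ∃ j, x j < 0 ∧ ¬ R j ∧ M b j ≠ 0)
    (hbR' : ∀ j, x j < 0 → R j → M b j = 0) : False := by
  classical
  -- The positive part of `x` and its two negative parts. The form turns out to be nonnegative on
  -- their combinations, whereas it is nonpositive on the hyperplane orthogonal to `u`, so all
  -- combinations in that hyperplane lie in the kernel.
  let y1 : ι → ℝ := fun i => if 0 < x i then x i else 0
  let y2 : ι → ℝ := fun i => if x i < 0 ∧ R i then x i else 0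
  let y3 : ι → ℝ := fun i => if x i < 0 ∧ ¬ R i then x i else 0
  have hx : x = y1 + y2 + y3 := by
    funext i
    simp only [y1, y2, y3, Pi.add_apply]
    rcases lt_trichotomy (x i) 0 with h | h | h
    · by_cases hR : R i <;> simp [h, hR, h.le]
    · simp [h]
    · simp [h, h.not_gt]
  have hq : ∀ a b : ι → ℝ, a ⬝ᵥ M *ᵥ b = b ⬝ᵥ M *ᵥ a := by
    intro a b
    simp only [dotProduct, mulVec, Finset.mul_sum]
    rw [Finset.sum_comm]
    refine Finset.sum_congr rfl fun i _ => Finset.sum_congr rfl fun j _ => ?_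
    rw [hM j i]; ring
  have hle : ∀ a b : ι → ℝ, (∀ i j, a i * (M i j * b j) ≤ 0) → a ⬝ᵥ M *ᵥ b ≤ 0 := by
    intro a b h
    simp only [dotProduct, mulVec, Finset.mul_sum]
    exact Finset.sum_nonpos fun i _ => Finset.sum_nonpos fun j _ => h i j
  have h12 : y1 ⬝ᵥ M *ᵥ y2 ≤ 0 := by
    refine hle _ _ fun i j => ?_
    simp only [y1, y2]
    split_ifs with h1 h2
    · have hij : i ≠ j := by rintro rfl; exact lt_asymm h1 h2.1
      exact mul_nonpos_of_nonneg_of_nonpos h1.le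
        (mul_nonpos_of_nonneg_of_nonpos (hoff i j hij) h2.1.le)
    all_goals simp
  have h13 : y1 ⬝ᵥ M *ᵥ y3 ≤ 0 := by
    refine hle _ _ fun i j => ?_
    simp only [y1, y3]
    split_ifs with h1 h2
    · have hij : i ≠ j := by rintro rfl; exact lt_asymm h1 h2.1
      exact mul_nonpos_of_nonneg_of_nonpos h1.le
        (mul_nonpos_of_nonneg_of_nonpos (hoff i j hij) h2.1.le)
    all_goals simp
  have h23 : y2 ⬝ᵥ M *ᵥ y3 = 0 := by
    simp only [dotProduct, mulVec, Finset.mul_sum]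
    refine Finset.sum_eq_zero fun i _ => Finset.sum_eq_zero fun j _ => ?_
    simp only [y2, y3]
    split_ifs with h1 h2
    · simp [hsep i j h1.1 h1.2 h2.1 h2.2]
    all_goals simp
  have h0 : ∀ y : ι → ℝ, y ⬝ᵥ M *ᵥ y1 + y ⬝ᵥ M *ᵥ y2 + y ⬝ᵥ M *ᵥ y3 = 0 := by
    intro y
    rw [← dotProduct_add, ← dotProduct_add, ← mulVec_add, ← mulVec_add, ← hx, hMx,
      dotProduct_zero]
  -- every combination orthogonal to `u` lies in the kernel
  have hker : ∀ a1 a2 a3 : ℝ, a1 * (u ⬝ᵥ y1) + a2 * (u ⬝ᵥ y2) + a3 * (u ⬝ᵥ y3) = 0 →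
      a1 • M *ᵥ y1 + a2 • M *ᵥ y2 + a3 • M *ᵥ y3 = 0 := by
    intro a1 a2 a3 ha
    have hz := hu (a1 • y1 + a2 • y2 + a3 • y3) (by
      simpa [dotProduct_add, dotProduct_smul] using ha)
    -- The diagonal values of the form are eliminated with the relations obtained by pairing `M *ᵥ x
    -- = 0` with `y1`, `y2`, `y3`; the mixed term of `y2` and `y3` is zero.
    have e : (a1 • y1 + a2 • y2 + a3 • y3) ⬝ᵥ M *ᵥ (a1 • y1 + a2 • y2 + a3 • y3) =
        -(y1 ⬝ᵥ M *ᵥ y2) * (a1 - a2) ^ 2 + -(y1 ⬝ᵥ M *ᵥ y3) * (a1 - a3) ^ 2 := by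
      simp only [mulVec_add, mulVec_smul, dotProduct_add, add_dotProduct, dotProduct_smul,
        smul_dotProduct, smul_eq_mul]
      have r1 := h0 y1
      have r2 := h0 y2
      have r3 := h0 y3
      rw [hq y2 y1] at *
      rw [hq y3 y1] at *
      rw [hq y3 y2] at *
      rw [h23] at *
      linear_combination a1 ^ 2 * r1 + a2 ^ 2 * r2 + a3 ^ 2 * r3
    have hnn : 0 ≤ (a1 • y1 + a2 • y2 + a3 • y3) ⬝ᵥ M *ᵥ (a1 • y1 + a2 • y2 + a3 • y3) := by
      rw [e]
      exact add_nonneg (mul_nonneg (by linarith) (sq_nonneg _))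
        (mul_nonneg (by linarith) (sq_nonneg _))
    have := hz.2 (le_antisymm hz.1 hnn)
    simpa [mulVec_add, mulVec_smul] using this
  have hrow : ∀ i, (M *ᵥ y1) i + (M *ᵥ y2) i + (M *ᵥ y3) i = 0 := by
    intro i
    have := congrFun hMx i
    rw [hx, mulVec_add, mulVec_add] at this
    exact this
  have hneg : ∀ (y : ι → ℝ) (r : ι), (∀ j, y j ≤ 0) → (∃ j, j ≠ r ∧ y j < 0 ∧ M r j ≠ 0) →
      y r = 0 → (M *ᵥ y) r < 0 := by
    intro y r hy ⟨j, hjr, hj, hMj⟩ hyr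
    have : ∀ k, M r k * y k ≤ 0 := by
      intro k
      by_cases hk : r = k
      · rw [← hk, hyr, mul_zero]
      · exact mul_nonpos_of_nonneg_of_nonpos (hoff r k hk) (hy k)
    refine Finset.sum_neg' (fun k _ => this k) ⟨j, Finset.mem_univ _, ?_⟩
    exact mul_neg_of_pos_of_neg (lt_of_le_of_ne (hoff r j hjr.symm) hMj.symm) hj
  have hy2 : ∀ j, y2 j ≤ 0 := fun j => by simp only [y2]; split_ifs with h; exacts [h.1.le, le_rfl]
  have hy3 : ∀ j, y3 j ≤ 0 := fun j => by simp only [y3]; split_ifs with h; exacts [h.1.le, le_rfl]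
  have pe : (M *ᵥ y2) e < 0 := by
    obtain ⟨j, hj, hR, hMj⟩ := heR
    refine hneg _ _ hy2 ⟨j, by rintro rfl; exact hj.ne he, ?_, hMj⟩ (by simp [y2, he])
    simp [y2, hj, hR]
  have pb : (M *ᵥ y3) b < 0 := by
    obtain ⟨j, hj, hR, hMj⟩ := hbR
    refine hneg _ _ hy3 ⟨j, by rintro rfl; exact hj.ne hb, ?_, hMj⟩ (by simp [y3, hb])
    simp [y3, hj, hR]
  have qb : (M *ᵥ y2) b = 0 := by
    refine Finset.sum_eq_zero fun j _ => ?_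
    simp only [y2]
    split_ifs with h
    · simp [hbR' j h.1 h.2]
    · simp
  -- Row `b` does not see `y2`, so it compares `a1` with `a3`; row `e` then compares `a1` with `a2`.
  -- Only multiples of `x` itself can lie in the kernel.
  have heq : ∀ a1 a2 a3 : ℝ, a1 * (u ⬝ᵥ y1) + a2 * (u ⬝ᵥ y2) + a3 * (u ⬝ᵥ y3) = 0 →
      a1 = a3 ∧ a1 = a2 := by
    intro a1 a2 a3 ha
    have hb' := congrFun (hker a1 a2 a3 ha) b
    have he' := congrFun (hker a1 a2 a3 ha) e
    simp only [Pi.add_apply, Pi.smul_apply, smul_eq_mul, Pi.zero_apply] at hb' he'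
    have rb := hrow b
    have re := hrow e
    rw [qb] at hb' rb
    have h13 : a1 = a3 := by
      have : (a3 - a1) * (M *ᵥ y3) b = 0 := by linear_combination hb' - a1 * rb
      rcases mul_eq_zero.1 this with h | h
      · linarith
      · exact absurd h pb.ne
    refine ⟨h13, ?_⟩
    have : (a2 - a1) * (M *ᵥ y2) e = 0 := by
      rw [← h13] at he'
      linear_combination he' - a1 * re
    rcases mul_eq_zero.1 this with h | h
    · linarith
    · exact absurd h pe.ne
  -- The coefficient vectors orthogonal to `u` form a space of dimension at least two, so they are
  -- not all constant: the first choice forces `u ⬝ᵥ y1 = 0`, and then `(1, 0, 0)` is an admissible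
  -- nonconstant choice.
  have k1 := (heq (u ⬝ᵥ y2) (-(u ⬝ᵥ y1)) 0 (by ring))
  have k2 := (heq 1 0 0 (by rw [show u ⬝ᵥ y1 = 0 by linarith [k1.1, k1.2]]; ring))
  norm_num at k2

/-! ### Continuous logarithms -/

/-- The contraction run backwards is a homotopy from a constant map to `f`. It lifts along the
covering `exp`, starting from a constant logarithm. -/
theorem exists_continuous_log {A : Type*} [TopologicalSpace A] [ContractibleSpace A]
    {f : A → ℂ} (hf : Continuous f) (h0 : ∀ a, f a ≠ 0) :
    ∃ g : A → ℂ, Continuous g ∧ ∀ a, Complex.exp (g a) = f a := by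
  obtain ⟨a₀, ⟨h⟩⟩ := id_nullhomotopic A
  let F : C(A, {z : ℂ // z ≠ 0}) := ⟨fun a => ⟨f a, h0 a⟩, by fun_prop⟩
  let H : C(unitInterval × A, {z : ℂ // z ≠ 0}) := F.comp h.symm.toContinuousMap
  let f₀ : C(A, ℂ) := ContinuousMap.const A (Complex.log (f a₀))
  have H0 : ∀ a, H (0, a) = (⟨_, (f₀ a).exp_ne_zero⟩ : {z : ℂ // z ≠ 0}) := by
    intro a
    apply Subtype.ext
    simp [H, F, f₀, Complex.exp_log (h0 a₀)]
  refine ⟨fun a => Complex.isCoveringMap_exp.liftHomotopy H f₀ H0 (1, a), by fun_prop, fun a => ?_⟩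
  have := congrFun (Complex.isCoveringMap_exp.liftHomotopy_lifts H f₀ H0) (1, a)
  have := congrArg Subtype.val this
  simpa [H, F] using this

theorem exists_continuousOn_log {A : Type*} [TopologicalSpace A] {S : Set A} [ContractibleSpace S]
    {f : A → ℂ} (hf : ContinuousOn f S) (h0 : ∀ a ∈ S, f a ≠ 0) :
    ∃ g : A → ℂ, ContinuousOn g S ∧ ∀ a ∈ S, Complex.exp (g a) = f a := by
  classical
  obtain ⟨g, hg, h⟩ := exists_continuous_log (continuousOn_iff_continuous_domRestrict.1 hf)
    (fun a => h0 a a.2)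
  refine ⟨fun a => if ha : a ∈ S then g ⟨a, ha⟩ else 0, ?_, fun a ha => ?_⟩
  · rw [continuousOn_iff_continuous_domRestrict]
    convert hg using 1
    funext a
    simp
  · simp [ha, h]

theorem IsPreconnected.exists_int_of_continuousOn {A : Type*} [TopologicalSpace A] {S : Set A}
    (hS : IsPreconnected S) {f : A → ℝ} (hf : ContinuousOn f S) (h : ∀ a ∈ S, ∃ n : ℤ, f a = n) :
    ∃ n : ℤ, ∀ a ∈ S, f a = n := by
  have hT : _root_.IsDiscrete (Set.range ((↑) : ℤ → ℝ)) := by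
    refine ⟨?_⟩
    exact
      (Int.isClosedEmbedding_coe_real.isEmbedding.toHomeomorph.symm.isEmbedding).discreteTopology
  obtain ⟨y, ⟨n, rfl⟩, hy⟩ := hS.eqOn_const_of_mapsTo hT hf
    (fun a ha => (h a ha).imp fun n hn => hn.symm) ⟨0, 0, by simp⟩
  exact ⟨n, hy⟩

/-- Two continuous logarithms of the same function on a connected set differ by a constant. -/
theorem IsPreconnected.exists_int_of_exp_eq {A : Type*} [TopologicalSpace A] {S : Set A}
    (hS : IsPreconnected S) {f g : A → ℂ} (hf : ContinuousOn f S) (hg : ContinuousOn g S)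
    (h : ∀ a ∈ S, Complex.exp (f a) = Complex.exp (g a)) :
    ∃ n : ℤ, ∀ a ∈ S, f a = g a + n * (2 * Real.pi * Complex.I) := by
  have h1 : ∀ a ∈ S, ∃ n : ℤ, f a = g a + n * (2 * Real.pi * Complex.I) := fun a ha =>
    Complex.exp_eq_exp_iff_exists_int.1 (h a ha)
  obtain ⟨n, hn⟩ := hS.exists_int_of_continuousOn (f := fun a => (f a - g a).im / (2 * Real.pi))
    ((Complex.continuous_im.comp_continuousOn (hf.sub hg)).div_const _) (by
      intro a ha
      obtain ⟨n, hn⟩ := h1 a ha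
      refine ⟨n, ?_⟩
      rw [hn]
      have := Real.pi_ne_zero
      simp)
  refine ⟨n, fun a ha => ?_⟩
  obtain ⟨m, hm⟩ := h1 a ha
  have := hn a ha
  rw [hm] at this
  have hpi := Real.pi_ne_zero
  simp at this
  rw [hm, this]

/-- The function `z ^ n` has a continuous logarithm on a circle only if `n = 0`. -/
theorem eq_zero_of_continuousOn_log_sphere {ε : ℝ} (hε : 0 < ε) {n : ℤ} {L : ℂ → ℂ}
    (hL : ContinuousOn L (Metric.sphere 0 ε))
    (h : ∀ z ∈ Metric.sphere (0 : ℂ) ε, Complex.exp (L z) = z ^ n) : n = 0 := by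
  let γ : ℝ → ℂ := fun θ => ε * Complex.exp (θ * Complex.I)
  have hγ : ∀ θ, γ θ ∈ Metric.sphere (0 : ℂ) ε := by
    intro θ
    simp [γ, Complex.norm_exp_ofReal_mul_I, abs_of_pos hε]
  have hγc : Continuous γ := by fun_prop
  -- Along the circle the logarithm has to agree with `n * log ε + n * θ * I` up to a constant, and
  -- this grows by `2πin` over one turn.
  obtain ⟨m, hm⟩ := (isPreconnected_univ (α := ℝ)).exists_int_of_exp_eq
    (f := fun θ => L (γ θ)) (g := fun θ => n * Complex.log ε + n * (θ * Complex.I))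
    (hL.comp_continuous hγc hγ).continuousOn (by fun_prop) (by
      intro θ _
      rw [h _ (hγ θ), Complex.exp_add, Complex.exp_int_mul, Complex.exp_int_mul,
        Complex.exp_log (by exact_mod_cast hε.ne'), mul_zpow])
  have h0 := hm 0 trivial
  have h1 := hm (2 * Real.pi) trivial
  have e : γ (2 * Real.pi) = γ 0 := by
    simp [γ, Complex.exp_two_pi_mul_I]
  simp only [e] at h1
  rw [h0] at h1
  have hpi := Real.pi_ne_zero
  have : (n : ℂ) * (2 * Real.pi * Complex.I) = 0 := by
    push_cast at h1
    linear_combination -h1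
  have h2 : (2 * Real.pi * Complex.I : ℂ) ≠ 0 := Complex.two_pi_I_ne_zero
  exact_mod_cast (mul_eq_zero.1 this).resolve_right h2

theorem Complex.exp_image_halfPlane {r : ℝ} (hr : 0 < r) :
    Complex.exp '' {w | w.re < Real.log r} = Metric.ball 0 r \ {0} := by
  ext z
  constructor
  · rintro ⟨w, hw, rfl⟩
    refine ⟨?_, Complex.exp_ne_zero w⟩
    rw [mem_ball_zero_iff, Complex.norm_exp, ← Real.lt_log_iff_exp_lt hr]
    exact hw
  · rintro ⟨hz, h0⟩
    refine ⟨Complex.log z, ?_, Complex.exp_log h0⟩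
    rw [mem_ball_zero_iff] at hz
    simp only [Set.mem_ofPred_eq, Complex.log_re]
    exact Real.log_lt_log (norm_pos_iff.2 h0) hz

theorem isPreconnected_ball_diff_zero {r : ℝ} (hr : 0 < r) :
    IsPreconnected (Metric.ball (0 : ℂ) r \ {0}) := by
  rw [← Complex.exp_image_halfPlane hr]
  exact (convex_halfSpace_re_lt _).isPreconnected.image _ Complex.continuous_exp.continuousOn

/-- On a punctured disc, every function without zeros is a power of `z` times an exponential. -/
theorem exists_zpow_mul_exp {r : ℝ} (hr : 0 < r) {f : ℂ → ℂ}
    (hf : ContinuousOn f (Metric.ball 0 r \ {0})) (h0 : ∀ z ∈ Metric.ball 0 r \ {0}, f z ≠ 0) :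
    ∃ (n : ℤ) (h : ℂ → ℂ), ContinuousOn h (Metric.ball 0 r \ {0}) ∧
      ∀ z ∈ Metric.ball 0 r \ {0}, f z = z ^ n * Complex.exp (h z) := by
  set S : Set ℂ := {w | w.re < Real.log r} with hS
  have hmaps : Set.MapsTo Complex.exp S (Metric.ball 0 r \ {0}) := by
    rw [← Complex.exp_image_halfPlane hr]
    exact Set.mapsTo_image _ _
  have hconv : Convex ℝ S := convex_halfSpace_re_lt _
  have : ContractibleSpace S := hconv.contractibleSpace ⟨(Real.log r - 1 : ℝ), by simp [hS]⟩
  obtain ⟨H, hH, hexp⟩ := exists_continuousOn_log (S := S) (f := f ∘ Complex.exp)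
    (hf.comp Complex.continuous_exp.continuousOn hmaps) (fun a ha => h0 _ (hmaps ha))
  have hshift : ∀ w ∈ S, ∀ k : ℤ, w + k * (2 * Real.pi * Complex.I) ∈ S := by
    intro w hw k
    simpa [hS] using hw
  -- After pulling back along `exp` to a half plane, `f` has a logarithm `H`. The power `n` is its
  -- monodromy under translation by `2πi`; subtracting `n * w` makes it periodic, so that it
  -- descends to the punctured disc.
  obtain ⟨n, hn⟩ := hconv.isPreconnected.exists_int_of_exp_eq
    (f := fun w => H (w + (1 : ℤ) * (2 * Real.pi * Complex.I))) (g := H)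
    (hH.comp (by fun_prop) fun w hw => hshift w hw 1) hH (by
      intro w hw
      rw [hexp _ (hshift w hw 1), hexp w hw]
      simp [Complex.exp_add, Complex.exp_two_pi_mul_I])
  let G : ℂ → ℂ := fun w => H w - n * w
  have hG1 : ∀ w ∈ S, G (w + (1 : ℤ) * (2 * Real.pi * Complex.I)) = G w := by
    intro w hw
    simp only [G]
    rw [hn w hw]
    push_cast
    ring
  have hGn : ∀ k : ℕ, ∀ w ∈ S, G (w + (k : ℤ) * (2 * Real.pi * Complex.I)) = G w := by
    intro k
    induction k with
    | zero => intro w _; simp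
    | succ k ih =>
      intro w hw
      rw [← ih w hw, ← hG1 _ (hshift w hw k)]
      congr 1
      push_cast
      ring
  have hGz : ∀ k : ℤ, ∀ w ∈ S, G (w + k * (2 * Real.pi * Complex.I)) = G w := by
    intro k w hw
    obtain ⟨m, rfl | rfl⟩ := k.eq_nat_or_neg
    · exact hGn m w hw
    · rw [← hGn m _ (hshift w hw _)]
      congr 1
      push_cast
      ring
  have hGe : ∀ w ∈ S, ∀ w' ∈ S, Complex.exp w = Complex.exp w' → G w = G w' := by
    intro w _ w' hw' h
    obtain ⟨k, rfl⟩ := Complex.exp_eq_exp_iff_exists_int.1 h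
    exact hGz k w' hw'
  have hS' : ∀ w, Complex.exp w ∈ Metric.ball 0 r \ {0} → w ∈ S := by
    intro w hw
    have := hw.1
    rw [mem_ball_zero_iff, Complex.norm_exp, ← Real.lt_log_iff_exp_lt hr] at this
    exact this
  have hGc : ContinuousOn G S := hH.sub (by fun_prop)
  refine ⟨n, fun z => G (Complex.log z), ?_, fun z hz => ?_⟩
  · intro z₀ hz₀
    have hz0 : z₀ ≠ 0 := hz₀.2
    -- A branch of the logarithm that is continuous near `z₀`, which `Complex.log` itself need not
    -- be. By periodicity of `G` the choice of branch is irrelevant.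
    let ℓ : ℂ → ℂ := fun z => Complex.log z₀ + Complex.log (z / z₀)
    have hℓc : ContinuousAt ℓ z₀ := by
      refine continuousAt_const.add (ContinuousAt.clog (by fun_prop) ?_)
      simp [hz0]
    have hℓe : ∀ z ∈ Metric.ball 0 r \ {0}, Complex.exp (ℓ z) = z := by
      intro z hz
      simp only [ℓ]
      rw [Complex.exp_add, Complex.exp_log hz0, Complex.exp_log (div_ne_zero hz.2 hz0)]
      field_simp
    have hℓS : Set.MapsTo ℓ (Metric.ball 0 r \ {0}) S := fun z hz => hS' _ (by rwa [hℓe z hz])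
    have : ContinuousWithinAt (fun z => G (ℓ z)) (Metric.ball 0 r \ {0}) z₀ :=
      (hGc (ℓ z₀) (hℓS hz₀)).comp hℓc.continuousWithinAt hℓS
    refine this.congr (fun z hz => ?_) ?_
    · refine hGe _ (hS' _ (by rwa [Complex.exp_log hz.2])) _ (hℓS hz) ?_
      rw [hℓe z hz, Complex.exp_log hz.2]
    · refine hGe _ (hS' _ (by rwa [Complex.exp_log hz0])) _ (hℓS hz₀) ?_
      rw [hℓe _ hz₀, Complex.exp_log hz0]
  · have hz0 : z ≠ 0 := hz.2
    have hl := hS' (Complex.log z) (by rwa [Complex.exp_log hz0])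
    have := hexp _ hl
    simp only [Function.comp, Complex.exp_log hz0] at this
    simp only [G]
    rw [← this, Complex.exp_sub, Complex.exp_int_mul, Complex.exp_log hz0]
    field_simp [zpow_ne_zero n hz0]

/-! ### Punctured neighbourhoods in topological surfaces -/

theorem exists_chart_of_chartedSpace {X : Type*} [TopologicalSpace X]
    [ChartedSpace (EuclideanSpace ℝ (Fin 2)) X] (x : X) :
    ∃ φ : OpenPartialHomeomorph X ℂ, x ∈ φ.source ∧ φ x = 0 := by
  let e : EuclideanSpace ℝ (Fin 2) ≃ₜ ℂ :=
    Complex.orthonormalBasisOneI.repr.symm.toHomeomorph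
  let φ := (chartAt (EuclideanSpace ℝ (Fin 2)) x).transHomeomorph
    (e.trans (Homeomorph.subRight (e (chartAt (EuclideanSpace ℝ (Fin 2)) x x))))
  refine ⟨φ, ?_, ?_⟩
  · simp [φ]
  · simp [φ]

section Chart

variable {X : Type*} [TopologicalSpace X] {x : X} (φ : OpenPartialHomeomorph X ℂ)

/-- The disc of radius `r` in a chart. -/
def chartDisc (r : ℝ) : Set X := φ.source ∩ φ ⁻¹' Metric.ball 0 r

variable {φ}

theorem chartDisc_mem_nhds (hx : x ∈ φ.source) (h0 : φ x = 0) {r : ℝ} (hr : 0 < r) :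
    chartDisc φ r ∈ nhds x :=
  (φ.isOpen_inter_preimage Metric.isOpen_ball).mem_nhds ⟨hx, by simp [h0, hr]⟩

theorem exists_chartDisc_subset (hx : x ∈ φ.source) (h0 : φ x = 0) {U : Set X}
    (hU : U ∈ nhds x) :
    ∃ r, 0 < r ∧ Metric.ball 0 r ⊆ φ.target ∧ chartDisc φ r ⊆ U := by
  have h1 : φ.symm ⁻¹' U ∈ nhds (0 : ℂ) := by
    have := φ.symm.continuousAt (x := 0) (by simpa [h0] using φ.map_source hx)
    refine this.preimage_mem_nhds ?_
    rwa [← h0, φ.left_inv hx]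
  have h2 : φ.target ∈ nhds (0 : ℂ) := φ.open_target.mem_nhds (h0 ▸ φ.map_source hx)
  obtain ⟨r, hr, h⟩ := Metric.mem_nhds_iff.1 (Filter.inter_mem h1 h2)
  refine ⟨r, hr, fun z hz => (h hz).2, fun y hy => ?_⟩
  have := (h hy.2).1
  rwa [Set.mem_preimage, φ.left_inv hy.1] at this

theorem chartDisc_diff_eq (hx : x ∈ φ.source) (h0 : φ x = 0) {r : ℝ}
    (ht : Metric.ball 0 r ⊆ φ.target) :
    chartDisc φ r \ {x} = φ.symm '' (Metric.ball 0 r \ {0}) := by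
  ext y
  constructor
  · rintro ⟨⟨hy, hr⟩, hne⟩
    refine ⟨φ y, ⟨hr, fun h => hne ?_⟩, φ.left_inv hy⟩
    rw [Set.mem_singleton_iff] at h
    rw [Set.mem_singleton_iff, ← φ.left_inv hy, h, ← h0, φ.left_inv hx]
  · rintro ⟨z, ⟨hz, hne⟩, rfl⟩
    refine ⟨⟨φ.map_target (ht hz), by simpa [φ.right_inv (ht hz)] using hz⟩, fun h => hne ?_⟩
    rw [Set.mem_singleton_iff] at h ⊢
    rw [← φ.right_inv (ht hz), h, h0]

theorem isPreconnected_chartDisc_diff (hx : x ∈ φ.source) (h0 : φ x = 0) {r : ℝ} (hr : 0 < r)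
    (ht : Metric.ball 0 r ⊆ φ.target) : IsPreconnected (chartDisc φ r \ {x}) := by
  rw [chartDisc_diff_eq hx h0 ht]
  exact (isPreconnected_ball_diff_zero hr).image _
    (φ.continuousOn_symm.mono (Set.sdiff_subset.trans ht))

theorem exists_zpow_mul_exp_chartDisc (hx : x ∈ φ.source) (h0 : φ x = 0) {r : ℝ} (hr : 0 < r)
    (ht : Metric.ball 0 r ⊆ φ.target) {f : X → ℂ} (hf : ContinuousOn f (chartDisc φ r \ {x}))
    (hf0 : ∀ y ∈ chartDisc φ r \ {x}, f y ≠ 0) :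
    ∃ (n : ℤ) (h : X → ℂ), ContinuousOn h (chartDisc φ r \ {x}) ∧
      ∀ y ∈ chartDisc φ r \ {x}, f y = φ y ^ n * Complex.exp (h y) := by
  have hd := chartDisc_diff_eq hx h0 ht
  have hm : Set.MapsTo φ.symm (Metric.ball 0 r \ {0}) (chartDisc φ r \ {x}) := by
    rw [hd]; exact Set.mapsTo_image _ _
  have hm' : Set.MapsTo φ (chartDisc φ r \ {x}) (Metric.ball 0 r \ {0}) := by
    rw [hd]
    rintro _ ⟨z, hz, rfl⟩
    rwa [φ.right_inv (ht hz.1)]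
  obtain ⟨n, h, hc, he⟩ := exists_zpow_mul_exp hr (f := f ∘ φ.symm)
    (hf.comp (φ.continuousOn_symm.mono (Set.sdiff_subset.trans ht)) hm) (fun z hz => hf0 _ (hm hz))
  refine ⟨n, h ∘ φ, hc.comp (φ.continuousOn.mono fun y hy => hy.1.1) hm', fun y hy => ?_⟩
  have := he _ (hm' hy)
  simpa [φ.left_inv hy.1.1] using this

/-- A chart has no continuous logarithm on a punctured neighbourhood. -/
theorem not_exists_log_chart (hx : x ∈ φ.source) (h0 : φ x = 0) {U : Set X}
    (hU : U ∈ nhds x) {L : X → ℂ} (hL : ContinuousOn L (U \ {x}))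
    (h : ∀ y ∈ U \ {x}, y ∈ φ.source → Complex.exp (L y) = φ y) : False := by
  obtain ⟨r, hr, ht, hsub⟩ := exists_chartDisc_subset hx h0 hU
  have hs : Metric.sphere (0 : ℂ) (r / 2) ⊆ Metric.ball 0 r \ {0} := by
    intro z hz
    rw [mem_sphere_zero_iff_norm] at hz
    refine ⟨by rw [mem_ball_zero_iff, hz]; linarith, fun h => ?_⟩
    rw [Set.mem_singleton_iff.1 h, norm_zero] at hz
    linarith
  have hm : Set.MapsTo φ.symm (Metric.sphere (0 : ℂ) (r / 2)) (U \ {x}) := by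
    intro z hz
    have : φ.symm z ∈ chartDisc φ r \ {x} := by
      rw [chartDisc_diff_eq hx h0 ht]
      exact Set.mem_image_of_mem _ (hs hz)
    exact ⟨hsub this.1, this.2⟩
  have := eq_zero_of_continuousOn_log_sphere (ε := r / 2) (by positivity) (n := 1)
    (L := L ∘ φ.symm)
    (hL.comp (φ.continuousOn_symm.mono fun z hz => ht (hs hz).1) hm) (by
      intro z hz
      have hz' := ht (hs hz).1
      simp only [Function.comp, zpow_one]
      rw [h _ (hm hz) (φ.map_target hz'), φ.right_inv hz'])
  exact one_ne_zero this

end Chart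

/-! ### Barycentric coordinates and piecewise polynomial functions on the realization. -/

namespace stdSimplex

theorem map_succAbove_self {n : ℕ} (i : Fin (n + 1)) (t : stdSimplex ℝ (Fin n)) :
    stdSimplex.map i.succAbove t i = 0 := by
  rw [stdSimplex.map_coe, FunOnFinite.linearMap_apply_apply]
  simp [Fin.succAbove_ne]

theorem map_succAbove_succAbove {n : ℕ} (i : Fin (n + 1)) (t : stdSimplex ℝ (Fin n)) (k : Fin n) :
    stdSimplex.map i.succAbove t (i.succAbove k) = t k := by
  rw [stdSimplex.map_coe, FunOnFinite.linearMap_apply_apply]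
  simp [Finset.filter_eq']

theorem map_const_apply {n : ℕ} (k : Fin n) (t : stdSimplex ℝ (Fin 1)) (j : Fin n) :
    stdSimplex.map (fun _ => k) t j = if k = j then 1 else 0 := by
  rw [stdSimplex.map_coe, FunOnFinite.linearMap_apply_apply]
  split_ifs with h
  · simp [h]
  · simp [h]

theorem continuous_eval {ι : Type*} [Fintype ι] (i : ι) :
    Continuous fun t : stdSimplex ℝ ι => t i :=
  (continuous_apply i).comp continuous_subtype_val

end stdSimplex

namespace DeltaComplex

variable (K : DeltaComplex.{u})

theorem facetMap_map (f : K.F) (i : Fin 3) (t : stdSimplex ℝ (Fin 2)) :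
    K.facetMap f (stdSimplex.map i.succAbove t) = K.edgeMap (K.faceEdge f i) t :=
  Quot.sound (.facet f i t)

theorem edgeMap_map (e : K.E) (k : Fin 2) (t : stdSimplex ℝ (Fin 1)) :
    K.edgeMap e (stdSimplex.map (fun _ => k) t) = K.vertexPt (K.edgeVert e k) := by
  have : t = stdSimplex.vertex 0 := Subsingleton.elim _ _
  rw [this]
  exact Quot.sound (.edge e k _)

theorem edgeMap_vertex (e : K.E) (k : Fin 2) :
    K.edgeMap e (stdSimplex.vertex k) = K.vertexPt (K.edgeVert e k) := by
  rw [← K.edgeMap_map e k (stdSimplex.vertex 0), stdSimplex.map_vertex]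

theorem continuous_edgeMap (e : K.E) : Continuous (K.edgeMap e) :=
  continuous_quot_mk.comp (continuous_inr.comp (continuous_inl.comp continuous_sigmaMk))

theorem continuous_facetMap (f : K.F) : Continuous (K.facetMap f) :=
  continuous_quot_mk.comp (continuous_inr.comp (continuous_inr.comp continuous_sigmaMk))

theorem eq_vertexPt_or (x : K.Realization) :
    (∃ v, x = K.vertexPt v) ∨ (∃ e t, x = K.edgeMap e t) ∨ ∃ f t, x = K.facetMap f t := by
  obtain ⟨⟨v, t⟩ | ⟨e, t⟩ | ⟨f, t⟩, rfl⟩ := Quot.exists_rep x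
  · have : t = stdSimplex.vertex 0 := Subsingleton.elim _ _
    exact .inl ⟨v, by rw [this]; rfl⟩
  · exact .inr (.inl ⟨e, t, rfl⟩)
  · exact .inr (.inr ⟨f, t, rfl⟩)

/-- A function on the realization, given by compatible functions on the closed cells. -/
def glue {Y : Type*} (gV : K.V → Y) (gE : K.E → stdSimplex ℝ (Fin 2) → Y)
    (gF : K.F → stdSimplex ℝ (Fin 3) → Y)
    (hE : ∀ e k t, gE e (stdSimplex.map (fun _ : Fin 1 => k) t) = gV (K.edgeVert e k))
    (hF : ∀ f i t, gF f (stdSimplex.map i.succAbove t) = gE (K.faceEdge f i) t) :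
    K.Realization → Y :=
  Quot.lift (Sum.elim (fun p => gV p.1) (Sum.elim (fun p => gE p.1 p.2) (fun p => gF p.1 p.2))) (by
    rintro _ _ (⟨e, k, t⟩ | ⟨f, i, t⟩)
    · exact hE e k t
    · exact hF f i t)

theorem continuous_glue {Y : Type*} [TopologicalSpace Y] (gV : K.V → Y)
    (gE : K.E → stdSimplex ℝ (Fin 2) → Y) (gF : K.F → stdSimplex ℝ (Fin 3) → Y)
    (hE : ∀ e k t, gE e (stdSimplex.map (fun _ : Fin 1 => k) t) = gV (K.edgeVert e k))
    (hF : ∀ f i t, gF f (stdSimplex.map i.succAbove t) = gE (K.faceEdge f i) t)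
    (cE : ∀ e, Continuous (gE e)) (cF : ∀ f, Continuous (gF f)) :
    Continuous (K.glue gV gE gF hE hF) := by
  refine continuous_quot_lift _ (Continuous.sumElim ?_ (Continuous.sumElim ?_ ?_))
  · exact continuous_sigma fun v => (continuous_const : Continuous fun _ => gV v)
  · exact continuous_sigma fun e => cE e
  · exact continuous_sigma fun f => cF f

/-- The function that is affine on each cell and takes given values at the vertices. -/
noncomputable def vertCoord (w : K.V → ℝ) : K.Realization → ℝ :=
  K.glue w (fun e t => ∑ k, t k * w (K.edgeVert e k)) (fun f t => ∑ i, t i * w (K.faceVert f i))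
    (by
      intro e k t
      simp [stdSimplex.map_const_apply])
    (by
      intro f i t
      rw [Fin.sum_univ_succAbove _ i]
      simp [stdSimplex.map_succAbove_self, stdSimplex.map_succAbove_succAbove,
        K.edgeVert_faceEdge])

/-- The function that vanishes at the vertices and is a multiple of the product of the two
barycentric coordinates on each edge. -/
noncomputable def edgeCoord (w : K.E → ℝ) : K.Realization → ℝ :=
  K.glue (fun _ => 0) (fun e t => w e * (t 0 * t 1))
    (fun f t => ∑ i : Fin 3, w (K.faceEdge f i) * (t (i.succAbove 0) * t (i.succAbove 1)))
    (by
      intro e k t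
      fin_cases k <;> simp [stdSimplex.map_const_apply])
    (by
      intro f i t
      rw [Finset.sum_eq_single i]
      · simp [stdSimplex.map_succAbove_succAbove]
      · intro j _ hj
        obtain ⟨k, hk⟩ := Fin.exists_succAbove_eq hj.symm
        have h0 := stdSimplex.map_succAbove_self i t
        rw [← hk] at h0
        have : k = 0 ∨ k = 1 := by omega
        rcases this with rfl | rfl
        · rw [← hk, h0]; simp
        · rw [← hk, h0]; simp
      · simp)

/-- The function that vanishes on the edges and is a multiple of the product of the three
barycentric coordinates on each facet. -/
noncomputable def facetCoord (w : K.F → ℝ) : K.Realization → ℝ :=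
  K.glue (fun _ => 0) (fun _ _ => 0) (fun f t => w f * ∏ i, t i)
    (by simp)
    (by
      intro f i t
      rw [Finset.prod_eq_zero (Finset.mem_univ i) (stdSimplex.map_succAbove_self i t), mul_zero])

variable {K}

@[simp] theorem vertCoord_vertexPt (w : K.V → ℝ) (v : K.V) : K.vertCoord w (K.vertexPt v) = w v :=
  rfl

@[simp] theorem vertCoord_edgeMap (w : K.V → ℝ) (e : K.E) (t) :
    K.vertCoord w (K.edgeMap e t) = ∑ k, t k * w (K.edgeVert e k) := rfl

@[simp] theorem vertCoord_facetMap (w : K.V → ℝ) (f : K.F) (t) :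
    K.vertCoord w (K.facetMap f t) = ∑ i, t i * w (K.faceVert f i) := rfl

@[simp] theorem edgeCoord_vertexPt (w : K.E → ℝ) (v : K.V) : K.edgeCoord w (K.vertexPt v) = 0 :=
  rfl

@[simp] theorem edgeCoord_edgeMap (w : K.E → ℝ) (e : K.E) (t) :
    K.edgeCoord w (K.edgeMap e t) = w e * (t 0 * t 1) := rfl

@[simp] theorem edgeCoord_facetMap (w : K.E → ℝ) (f : K.F) (t) :
    K.edgeCoord w (K.facetMap f t) =
      ∑ i : Fin 3, w (K.faceEdge f i) * (t (i.succAbove 0) * t (i.succAbove 1)) := rfl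

@[simp] theorem facetCoord_vertexPt (w : K.F → ℝ) (v : K.V) : K.facetCoord w (K.vertexPt v) = 0 :=
  rfl

@[simp] theorem facetCoord_edgeMap (w : K.F → ℝ) (e : K.E) (t) :
    K.facetCoord w (K.edgeMap e t) = 0 := rfl

@[simp] theorem facetCoord_facetMap (w : K.F → ℝ) (f : K.F) (t) :
    K.facetCoord w (K.facetMap f t) = w f * ∏ i, t i := rfl

theorem continuous_vertCoord (w : K.V → ℝ) : Continuous (K.vertCoord w) := by
  refine K.continuous_glue _ _ _ _ _ (fun e => ?_) (fun f => ?_)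
  · exact continuous_finsetSum _ fun k _ => (stdSimplex.continuous_eval k).mul_const _
  · exact continuous_finsetSum _ fun k _ => (stdSimplex.continuous_eval k).mul_const _

theorem continuous_edgeCoord (w : K.E → ℝ) : Continuous (K.edgeCoord w) := by
  refine K.continuous_glue _ _ _ _ _ (fun e => ?_) (fun f => ?_)
  · exact continuous_const.mul ((stdSimplex.continuous_eval _).mul (stdSimplex.continuous_eval _))
  · exact continuous_finsetSum _ fun k _ => continuous_const.mul
      ((stdSimplex.continuous_eval _).mul (stdSimplex.continuous_eval _))

theorem continuous_facetCoord (w : K.F → ℝ) : Continuous (K.facetCoord w) := by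
  refine K.continuous_glue _ _ _ _ _ (fun e => ?_) (fun f => ?_)
  · exact continuous_const
  · exact continuous_const.mul (continuous_finsetProd _ fun k _ => stdSimplex.continuous_eval k)

namespace Subcomplex

theorem vertexPt_mem (S : K.Subcomplex) {v : K.V} (hv : v ∈ S.verts) : K.vertexPt v ∈ S.carrier :=
  .inl ⟨v, hv, rfl⟩

theorem edgeMap_mem (S : K.Subcomplex) {e : K.E} (he : e ∈ S.edges) (t) :
    K.edgeMap e t ∈ S.carrier := .inr (.inl ⟨e, he, t, rfl⟩)

theorem facetMap_mem (S : K.Subcomplex) {f : K.F} (hf : f ∈ S.facets) (t) :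
    K.facetMap f t ∈ S.carrier := .inr (.inr ⟨f, hf, t, rfl⟩)

theorem faceVert_mem (S : K.Subcomplex) {f : K.F} (hf : f ∈ S.facets) (i : Fin 3) :
    K.faceVert f i ∈ S.verts := by
  obtain ⟨j, hj⟩ : ∃ j : Fin 3, j ≠ i := exists_ne i
  obtain ⟨k, hk⟩ := Fin.exists_succAbove_eq hj.symm
  rw [← hk, ← K.edgeVert_faceEdge]
  exact S.edgeVert_mem _ (S.faceEdge_mem f hf j) k

/-- A property of vertices that is constant along the edges of a connected subcomplex is constant
on its vertices. -/
theorem of_preconnected (S : K.Subcomplex) [hS : PreconnectedSpace S.carrier] (P : K.V → Prop)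
    (hP : ∀ e ∈ S.edges, (P (K.edgeVert e 0) ↔ P (K.edgeVert e 1))) {v w : K.V}
    (hv : v ∈ S.verts) (hw : w ∈ S.verts) (h : P v) : P w := by
  classical
  -- The indicator of `P` extends to a continuous function that is constant on each cell of `S` and
  -- takes integral values there.
  let a : K.V → ℝ := fun v => if P v then 1 else 0
  have hcell : ∀ {n : ℕ} (p : Fin (n + 1) → K.V) (t : stdSimplex ℝ (Fin (n + 1))),
      (∀ i, P (p i) ↔ P (p 0)) → ∃ m : ℤ, ∑ i, t i * a (p i) = m := by
    intro n p t h
    have : ∀ i, a (p i) = a (p 0) := fun i => by simp [a, h i]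
    simp only [this, ← Finset.sum_mul, stdSimplex.sum_eq_one, one_mul]
    by_cases h0 : P (p 0)
    · exact ⟨1, by simp [a, h0]⟩
    · exact ⟨0, by simp [a, h0]⟩
  obtain ⟨n, hn⟩ := (isPreconnected_iff_preconnectedSpace.2 hS).exists_int_of_continuousOn
    (K.continuous_vertCoord a).continuousOn (by
      rintro _ (⟨v, hv, rfl⟩ | ⟨e, he, t, rfl⟩ | ⟨f, hf, t, rfl⟩)
      · by_cases h0 : P v
        · exact ⟨1, by simp [a, h0]⟩
        · exact ⟨0, by simp [a, h0]⟩
      · refine hcell _ _ fun i => ?_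
        fin_cases i
        · rfl
        · exact (hP e he).symm
      · refine hcell _ _ fun i => ?_
        have h2 := hP _ (S.faceEdge_mem f hf 2)
        have h1 := hP _ (S.faceEdge_mem f hf 1)
        simp only [K.edgeVert_faceEdge] at h1 h2
        fin_cases i
        · rfl
        · exact h2.symm
        · exact h1.symm)
  have h1 := hn _ (S.vertexPt_mem hv)
  rw [← hn _ (S.vertexPt_mem hw)] at h1
  by_contra hw'
  simp [a, h, hw'] at h1

end Subcomplex

/-! ### Cocycles and their potentials on contractible subcomplexes. -/

/-- A cocycle: a function on the (oriented) edges whose sum around each facet vanishes. -/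
def IsCocycle (c : K.E → ℤ) : Prop :=
  ∀ f : K.F, c (K.faceEdge f 1) = c (K.faceEdge f 2) + c (K.faceEdge f 0)

/-- The map to the multiplicative group of complex numbers defined by a cocycle. -/
noncomputable def cocycleMap (c : K.E → ℤ) (hc : IsCocycle c) : K.Realization → ℂ :=
  K.glue (fun _ => 1) (fun e t => Complex.exp ((t 1 * c e : ℝ) * (2 * Real.pi * Complex.I)))
    (fun f t => Complex.exp ((t 1 * c (K.faceEdge f 2) + t 2 * c (K.faceEdge f 1) : ℝ) *
      (2 * Real.pi * Complex.I)))
    (by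
      intro e k t
      rw [stdSimplex.map_const_apply]
      split_ifs
      · simp
      · simp)
    (by
      intro f i t
      have hs := stdSimplex.add_eq_one t
      have h := hc f
      fin_cases i
      · have e1 := stdSimplex.map_succAbove_succAbove 0 t 0
        have e2 := stdSimplex.map_succAbove_succAbove 0 t 1
        simp only [Fin.zero_eta, Fin.succAbove_zero, Fin.succ_zero_eq_one, Fin.succ_one_eq_two]
          at e1 e2 ⊢
        rw [e1, e2, Complex.exp_eq_exp_iff_exists_int]
        -- Only on the side opposite to vertex `0` do the two exponents differ; by the cocycle
        -- condition the difference is this integer multiple of `2πi`.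
        refine ⟨c (K.faceEdge f 2), ?_⟩
        have hs' : t 0 = 1 - t 1 := by linarith
        rw [h, hs']
        push_cast
        ring
      · have e1 := stdSimplex.map_succAbove_self 1 t
        have e2 : stdSimplex.map (Fin.succAbove 1) t 2 = t 1 :=
          stdSimplex.map_succAbove_succAbove 1 t 1
        simp only [Fin.mk_one, e1, e2]
        simp
      · have e1 := stdSimplex.map_succAbove_self 2 t
        have e2 : stdSimplex.map (Fin.succAbove 2) t 1 = t 1 :=
          stdSimplex.map_succAbove_succAbove 2 t 1
        simp only [Fin.reduceFinMk, e1, e2]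
        simp)

theorem continuous_cocycleMap (c : K.E → ℤ) (hc : IsCocycle c) : Continuous (cocycleMap c hc) := by
  refine K.continuous_glue _ _ _ _ _ (fun e => ?_) (fun f => ?_)
  · exact Complex.continuous_exp.comp ((Complex.continuous_ofReal.comp
      ((stdSimplex.continuous_eval 1).mul_const _)).mul_const _)
  · exact Complex.continuous_exp.comp ((Complex.continuous_ofReal.comp
      (((stdSimplex.continuous_eval 1).mul_const _).add
        ((stdSimplex.continuous_eval 2).mul_const _))).mul_const _)

/-- On a contractible subcomplex every cocycle has a potential. -/
theorem IsCocycle.exists_potential {c : K.E → ℤ} (hc : IsCocycle c) (S : K.Subcomplex)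
    [ContractibleSpace S.carrier] :
    ∃ ψ : K.V → ℤ, ∀ e ∈ S.edges, ψ (K.edgeVert e 1) - ψ (K.edgeVert e 0) = c e := by
  classical
  have hne : ∀ x, cocycleMap c hc x ≠ 0 := by
    intro x
    obtain ⟨v, rfl⟩ | ⟨e, t, rfl⟩ | ⟨f, t, rfl⟩ := K.eq_vertexPt_or x
    · exact one_ne_zero
    · exact Complex.exp_ne_zero _
    · exact Complex.exp_ne_zero _
  obtain ⟨L, hL, hexp⟩ := exists_continuousOn_log (S := S.carrier)
    (continuous_cocycleMap c hc).continuousOn fun a _ => hne a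
  -- The map is `1` at the vertices, so its logarithm there is an integral multiple of `2πi`. These
  -- integers are the potential.
  have hv : ∀ v ∈ S.verts, ∃ n : ℤ, L (K.vertexPt v) = n * (2 * Real.pi * Complex.I) :=
    fun v hv => Complex.exp_eq_one_iff.1 (hexp _ (S.vertexPt_mem hv))
  refine ⟨fun v => if hv' : v ∈ S.verts then (hv v hv').choose else 0, fun e he => ?_⟩
  have h0 := S.edgeVert_mem e he 0
  have h1 := S.edgeVert_mem e he 1
  simp only [h0, h1, dif_pos]
  have hn0 := (hv _ h0).choose_spec
  have hn1 := (hv _ h1).choose_spec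
  set n0 := (hv _ h0).choose
  set n1 := (hv _ h1).choose
  -- Along the edge the logarithm differs from the explicit one by a constant, so it changes by `2πi
  -- * c e` from end to end.
  obtain ⟨m, hm⟩ := (isPreconnected_univ (α := stdSimplex ℝ (Fin 2))).exists_int_of_exp_eq
    (f := fun t => L (K.edgeMap e t))
    (g := fun t => (t 1 * c e : ℝ) * (2 * Real.pi * Complex.I))
    (hL.comp_continuous (K.continuous_edgeMap e) fun t => S.edgeMap_mem he t).continuousOn
    ((Complex.continuous_ofReal.comp
      ((stdSimplex.continuous_eval 1).mul_const _)).mul_const _).continuousOn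
    (fun t _ => hexp _ (S.edgeMap_mem he t))
  have m0 := hm (stdSimplex.vertex 0) trivial
  have m1 := hm (stdSimplex.vertex 1) trivial
  simp only [edgeMap_vertex, hn0, hn1] at m0 m1
  have hI : (2 * Real.pi * Complex.I : ℂ) ≠ 0 := Complex.two_pi_I_ne_zero
  have : ((n1 - n0 : ℤ) : ℂ) * (2 * Real.pi * Complex.I) =
      (c e : ℂ) * (2 * Real.pi * Complex.I) := by
    simp only [stdSimplex.vertex_coe, Pi.single_eq_same, ne_eq, one_ne_zero, not_false_eq_true,
      Pi.single_eq_of_ne, zero_mul, Complex.ofReal_zero, zero_add, one_mul] at m0 m1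
    push_cast
    rw [sub_mul, m0, m1]
    push_cast
    ring
  exact_mod_cast mul_right_cancel₀ hI this

end DeltaComplex

/-! ### Coordinates on edges and on the triangles attached to an edge. -/

namespace stdSimplex

/-- The interior of a simplex is dense. -/
theorem dense_interior (n : ℕ) : Dense {t : stdSimplex ℝ (Fin (n + 1)) | ∀ i, 0 < t i} := by
  intro t
  let b : stdSimplex ℝ (Fin (n + 1)) := stdSimplex.barycenter
  have hb : ∀ i, 0 < b i := fun i => by
    change (0 : ℝ) < (Fintype.card (Fin (n + 1)) : ℝ)⁻¹
    positivity
  let γ : unitInterval → stdSimplex ℝ (Fin (n + 1)) := fun s =>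
    ⟨((1 - s : ℝ) • t.1 + (s : ℝ) • b.1), (convex_stdSimplex ℝ _) t.2 b.2
      (by linarith [s.2.2]) s.2.1 (by ring)⟩
  have hγ : Continuous γ := by
    refine Continuous.subtype_mk ?_ _
    fun_prop
  have h0 : γ 0 = t := by
    apply Subtype.ext
    simp [γ]
  rw [← h0]
  have : (0 : unitInterval) ∈ closure (Set.Ioi 0) := by
    rw [closure_Ioi' ⟨1, zero_lt_one⟩]
    exact Set.self_mem_Ici
  refine map_mem_closure hγ this fun s hs i => ?_
  have hs' : (0 : ℝ) < s := hs
  have h1 : 0 ≤ (1 - s : ℝ) * t i :=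
    mul_nonneg (by linarith [s.2.2]) (stdSimplex.zero_le t i)
  have h2 : 0 < (s : ℝ) * b i := mul_pos hs' (hb i)
  exact add_pos_of_nonneg_of_pos h1 h2

/-- The point of the segment with given difference of the barycentric coordinates, clamped. -/
noncomputable def edgePt (s : ℝ) : stdSimplex ℝ (Fin 2) :=
  ⟨![(1 + max (-1) (min s 1)) / 2, (1 - max (-1) (min s 1)) / 2], by
    have h1 : (-1 : ℝ) ≤ max (-1) (min s 1) := le_max_left _ _
    have h2 : max (-1) (min s 1) ≤ (1 : ℝ) := max_le (by norm_num) (min_le_right _ _)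
    refine ⟨fun i => ?_, ?_⟩
    · fin_cases i
      · simp only [Fin.zero_eta, Matrix.cons_val_zero]; linarith
      · simp only [Fin.mk_one, Matrix.cons_val_one, Matrix.cons_val_fin_one]; linarith
    · simp only [Fin.sum_univ_two, Matrix.cons_val_zero, Matrix.cons_val_one,
        Matrix.cons_val_fin_one]
      ring⟩

theorem continuous_edgePt : Continuous edgePt := by
  refine Continuous.subtype_mk (continuous_pi fun i => ?_) _
  fin_cases i
  · simp only [Fin.zero_eta, Matrix.cons_val_zero]; fun_prop
  · simp only [Fin.mk_one, Matrix.cons_val_one, Matrix.cons_val_fin_one]; fun_prop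

theorem edgePt_apply {s : ℝ} (h : |s| ≤ 1) :
    edgePt s 0 = (1 + s) / 2 ∧ edgePt s 1 = (1 - s) / 2 := by
  obtain ⟨h1, h2⟩ := abs_le.1 h
  have : max (-1) (min s 1) = s := by rw [min_eq_left h2, max_eq_right h1]
  constructor
  · change ![(1 + max (-1) (min s 1)) / 2, (1 - max (-1) (min s 1)) / 2] 0 = _
    rw [this]; rfl
  · change ![(1 + max (-1) (min s 1)) / 2, (1 - max (-1) (min s 1)) / 2] 1 = _
    rw [this]; rfl

theorem ext_fin_two {t t' : stdSimplex ℝ (Fin 2)} (h : t 0 - t 1 = t' 0 - t' 1) : t = t' := by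
  have h1 := stdSimplex.add_eq_one t
  have h2 := stdSimplex.add_eq_one t'
  apply stdSimplex.ext
  funext i
  fin_cases i
  · change t 0 = t' 0; linarith
  · change t 1 = t' 1; linarith

theorem edgePt_sub (t : stdSimplex ℝ (Fin 2)) : edgePt (t 0 - t 1) = t := by
  have h0 := stdSimplex.zero_le t 0
  have h1 := stdSimplex.zero_le t 1
  have h2 := stdSimplex.add_eq_one t
  obtain ⟨e0, e1⟩ := edgePt_apply (s := t 0 - t 1) (abs_le.2 ⟨by linarith, by linarith⟩)
  apply ext_fin_two
  rw [e0, e1]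
  ring

theorem sum_succAbove (t : stdSimplex ℝ (Fin 3)) (i : Fin 3) :
    t i + t (i.succAbove 0) + t (i.succAbove 1) = 1 := by
  rw [← stdSimplex.sum_eq_one t, Fin.sum_univ_succAbove _ i, Fin.sum_univ_two, add_assoc]

/-- The point of a triangle with `i`-th barycentric coordinate `τ` (clamped) and with given
difference of the two other ones (clamped). -/
noncomputable def pagePt (i : Fin 3) (s τ : ℝ) : stdSimplex ℝ (Fin 3) :=
  -- Division by `1 - τ` makes the difference of the other two coordinates equal to `s`. Replacing
  -- `τ` by `min τ (1 / 2)` in the denominator keeps it positive, so the map is continuous on the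
  -- whole plane.
  ⟨i.insertNth (max 0 (min τ 1)) fun k =>
    (1 - max 0 (min τ 1)) * (edgePt (s / (1 - min τ (1 / 2))) k), by
    have h1 : (0 : ℝ) ≤ max 0 (min τ 1) := le_max_left _ _
    have h2 : max 0 (min τ 1) ≤ (1 : ℝ) := max_le (by norm_num) (min_le_right _ _)
    refine ⟨fun j => ?_, ?_⟩
    · obtain rfl | ⟨k, rfl⟩ := Fin.eq_self_or_eq_succAbove i j
      · simp
      · simp only [Fin.insertNth_apply_succAbove]
        exact mul_nonneg (by linarith) (stdSimplex.zero_le _ k)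
    · rw [Fin.sum_univ_succAbove _ i]
      simp only [Fin.insertNth_apply_same, Fin.insertNth_apply_succAbove]
      rw [← Finset.mul_sum, stdSimplex.sum_eq_one]
      ring⟩

theorem pagePt_apply (i : Fin 3) (s τ : ℝ) (j : Fin 3) :
    pagePt i s τ j = i.insertNth (α := fun _ => ℝ) (max 0 (min τ 1)) (fun k =>
      (1 - max 0 (min τ 1)) * (edgePt (s / (1 - min τ (1 / 2))) k)) j := rfl

theorem continuous_pagePt (i : Fin 3) : Continuous fun p : ℝ × ℝ => pagePt i p.1 p.2 := by
  refine Continuous.subtype_mk (continuous_pi fun j => ?_) _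
  obtain rfl | ⟨k, rfl⟩ := Fin.eq_self_or_eq_succAbove i j
  · simp only [Fin.insertNth_apply_same]
    fun_prop
  · simp only [Fin.insertNth_apply_succAbove]
    refine Continuous.mul (by fun_prop) ((continuous_eval k).comp (continuous_edgePt.comp ?_))
    refine Continuous.div (by fun_prop) (by fun_prop) fun p => ?_
    have := min_le_right p.2 (1 / 2)
    intro h
    linarith

theorem pagePt_self {i : Fin 3} {s τ : ℝ} (h0 : 0 ≤ τ) (h1 : τ ≤ 1) :
    pagePt i s τ i = τ := by
  rw [pagePt_apply, Fin.insertNth_apply_same, min_eq_left h1, max_eq_right h0]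

theorem pagePt_succAbove {i : Fin 3} {s τ : ℝ} (h0 : 0 ≤ τ) (h1 : τ ≤ 1 / 2) (hs : |s| ≤ 1 / 2) :
    pagePt i s τ (i.succAbove 0) = (1 - τ + s) / 2 ∧
      pagePt i s τ (i.succAbove 1) = (1 - τ - s) / 2 := by
  have hpos : 0 < 1 - τ := by linarith
  have hs' : |s / (1 - τ)| ≤ 1 := by
    rw [abs_div, abs_of_pos hpos, div_le_one hpos]
    linarith
  obtain ⟨e0, e1⟩ := edgePt_apply hs'
  have hne := hpos.ne'
  constructor
  · rw [pagePt_apply, Fin.insertNth_apply_succAbove, min_eq_left h1,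
      min_eq_left (h1.trans (by norm_num)),
      max_eq_right h0, e0]
    field_simp
  · rw [pagePt_apply, Fin.insertNth_apply_succAbove, min_eq_left h1,
      min_eq_left (h1.trans (by norm_num)),
      max_eq_right h0, e1]
    field_simp

theorem pagePt_sub (i : Fin 3) (t : stdSimplex ℝ (Fin 3)) (h : t i ≤ 1 / 2)
    (h' : |t (i.succAbove 0) - t (i.succAbove 1)| ≤ 1 / 2) :
    pagePt i (t (i.succAbove 0) - t (i.succAbove 1)) (t i) = t := by
  have h0 := stdSimplex.zero_le t i
  have hs := sum_succAbove t i
  obtain ⟨e0, e1⟩ := pagePt_succAbove (i := i) h0 h h'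
  apply stdSimplex.ext
  funext j
  obtain rfl | ⟨k, rfl⟩ := Fin.eq_self_or_eq_succAbove i j
  · exact pagePt_self h0 (h.trans (by norm_num))
  · fin_cases k
    · refine e0.trans ?_; simp only [Fin.zero_eta]; linarith
    · refine e1.trans ?_; simp only [Fin.mk_one]; linarith

theorem pagePt_zero (i : Fin 3) (s : ℝ) : pagePt i s 0 = stdSimplex.map i.succAbove (edgePt s) := by
  apply stdSimplex.ext
  funext j
  obtain rfl | ⟨k, rfl⟩ := Fin.eq_self_or_eq_succAbove i j
  · rw [map_succAbove_self]
    exact pagePt_self le_rfl zero_le_one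
  · rw [map_succAbove_succAbove]
    rw [pagePt_apply, Fin.insertNth_apply_succAbove]
    norm_num

end stdSimplex

theorem Fin.exists_succAbove_pair : ∀ i j : Fin 3, i ≠ j → ∃ m : Fin 3,
    (m.succAbove 0 = i ∧ m.succAbove 1 = j) ∨ (m.succAbove 0 = j ∧ m.succAbove 1 = i) := by
  decide

/-! ### Links of vertices in a surface. -/

namespace DeltaComplex

variable {K : DeltaComplex.{u}}

theorem faceEdge_injective (f : K.F) : Function.Injective (K.faceEdge f) := by
  intro i j h
  by_contra hne
  obtain ⟨k, hk⟩ := Fin.exists_succAbove_eq hne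
  have h1 : K.faceVert f i = K.edgeVert (K.faceEdge f j) k := by rw [K.edgeVert_faceEdge, hk]
  rw [← h, K.edgeVert_faceEdge] at h1
  exact Fin.succAbove_ne i k (K.faceVert_injective f h1.symm)

theorem edgeContains_faceEdge {f : K.F} {i j : Fin 3} (h : i ≠ j) :
    K.EdgeContains (K.faceEdge f i) (K.faceVert f j) := by
  obtain ⟨k, hk⟩ := Fin.exists_succAbove_eq h.symm
  exact ⟨k, by rw [K.edgeVert_faceEdge, hk]⟩

theorem edgeMap_eq_vertexPt {e : K.E} {t : stdSimplex ℝ (Fin 2)} {k k' : Fin 2} (hk : k' ≠ k)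
    (h : t k' = 0) : K.edgeMap e t = K.vertexPt (K.edgeVert e k) := by
  rw [← edgeMap_vertex]
  congr 1
  have h1 := stdSimplex.add_eq_one t
  apply stdSimplex.ext_fin_two
  fin_cases k <;> fin_cases k' <;> simp_all

theorem facetMap_eq_vertexPt {f : K.F} {t : stdSimplex ℝ (Fin 3)} {i : Fin 3}
    (h : ∀ j, j ≠ i → t j = 0) : K.facetMap f t = K.vertexPt (K.faceVert f i) := by
  obtain ⟨j, hj⟩ : ∃ j : Fin 3, j ≠ i := exists_ne i
  obtain ⟨k, hk⟩ := Fin.exists_succAbove_eq hj.symm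
  have : t = stdSimplex.map j.succAbove (stdSimplex.vertex k) := by
    rw [stdSimplex.map_vertex, hk]
    apply stdSimplex.ext
    funext l
    by_cases hl : l = i
    · subst hl
      have := stdSimplex.sum_eq_one t
      rw [Finset.sum_eq_single l (fun b _ hb => h b hb) (by simp)] at this
      simpa using this
    · rw [h l hl]
      simp [hl]
  rw [this, facetMap_map, edgeMap_vertex, K.edgeVert_faceEdge, hk]

open Classical in
/-- The link of a vertex in a surface is connected. -/
theorem Subcomplex.link_connected (S : K.Subcomplex) (hS : IsConnectedTopologicalSurface S.carrier)
    {v : K.V} (A : K.E → Prop)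
    (hA : ∀ f ∈ S.facets, ∀ i j, K.EdgeContains (K.faceEdge f i) v →
      K.EdgeContains (K.faceEdge f j) v → A (K.faceEdge f i) → A (K.faceEdge f j))
    {e e' : K.E} (he : e ∈ S.edges) (hev : K.EdgeContains e v) (he' : e' ∈ S.edges)
    (hev' : K.EdgeContains e' v) (hAe : A e) : A e' := by
  by_contra hAe'
  obtain ⟨_, _, _, ⟨hch⟩⟩ := hS
  have hv : v ∈ S.verts := by
    obtain ⟨k, rfl⟩ := hev
    exact S.edgeVert_mem e he k
  let x : S.carrier := ⟨K.vertexPt v, S.vertexPt_mem hv⟩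
  obtain ⟨φ, hx, h0⟩ := exists_chart_of_chartedSpace x
  let w : (K.E → Prop) → K.E → ℝ := fun B e => if K.EdgeContains e v ∧ B e then 1 else 0
  have hw : ∀ B e, 0 ≤ w B e := fun B e => by simp only [w]; split_ifs <;> norm_num
  have hw' : ∀ B e, 0 < w B e → K.EdgeContains e v ∧ B e := fun B e h => by
    by_contra hn
    simp [w, hn] at h
  let b : S.carrier → ℝ := fun y => K.vertCoord (Pi.single v 1) y
  have hbc : Continuous b := (K.continuous_vertCoord _).comp continuous_subtype_val
  -- The function `b` is positive only on the open star of `v`, so each point of the disc lies in a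
  -- closed cell containing `v`.
  obtain ⟨r, hr, ht, hsub⟩ := exists_chartDisc_subset hx h0 (U := {y | 0 < b y})
    ((isOpen_lt continuous_const hbc).mem_nhds (by simp [b, x]))
  have hpre := isPreconnected_chartDisc_diff hx h0 hr ht
  let O : (K.E → Prop) → Set S.carrier := fun B => {y | 0 < K.edgeCoord (w B) y}
  have hO : ∀ B, IsOpen (O B) := fun B =>
    isOpen_lt continuous_const ((K.continuous_edgeCoord _).comp continuous_subtype_val)
  have hne : ∀ (B : K.E → Prop) (e : K.E), e ∈ S.edges → K.EdgeContains e v → B e →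
      (chartDisc φ r \ {x} ∩ O B).Nonempty := by
    intro B e he hev hB
    obtain ⟨k, rfl⟩ := hev
    let g : stdSimplex ℝ (Fin 2) → S.carrier := fun t => ⟨K.edgeMap e t, S.edgeMap_mem he t⟩
    have hg : Continuous g := (K.continuous_edgeMap e).subtype_mk _
    have hgx : g (stdSimplex.vertex k) = x := Subtype.ext (K.edgeMap_vertex e k)
    have hn : g ⁻¹' chartDisc φ r ∈ nhds (stdSimplex.vertex k) :=
      hg.continuousAt.preimage_mem_nhds (hgx ▸ chartDisc_mem_nhds hx h0 hr)
    obtain ⟨t, ht1, ht2⟩ := mem_closure_iff_nhds.1 (stdSimplex.dense_interior 1 _) _ hn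
    have hpos : 0 < K.edgeCoord (w B) (g t) := by
      have : w B e = 1 := by simp only [w]; exact if_pos ⟨⟨k, rfl⟩, hB⟩
      simp only [g, edgeCoord_edgeMap, this, one_mul]
      exact mul_pos (ht2 0) (ht2 1)
    refine ⟨g t, ⟨ht1, fun h => ?_⟩, hpos⟩
    rw [Set.mem_singleton_iff] at h
    rw [h] at hpos
    simp [x] at hpos
  -- The open stars of the edges at `v` satisfying `A`, and of those not satisfying it, cover the
  -- punctured disc. As it is connected they meet, and a common point produces a facet with edges at
  -- `v` of both kinds.
  obtain ⟨y, ⟨hy, hyx⟩, hyA, hyB⟩ := hpre (O A) (O fun e => ¬ A e) (hO _) (hO _) (by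
    rintro ⟨y, hyS⟩ ⟨hy, hyx⟩
    have hb : 0 < b _ := hsub hy
    have hyx' : y ≠ K.vertexPt v := fun h => hyx (Subtype.ext h)
    have hAor : ∀ e, K.EdgeContains e v → 0 < w A e ∨ 0 < w (fun e => ¬ A e) e := by
      intro e he
      by_cases h : A e
      · left; simp [w, he, h]
      · right; simp [w, he, h]
    simp only [b] at hb
    obtain ⟨v', hv', rfl⟩ | ⟨e, he, t, rfl⟩ | ⟨f, hf, t, rfl⟩ := hyS
    · by_cases h : v' = v
      · exact absurd (h ▸ rfl) hyx'
      · simp [h] at hb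
    · rw [vertCoord_edgeMap] at hb
      obtain ⟨k, -, hk⟩ := Finset.exists_lt_of_sum_lt (s := Finset.univ)
        (f := fun _ : Fin 2 => (0 : ℝ)) (hb.trans_eq' Finset.sum_const_zero.symm)
      have hkv : K.edgeVert e k = v := by
        by_contra h
        simp [h] at hk
      have hpos : ∀ k', 0 < t k' := by
        intro k'
        refine lt_of_le_of_ne (stdSimplex.zero_le t k') fun h => ?_
        by_cases hkk : k' = k
        · rw [← hkk, ← h] at hk
          simp at hk
        · exact hyx' (by rw [edgeMap_eq_vertexPt hkk h.symm, hkv])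
      rcases hAor e ⟨k, hkv⟩ with h | h
      · left; exact mul_pos h (mul_pos (hpos 0) (hpos 1))
      · right; exact mul_pos h (mul_pos (hpos 0) (hpos 1))
    · rw [vertCoord_facetMap] at hb
      obtain ⟨i, -, hi⟩ := Finset.exists_lt_of_sum_lt (s := Finset.univ)
        (f := fun _ : Fin 3 => (0 : ℝ)) (hb.trans_eq' Finset.sum_const_zero.symm)
      have hiv : K.faceVert f i = v := by
        by_contra h
        simp [h] at hi
      have hi0 : 0 < t i := by simpa [hiv] using hi
      obtain ⟨j, hji, hj⟩ : ∃ j, j ≠ i ∧ t j ≠ 0 := by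
        by_contra hcon
        push Not at hcon
        exact hyx' (by rw [facetMap_eq_vertexPt hcon, hiv])
      have hj0 : 0 < t j := lt_of_le_of_ne (stdSimplex.zero_le t j) hj.symm
      obtain ⟨m, hm⟩ := Fin.exists_succAbove_pair i j hji.symm
      have hmt : 0 < t (m.succAbove 0) * t (m.succAbove 1) := by
        rcases hm with ⟨h1, h2⟩ | ⟨h1, h2⟩ <;> rw [h1, h2]
        · exact mul_pos hi0 hj0
        · exact mul_pos hj0 hi0
      have hmv : K.EdgeContains (K.faceEdge f m) v := by
        rw [← hiv]
        refine edgeContains_faceEdge ?_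
        rcases hm with ⟨h1, h2⟩ | ⟨h1, h2⟩
        · rw [← h1]; exact (Fin.succAbove_ne m 0).symm
        · rw [← h2]; exact (Fin.succAbove_ne m 1).symm
      have hsum : ∀ B, 0 < w B (K.faceEdge f m) → 0 < K.edgeCoord (w B) (K.facetMap f t) := by
        intro B hB
        rw [edgeCoord_facetMap]
        refine Finset.sum_pos' (fun l _ => mul_nonneg (hw _ _) (mul_nonneg
          (stdSimplex.zero_le t _) (stdSimplex.zero_le t _))) ⟨m, Finset.mem_univ _, ?_⟩
        exact mul_pos hB hmt
      exact (hAor _ hmv).imp (hsum _) (hsum _))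
    (hne A e he hev hAe) (hne _ e' he' hev' hAe')
  have hpick : ∀ B (f : K.F) (t : stdSimplex ℝ (Fin 3)), 0 < K.edgeCoord (w B) (K.facetMap f t) →
      ∃ i, K.EdgeContains (K.faceEdge f i) v ∧ B (K.faceEdge f i) := by
    intro B f t h
    rw [edgeCoord_facetMap] at h
    obtain ⟨i, -, hi⟩ := Finset.exists_lt_of_sum_lt (s := Finset.univ)
      (f := fun _ : Fin 3 => (0 : ℝ)) (h.trans_eq' Finset.sum_const_zero.symm)
    refine ⟨i, hw' _ _ (lt_of_le_of_ne (hw _ _) fun h0 => ?_)⟩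
    rw [← h0] at hi
    simp at hi
  obtain ⟨y, hyS⟩ := y
  simp only [O, Set.mem_ofPred_eq] at hyA hyB
  obtain ⟨v', hv', rfl⟩ | ⟨e, he, t, rfl⟩ | ⟨f, hf, t, rfl⟩ := hyS
  · simp at hyA
  · rw [edgeCoord_edgeMap] at hyA hyB
    have h1 : 0 < w A e := lt_of_le_of_ne (hw _ _) fun h0 => by simp [← h0] at hyA
    have h2 : 0 < w (fun e => ¬ A e) e := lt_of_le_of_ne (hw (fun e => ¬ A e) e) fun h0 => by
      simp [← h0] at hyB
    exact (hw' (fun e => ¬ A e) _ h2).2 (hw' _ _ h1).2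
  · obtain ⟨i, hi, hAi⟩ := hpick _ f t hyA
    obtain ⟨j, hj, hAj⟩ := hpick _ f t hyB
    exact hAj (hA f hf i j hi hj hAi)

end DeltaComplex

/-! ### The open star of an edge; every edge of a surface lies in at least two facets. -/

namespace DeltaComplex

variable {K : DeltaComplex.{u}}

open Classical in
/-- The open star of an edge, as the positivity domain of this function. -/
noncomputable def starCoord (e : K.E) : K.Realization → ℝ := K.edgeCoord (Pi.single e 1)

open Classical in
/-- The difference of the barycentric coordinates at the end points of an edge. -/
noncomputable def alongCoord (e : K.E) : K.Realization → ℝ :=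
  K.vertCoord (Pi.single (K.edgeVert e 0) 1 - Pi.single (K.edgeVert e 1) 1)

/-- On the open star of an edge, the barycentric coordinate opposite to the edge in the facets
where `w` is one. -/
noncomputable def heightCoord (e : K.E) (w : K.F → ℝ) : K.Realization → ℝ :=
  fun y => K.facetCoord w y / starCoord e y

theorem continuous_starCoord (e : K.E) : Continuous (starCoord e) := K.continuous_edgeCoord _

theorem continuous_alongCoord (e : K.E) : Continuous (alongCoord e) := K.continuous_vertCoord _

theorem continuousOn_heightCoord (e : K.E) (w : K.F → ℝ) :
    ContinuousOn (heightCoord e w) {y | 0 < starCoord e y} :=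
  (K.continuous_facetCoord w).continuousOn.div (continuous_starCoord e).continuousOn
    fun _ hy => (ne_of_gt hy)

theorem starCoord_edgeMap (e : K.E) (t) : starCoord e (K.edgeMap e t) = t 0 * t 1 := by
  simp [starCoord]

theorem starCoord_facetMap {e : K.E} {f : K.F} {i : Fin 3} (h : K.faceEdge f i = e) (t) :
    starCoord e (K.facetMap f t) = t (i.succAbove 0) * t (i.succAbove 1) := by
  classical
  subst h
  rw [starCoord, edgeCoord_facetMap, Finset.sum_eq_single i]
  · simp
  · intro j _ hj
    rw [Pi.single_eq_of_ne fun h => hj (faceEdge_injective f h), zero_mul]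
  · simp

theorem alongCoord_edgeMap (e : K.E) (t) : alongCoord e (K.edgeMap e t) = t 0 - t 1 := by
  have h : K.edgeVert e 0 ≠ K.edgeVert e 1 := fun h =>
    absurd (K.edgeVert_injective e h) (by decide)
  simp [alongCoord, h, h.symm]
  ring

theorem alongCoord_facetMap {e : K.E} {f : K.F} {i : Fin 3} (h : K.faceEdge f i = e) (t) :
    alongCoord e (K.facetMap f t) = t (i.succAbove 0) - t (i.succAbove 1) := by
  subst h
  have h01 : K.faceVert f (i.succAbove 0) ≠ K.faceVert f (i.succAbove 1) := fun h =>
    absurd (Fin.succAbove_right_injective (K.faceVert_injective f h)) (by decide)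
  have hi : ∀ k, K.faceVert f i ≠ K.faceVert f (i.succAbove k) := fun k h =>
    Fin.succAbove_ne i k (K.faceVert_injective f h).symm
  rw [alongCoord, vertCoord_facetMap, Fin.sum_univ_succAbove _ i]
  simp [K.edgeVert_faceEdge, h01, h01.symm, hi]
  ring

theorem heightCoord_edgeMap (e : K.E) (w : K.F → ℝ) (t) :
    heightCoord e w (K.edgeMap e t) = 0 := by simp [heightCoord]

theorem heightCoord_facetMap {e : K.E} {f : K.F} {i : Fin 3} (h : K.faceEdge f i = e)
    (w : K.F → ℝ) {t} (ht : 0 < starCoord e (K.facetMap f t)) :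
    heightCoord e w (K.facetMap f t) = w f * t i := by
  rw [starCoord_facetMap h] at ht
  rw [heightCoord, starCoord_facetMap h, facetCoord_facetMap, Fin.prod_univ_succAbove _ i,
    Fin.prod_univ_two]
  have h0 := left_ne_zero_of_mul ht.ne'
  have h1 := right_ne_zero_of_mul ht.ne'
  field_simp

/-- The points of the open star of an edge. -/
theorem Subcomplex.exists_of_starCoord_pos (S : K.Subcomplex) {e : K.E} {y : K.Realization}
    (hy : y ∈ S.carrier) (h : 0 < starCoord e y) :
    (∃ t, y = K.edgeMap e t) ∨
      ∃ f ∈ S.facets, ∃ i, K.faceEdge f i = e ∧ ∃ t, y = K.facetMap f t := by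
  classical
  obtain ⟨v, hv, rfl⟩ | ⟨e', he, t, rfl⟩ | ⟨f, hf, t, rfl⟩ := hy
  · simp [starCoord] at h
  · by_cases hee : e' = e
    · exact .inl ⟨t, by rw [hee]⟩
    · simp [starCoord, hee] at h
  · refine .inr ⟨f, hf, ?_⟩
    by_contra hcon
    have : ∀ i, K.faceEdge f i ≠ e := fun i hi => hcon ⟨i, hi, t, rfl⟩
    rw [starCoord, edgeCoord_facetMap, Finset.sum_eq_zero] at h
    · exact lt_irrefl _ h
    · intro i _
      rw [Pi.single_eq_of_ne (this i), zero_mul]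

/-- The midpoint of an edge. -/
noncomputable def midPt (e : K.E) : K.Realization := K.edgeMap e (stdSimplex.edgePt 0)

theorem edgePt_zero : stdSimplex.edgePt 0 0 = 1 / 2 ∧ stdSimplex.edgePt 0 1 = 1 / 2 := by
  have := stdSimplex.edgePt_apply (s := 0) (by simp)
  simpa using this

theorem starCoord_midPt (e : K.E) : 0 < starCoord e (midPt e) := by
  rw [midPt, starCoord_edgeMap, edgePt_zero.1, edgePt_zero.2]
  norm_num

theorem alongCoord_midPt (e : K.E) : alongCoord e (midPt e) = 0 := by
  rw [midPt, alongCoord_edgeMap, edgePt_zero.1, edgePt_zero.2]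
  norm_num

theorem edgeMap_eq_midPt {e : K.E} {t} (h : alongCoord e (K.edgeMap e t) = 0) :
    K.edgeMap e t = midPt e := by
  rw [alongCoord_edgeMap] at h
  rw [midPt, ← h, stdSimplex.edgePt_sub]

theorem facetMap_pagePt_zero {e : K.E} {f : K.F} {i : Fin 3} (h : K.faceEdge f i = e) (s : ℝ) :
    K.facetMap f (stdSimplex.pagePt i s 0) = K.edgeMap e (stdSimplex.edgePt s) := by
  rw [stdSimplex.pagePt_zero, facetMap_map, h]

theorem starCoord_pagePt {e : K.E} {f : K.F} {i : Fin 3} (h : K.faceEdge f i = e) {s τ : ℝ}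
    (h0 : 0 ≤ τ) (h1 : τ < 1 / 2) (hs : |s| < 1 / 2) :
    0 < starCoord e (K.facetMap f (stdSimplex.pagePt i s τ)) := by
  obtain ⟨e0, e1⟩ := stdSimplex.pagePt_succAbove (i := i) h0 h1.le hs.le
  obtain ⟨h3, h4⟩ := abs_lt.1 hs
  rw [starCoord_facetMap h, e0, e1]
  exact mul_pos (by linarith) (by linarith)

theorem alongCoord_pagePt {e : K.E} {f : K.F} {i : Fin 3} (h : K.faceEdge f i = e) {s τ : ℝ}
    (h0 : 0 ≤ τ) (h1 : τ < 1 / 2) (hs : |s| < 1 / 2) :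
    alongCoord e (K.facetMap f (stdSimplex.pagePt i s τ)) = s := by
  obtain ⟨e0, e1⟩ := stdSimplex.pagePt_succAbove (i := i) h0 h1.le hs.le
  rw [alongCoord_facetMap h, e0, e1]
  ring

theorem heightCoord_pagePt {e : K.E} {f : K.F} {i : Fin 3} (h : K.faceEdge f i = e)
    (w : K.F → ℝ) {s τ : ℝ} (h0 : 0 ≤ τ) (h1 : τ < 1 / 2) (hs : |s| < 1 / 2) :
    heightCoord e w (K.facetMap f (stdSimplex.pagePt i s τ)) = w f * τ := by
  rw [heightCoord_facetMap h w (starCoord_pagePt h h0 h1 hs),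
    stdSimplex.pagePt_self h0 (by linarith)]

theorem heightCoord_nonneg {S : K.Subcomplex} {e : K.E} {y : K.Realization} (hy : y ∈ S.carrier)
    (h : 0 < starCoord e y) : 0 ≤ heightCoord e (fun _ => 1) y := by
  obtain ⟨t, rfl⟩ | ⟨f, hf, i, hi, t, rfl⟩ := S.exists_of_starCoord_pos hy h
  · rw [heightCoord_edgeMap]
  · rw [heightCoord_facetMap hi _ h, one_mul]
    exact stdSimplex.zero_le t i

theorem eq_midPt_of_coord_eq_zero {S : K.Subcomplex} {e : K.E} {y : K.Realization}
    (hy : y ∈ S.carrier) (h : 0 < starCoord e y) (hs : alongCoord e y = 0)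
    (hτ : heightCoord e (fun _ => 1) y = 0) : y = midPt e := by
  obtain ⟨t, rfl⟩ | ⟨f, hf, i, hi, t, rfl⟩ := S.exists_of_starCoord_pos hy h
  · exact edgeMap_eq_midPt hs
  · rw [heightCoord_facetMap hi _ h, one_mul] at hτ
    have ht : stdSimplex.pagePt i (t (i.succAbove 0) - t (i.succAbove 1)) (t i) = t := by
      rw [alongCoord_facetMap hi] at hs
      exact stdSimplex.pagePt_sub i t (by rw [hτ]; norm_num) (by rw [hs]; norm_num)
    rw [hτ] at ht
    rw [← ht, facetMap_pagePt_zero hi] at hs ⊢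
    exact edgeMap_eq_midPt hs

/-- An edge of a surface lies in a facet of the surface. -/
theorem Subcomplex.exists_facet (S : K.Subcomplex) (hS : IsConnectedTopologicalSurface S.carrier)
    {e : K.E} (he : e ∈ S.edges) : ∃ f ∈ S.facets, K.FacetContains f e := by
  by_contra hcon
  obtain ⟨_, _, _, ⟨hch⟩⟩ := hS
  let g : ℝ → S.carrier := fun s => ⟨K.edgeMap e (stdSimplex.edgePt s), S.edgeMap_mem he _⟩
  have hg : Continuous g :=
    ((K.continuous_edgeMap e).comp stdSimplex.continuous_edgePt).subtype_mk _
  obtain ⟨φ, hx, h0⟩ := exists_chart_of_chartedSpace (g 0)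
  let a : S.carrier → ℝ := fun y => alongCoord e y
  have ha : Continuous a := (continuous_alongCoord e).comp continuous_subtype_val
  have hag : ∀ s, |s| ≤ 1 → a (g s) = s := by
    intro s hs
    obtain ⟨e0, e1⟩ := stdSimplex.edgePt_apply hs
    change alongCoord e (K.edgeMap e (stdSimplex.edgePt s)) = s
    rw [alongCoord_edgeMap, e0, e1]
    ring
  have hU : {y : S.carrier | 0 < starCoord e y} ∈ nhds (g 0) :=
    (isOpen_lt continuous_const
      ((continuous_starCoord e).comp continuous_subtype_val)).mem_nhds (starCoord_midPt e)
  obtain ⟨r, hr, ht, hsub⟩ := exists_chartDisc_subset hx h0 hU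
  have hpre := isPreconnected_chartDisc_diff hx h0 hr ht
  have hn : g ⁻¹' chartDisc φ r ∈ nhds (0 : ℝ) :=
    hg.continuousAt.preimage_mem_nhds (chartDisc_mem_nhds hx h0 hr)
  obtain ⟨ε, hε, hball⟩ := Metric.mem_nhds_iff.1 hn
  set δ := min (ε / 2) 1 with hδ
  have hδ0 : 0 < δ := lt_min (by linarith) one_pos
  have hδ1 : δ ≤ 1 := min_le_right _ _
  have hδε : δ < ε := (min_le_left _ _).trans_lt (by linarith)
  have hmem : ∀ s, |s| = δ → g s ∈ chartDisc φ r \ {g 0} := by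
    intro s hs
    refine ⟨hball (by simpa [hs] using hδε), fun h => ?_⟩
    have h1 := hag s (hs ▸ hδ1)
    rw [Set.mem_singleton_iff.1 h, hag 0 (by simp)] at h1
    rw [← h1, abs_zero] at hs
    exact hδ0.ne hs
  -- Near its midpoint an edge without facets is an open interval, which the midpoint disconnects,
  -- unlike a disc.
  obtain ⟨y, -, hy1, hy2⟩ := hpre {y | 0 < a y} {y | a y < 0} (isOpen_lt continuous_const ha)
    (isOpen_lt ha continuous_const) (by
      rintro y ⟨hy, hyx⟩
      have hpos : 0 < starCoord e y := hsub hy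
      rcases lt_trichotomy (a y) 0 with h | h | h
      · exact .inr h
      · exfalso
        obtain ⟨t, hyt⟩ | ⟨f, hf, i, hi, t, -⟩ := S.exists_of_starCoord_pos y.2 hpos
        · refine hyx (Subtype.ext ?_)
          rw [hyt]
          simp only [a, hyt] at h
          exact edgeMap_eq_midPt h
        · exact hcon ⟨f, hf, i, hi⟩
      · exact .inl h)
    ⟨g δ, hmem δ (abs_of_pos hδ0), by simpa [hag δ (by rw [abs_of_pos hδ0]; exact hδ1)] using hδ0⟩
    ⟨g (-δ), hmem (-δ) (by rw [abs_neg, abs_of_pos hδ0]), by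
      simpa [hag (-δ) (by rw [abs_neg, abs_of_pos hδ0]; exact hδ1)] using hδ0⟩
  exact lt_asymm (a := 0) (b := a y) hy1 hy2

/-- An edge of a surface lies in more than one facet of the surface. -/
theorem Subcomplex.exists_facet_ne (S : K.Subcomplex)
    (hS : IsConnectedTopologicalSurface S.carrier) {e : K.E} {f : K.F} (hf : f ∈ S.facets)
    (hfe : K.FacetContains f e) : ∃ g ∈ S.facets, K.FacetContains g e ∧ g ≠ f := by
  by_contra hcon
  have huniq : ∀ g ∈ S.facets, K.FacetContains g e → g = f := fun g hg hge => by
    by_contra h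
    exact hcon ⟨g, hg, hge, h⟩
  obtain ⟨_, _, _, ⟨hch⟩⟩ := hS
  obtain ⟨i, hi⟩ := hfe
  let p : ℝ × ℝ → S.carrier := fun q =>
    ⟨K.facetMap f (stdSimplex.pagePt i q.1 q.2), S.facetMap_mem hf _⟩
  have hp : Continuous p :=
    ((K.continuous_facetMap f).comp (stdSimplex.continuous_pagePt i)).subtype_mk _
  obtain ⟨φ, hx, h0⟩ := exists_chart_of_chartedSpace (p 0)
  have hpmid : (p 0 : K.Realization) = midPt e := facetMap_pagePt_zero hi 0
  let s : S.carrier → ℝ := fun y => alongCoord e y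
  let τ : S.carrier → ℝ := fun y => heightCoord e (fun _ => 1) y
  let U : Set S.carrier := {y | 0 < starCoord e y}
  have hUo : IsOpen U :=
    isOpen_lt continuous_const ((continuous_starCoord e).comp continuous_subtype_val)
  have hs : Continuous s := (continuous_alongCoord e).comp continuous_subtype_val
  have hτ : ContinuousOn τ U := (continuousOn_heightCoord e _).comp
    continuous_subtype_val.continuousOn fun y hy => hy
  obtain ⟨ε₀, hε₀, hball⟩ := Metric.mem_nhds_iff.1
    (hp.continuousAt.preimage_mem_nhds (φ.open_source.mem_nhds hx))
  set ε := min ε₀ (1 / 4) with hε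
  have hε0 : 0 < ε := lt_min hε₀ (by norm_num)
  have hε4 : ε ≤ 1 / 4 := min_le_right _ _
  -- A half rectangle around the midpoint without its centre, in the coordinates along the edge and
  -- away from it. It is star-shaped about `(0, ε / 2)`: segments from that point to the boundary
  -- side miss the centre. Hence the chart has a logarithm on it, which is impossible around a point
  -- of a surface.
  let C : Set (ℝ × ℝ) := {q | (|q.1| < ε ∧ 0 ≤ q.2 ∧ q.2 < ε) ∧ q ≠ 0}
  have hCsrc : ∀ q ∈ C, p q ∈ φ.source := by
    rintro q ⟨⟨h1, h2, h3⟩, -⟩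
    refine hball ?_
    rw [mem_ball_zero_iff, Prod.norm_def, max_lt_iff, Real.norm_eq_abs, Real.norm_eq_abs,
      abs_of_nonneg h2]
    have : ε ≤ ε₀ := min_le_left _ _
    exact ⟨by linarith, by linarith⟩
  have hps : ∀ q : ℝ × ℝ, |q.1| < ε → 0 ≤ q.2 → q.2 < ε → s (p q) = q.1 ∧ τ (p q) = q.2 := by
    intro q h1 h2 h3
    refine ⟨alongCoord_pagePt hi h2 (by linarith) (by linarith), ?_⟩
    refine (heightCoord_pagePt hi _ h2 (by linarith) (by linarith)).trans (one_mul _)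
  have hCne : ∀ q ∈ C, p q ≠ p 0 := by
    rintro q ⟨⟨h1, h2, h3⟩, hq⟩ h
    obtain ⟨e1, e2⟩ := hps q h1 h2 h3
    obtain ⟨e3, e4⟩ := hps 0 (by simpa using hε0) le_rfl hε0
    rw [h, e3] at e1
    rw [h, e4] at e2
    exact hq (Prod.ext e1.symm e2.symm)
  have hstar : StarConvex ℝ ((0, ε / 2) : ℝ × ℝ) C := by
    rintro q ⟨⟨h1, h2, h3⟩, hq⟩ a b ha hb hab
    refine ⟨⟨?_, ?_, ?_⟩, ?_⟩
    · simp only [Prod.fst_add, Prod.smul_fst, smul_eq_mul, mul_zero, zero_add, abs_mul,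
        abs_of_nonneg hb]
      have : b ≤ 1 := by linarith
      nlinarith [abs_nonneg q.1]
    · simp only [Prod.snd_add, Prod.smul_snd, smul_eq_mul]
      positivity
    · simp only [Prod.snd_add, Prod.smul_snd, smul_eq_mul]
      rcases hb.eq_or_lt with rfl | hb'
      · nlinarith
      · nlinarith
    · intro h
      have h2' := congrArg Prod.snd h
      have h1' := congrArg Prod.fst h
      simp only [Prod.fst_add, Prod.smul_fst, smul_eq_mul, mul_zero, zero_add, Prod.fst_zero,
        Prod.snd_add, Prod.smul_snd, Prod.snd_zero] at h1' h2'
      have hb1 : b ≠ 0 := by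
        rintro rfl
        have : a = 1 := by linarith
        subst this
        linarith
      have ha2 : a * (ε / 2) ≥ 0 := by positivity
      have hb2 : b * q.2 ≥ 0 := by positivity
      have hq2 : b * q.2 = 0 := by linarith
      exact hq (Prod.ext ((mul_eq_zero.1 h1').resolve_left hb1)
        ((mul_eq_zero.1 hq2).resolve_left hb1))
  have : ContractibleSpace C := by
    refine hstar.contractibleSpace ⟨(0, ε / 2), ⟨by simpa using hε0, by positivity, by
      simp only; linarith⟩, fun h => ?_⟩
    have := congrArg Prod.snd h
    simp only [Prod.snd_zero] at this
    linarith
  obtain ⟨L, hL, hexp⟩ := exists_continuousOn_log (S := C) (f := φ ∘ p)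
    (φ.continuousOn.comp hp.continuousOn hCsrc) (fun q hq h => hCne q hq (φ.injOn (hCsrc q hq) hx
      (h.trans h0.symm)))
  -- Since `f` is the only facet of `S` at `e`, the two coordinates invert `p` on this neighbourhood
  -- of the midpoint.
  let N : Set S.carrier := U ∩ (fun y => (s y, τ y)) ⁻¹' {q | |q.1| < ε ∧ q.2 < ε}
  have hNo : IsOpen N := by
    refine (hs.continuousOn.prodMk hτ).isOpen_inter_preimage hUo ?_
    exact (isOpen_lt (continuous_abs.comp continuous_fst) continuous_const).inter
      (isOpen_lt continuous_snd continuous_const)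
  have hNx : p 0 ∈ N := by
    obtain ⟨e3, e4⟩ := hps 0 (by simpa using hε0) le_rfl hε0
    refine ⟨?_, ?_, ?_⟩
    · change 0 < starCoord e (p 0)
      rw [hpmid]
      exact starCoord_midPt e
    · simp [e3, hε0]
    · simp [e4, hε0]
  have hNp : ∀ y ∈ N, p (s y, τ y) = y := by
    rintro ⟨y, hyS⟩ ⟨hy, h1, h2⟩
    apply Subtype.ext
    obtain ⟨f', t, hf', hft, rfl⟩ : ∃ f' t, f' = f ∧ 0 < starCoord e (K.facetMap f t) ∧
        y = K.facetMap f t := by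
      obtain ⟨t, rfl⟩ | ⟨f', hf', i', hi', t, rfl⟩ := S.exists_of_starCoord_pos hyS hy
      · have : K.edgeMap e t = K.facetMap f (stdSimplex.map i.succAbove t) := by
          rw [facetMap_map, hi]
        exact ⟨f, _, rfl, this ▸ hy, this⟩
      · obtain rfl := huniq f' hf' ⟨i', hi'⟩
        exact ⟨_, t, rfl, hy, rfl⟩
    simp only [s, τ] at h1 h2
    rw [alongCoord_facetMap hi] at h1
    rw [heightCoord_facetMap hi _ hft, one_mul] at h2
    change K.facetMap f (stdSimplex.pagePt i (alongCoord e (K.facetMap f t))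
      (heightCoord e (fun _ => 1) (K.facetMap f t))) = _
    rw [alongCoord_facetMap hi, heightCoord_facetMap hi _ hft, one_mul,
      stdSimplex.pagePt_sub i t (by linarith) (by linarith)]
  have hNC : Set.MapsTo (fun y => (s y, τ y)) (N \ {p 0}) C := by
    rintro y ⟨hy, hyx⟩
    refine ⟨⟨hy.2.1, heightCoord_nonneg y.2 hy.1, hy.2.2⟩, fun h => hyx ?_⟩
    have := hNp y hy
    rw [Set.mem_singleton_iff, ← this]
    exact congrArg p h
  refine not_exists_log_chart hx h0 (hNo.mem_nhds hNx) (L := fun y => L (s y, τ y))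
    (hL.comp ((hs.continuousOn.prodMk hτ).mono fun y hy => hy.1.1) hNC) fun y hy _ => ?_
  rw [hexp _ (hNC hy)]
  simp [hNp y hy.1]

end DeltaComplex

/-! ### Winding numbers exclude three facets at an edge of a surface. -/

namespace DeltaComplex

variable {K : DeltaComplex.{u}}

/-- The map from the plane to two facets sharing an edge. -/
noncomputable def bookMap (f g : K.F) (i j : Fin 3) (z : ℂ) : K.Realization :=
  if 0 ≤ z.im then K.facetMap f (stdSimplex.pagePt i z.re z.im)
  else K.facetMap g (stdSimplex.pagePt j z.re (-z.im))

theorem continuous_bookMap {e : K.E} {f g : K.F} {i j : Fin 3} (hi : K.faceEdge f i = e)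
    (hj : K.faceEdge g j = e) : Continuous (bookMap f g i j) := by
  refine Continuous.if_le ?_ ?_ continuous_const Complex.continuous_im ?_
  · exact (K.continuous_facetMap f).comp ((stdSimplex.continuous_pagePt i).comp
      (Complex.continuous_re.prodMk Complex.continuous_im))
  · exact (K.continuous_facetMap g).comp ((stdSimplex.continuous_pagePt j).comp
      (Complex.continuous_re.prodMk Complex.continuous_im.neg))
  · intro z hz
    rw [← hz, neg_zero, facetMap_pagePt_zero hi, facetMap_pagePt_zero hj]

theorem bookMap_mem {S : K.Subcomplex} {f g : K.F} (hf : f ∈ S.facets) (hg : g ∈ S.facets)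
    (i j : Fin 3) (z : ℂ) : bookMap f g i j z ∈ S.carrier := by
  rw [bookMap]
  split_ifs
  · exact S.facetMap_mem hf _
  · exact S.facetMap_mem hg _

theorem bookMap_zero {e : K.E} {f g : K.F} {i j : Fin 3} (hi : K.faceEdge f i = e) :
    bookMap f g i j 0 = midPt e := by
  simp [bookMap, facetMap_pagePt_zero hi, midPt]

theorem alongCoord_bookMap {e : K.E} {f g : K.F} {i j : Fin 3} (hi : K.faceEdge f i = e)
    (hj : K.faceEdge g j = e) {z : ℂ} (hz : ‖z‖ < 1 / 2) :
    alongCoord e (bookMap f g i j z) = z.re := by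
  have h1 := (Complex.abs_re_le_norm z).trans_lt hz
  have h2 := (Complex.abs_im_le_norm z).trans_lt hz
  rw [bookMap]
  split_ifs with h
  · exact alongCoord_pagePt hi h ((le_abs_self _).trans_lt h2) h1
  · exact alongCoord_pagePt hj (by linarith) ((neg_le_abs _).trans_lt h2) h1

theorem heightCoord_bookMap {e : K.E} {f g : K.F} {i j : Fin 3} (hi : K.faceEdge f i = e)
    (hj : K.faceEdge g j = e) (w : K.F → ℝ) {z : ℂ} (hz : ‖z‖ < 1 / 2) :
    heightCoord e w (bookMap f g i j z) = if 0 ≤ z.im then w f * z.im else w g * -z.im := by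
  have h1 := (Complex.abs_re_le_norm z).trans_lt hz
  have h2 := (Complex.abs_im_le_norm z).trans_lt hz
  rw [bookMap]
  split_ifs with h
  · exact heightCoord_pagePt hi w h ((le_abs_self _).trans_lt h2) h1
  · exact heightCoord_pagePt hj w (by linarith) ((neg_le_abs _).trans_lt h2) h1

/-- The function that maps the facet `f` containing `e` to the upper half plane, and all other
facets containing `e` to the lower half plane. -/
noncomputable def pageFun (e : K.E) (f : K.F) (y : K.Realization) : ℂ :=
  letI := Classical.decEq K.F
  ⟨alongCoord e y, heightCoord e (fun g => if g = f then 1 else -1) y⟩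

theorem continuousOn_pageFun (e : K.E) (f : K.F) :
    ContinuousOn (pageFun e f) {y | 0 < starCoord e y} := by
  classical
  have : pageFun e f = fun y => ((alongCoord e y : ℝ) : ℂ) +
      ((heightCoord e (fun g => if g = f then 1 else -1) y : ℝ) : ℂ) * Complex.I := by
    funext y
    rw [← Complex.mk_eq_add_mul_I, pageFun]
  rw [this]
  exact (Complex.continuous_ofReal.comp (continuous_alongCoord e)).continuousOn.add
    ((Complex.continuous_ofReal.comp_continuousOn (continuousOn_heightCoord e _)).mul
      continuousOn_const)

theorem pageFun_ne_zero {S : K.Subcomplex} {e : K.E} (f : K.F) {y : K.Realization}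
    (hy : y ∈ S.carrier) (h : 0 < starCoord e y) (hne : y ≠ midPt e) : pageFun e f y ≠ 0 := by
  classical
  intro h0
  have hre := congrArg Complex.re h0
  have him := congrArg Complex.im h0
  simp only [pageFun, Complex.zero_re, Complex.zero_im] at hre him
  refine hne (eq_midPt_of_coord_eq_zero hy h hre ?_)
  obtain ⟨t, rfl⟩ | ⟨g, hg, i, hi, t, rfl⟩ := S.exists_of_starCoord_pos hy h
  · rw [heightCoord_edgeMap]
  · rw [heightCoord_facetMap hi _ h] at him ⊢
    split_ifs at him <;> linarith

theorem pageFun_bookMap_left {e : K.E} {f g : K.F} {i j : Fin 3} (hi : K.faceEdge f i = e)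
    (hj : K.faceEdge g j = e) (hfg : g ≠ f) {z : ℂ} (hz : ‖z‖ < 1 / 2) :
    pageFun e f (bookMap f g i j z) = z := by
  apply Complex.ext
  · exact alongCoord_bookMap hi hj hz
  · refine (heightCoord_bookMap hi hj _ hz).trans ?_
    simp [hfg]

theorem pageFun_bookMap_right {e : K.E} {f g : K.F} {i j : Fin 3} (hi : K.faceEdge f i = e)
    (hj : K.faceEdge g j = e) (hfg : f ≠ g) {z : ℂ} (hz : ‖z‖ < 1 / 2) :
    pageFun e g (bookMap f g i j z) = (starRingEnd ℂ) z := by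
  apply Complex.ext
  · exact alongCoord_bookMap hi hj hz
  · refine (heightCoord_bookMap hi hj _ hz).trans ?_
    simp [hfg]

/-- This keeps the function of a page, on a loop in two other pages, in the closed lower half plane
and away from zero, so that it has a logarithm there. -/
theorem pageFun_bookMap_of_ne {e : K.E} {f g h : K.F} {i j : Fin 3} (hi : K.faceEdge f i = e)
    (hj : K.faceEdge g j = e) (hf : f ≠ h) (hg : g ≠ h) {z : ℂ} (hz : ‖z‖ < 1 / 2) :
    (pageFun e h (bookMap f g i j z)).im ≤ 0 ∧
      ‖pageFun e h (bookMap f g i j z)‖ = ‖z‖ := by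
  have hp : pageFun e h (bookMap f g i j z) = ⟨z.re, -|z.im|⟩ := by
    apply Complex.ext
    · exact alongCoord_bookMap hi hj hz
    · refine (heightCoord_bookMap hi hj _ hz).trans ?_
      split_ifs with h0
      · simp [abs_of_nonneg h0]
      · simp [abs_of_neg (not_le.1 h0)]
  rw [hp]
  refine ⟨neg_nonpos.2 (abs_nonneg _), ?_⟩
  rw [Complex.norm_def, Complex.norm_def, Complex.normSq_apply, Complex.normSq_apply]
  simp

/-- An edge of a surface does not lie in three facets of the surface. -/
theorem Subcomplex.not_three_facets (S : K.Subcomplex)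
    (hS : IsConnectedTopologicalSurface S.carrier) {e : K.E} {f g h : K.F} (hf : f ∈ S.facets)
    (hg : g ∈ S.facets) (hh : h ∈ S.facets) (hfe : K.FacetContains f e)
    (hge : K.FacetContains g e) (hhe : K.FacetContains h e) (hfg : f ≠ g) (hfh : f ≠ h)
    (hgh : g ≠ h) : False := by
  obtain ⟨_, _, _, ⟨hch⟩⟩ := hS
  obtain ⟨i, hi⟩ := hfe
  obtain ⟨j, hj⟩ := hge
  obtain ⟨k, hk⟩ := hhe
  let x : S.carrier := ⟨midPt e, by
    rw [midPt]
    exact S.edgeMap_mem (hi ▸ S.faceEdge_mem f hf i) _⟩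
  obtain ⟨φ, hx, h0⟩ := exists_chart_of_chartedSpace x
  let U : Set S.carrier := {y | 0 < starCoord e y}
  have hUo : IsOpen U :=
    isOpen_lt continuous_const ((continuous_starCoord e).comp continuous_subtype_val)
  obtain ⟨r, hr, ht, hsub⟩ := exists_chartDisc_subset hx h0 (hUo.mem_nhds (starCoord_midPt e))
  have hF : ∀ p : K.F, ∃ (n : ℤ) (l : S.carrier → ℂ), ContinuousOn l (chartDisc φ r \ {x}) ∧
      ∀ y ∈ chartDisc φ r \ {x}, pageFun e p y = φ y ^ n * Complex.exp (l y) := by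
    intro p
    refine exists_zpow_mul_exp_chartDisc hx h0 hr ht (f := fun y => pageFun e p y) ?_ ?_
    · exact (continuousOn_pageFun e p).comp continuous_subtype_val.continuousOn
        fun y hy => hsub hy.1
    · rintro y ⟨hy, hyx⟩
      exact pageFun_ne_zero p y.2 (hsub hy) fun h => hyx (Subtype.ext h)
  obtain ⟨n, l, hl, hfl⟩ := hF f
  obtain ⟨m, l', hl', hgl⟩ := hF g
  have hφ0 : ∀ y ∈ chartDisc φ r \ {x}, φ y ≠ 0 := fun y hy h =>
    hy.2 (φ.injOn hy.1.1 hx (h.trans h0.symm))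
  -- Raising to the powers `m` and `n` eliminates the chart: both sides contain the factor `φ y ^ (n
  -- * m)`.
  have hrel : ∀ y ∈ chartDisc φ r \ {x}, pageFun e f y ^ m =
      pageFun e g y ^ n * Complex.exp (m * l y - n * l' y) := by
    intro y hy
    rw [hfl y hy, hgl y hy, mul_zpow, mul_zpow, Complex.exp_sub, Complex.exp_int_mul,
      Complex.exp_int_mul, ← zpow_mul, ← zpow_mul, mul_comm m n]
    have := Complex.exp_ne_zero (l' y)
    field_simp
  -- small circles around the midpoint in two facets
  have hloop : ∀ (p q : K.F) (a b : Fin 3), p ∈ S.facets → q ∈ S.facets → K.faceEdge p a = e →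
      K.faceEdge q b = e → ∃ (γ : ℂ → S.carrier) (ε : ℝ), 0 < ε ∧ ε < 1 / 2 ∧ Continuous γ ∧
        (∀ z, (γ z : K.Realization) = bookMap p q a b z) ∧
        ∀ ε', 0 < ε' → ε' ≤ ε → Set.MapsTo γ (Metric.sphere 0 ε') (chartDisc φ r \ {x}) := by
    intro p q a b hp hq ha hb
    let γ : ℂ → S.carrier := fun z => ⟨bookMap p q a b z, bookMap_mem hp hq a b z⟩
    have hγ : Continuous γ := (continuous_bookMap ha hb).subtype_mk _
    have hγ0 : γ 0 = x := Subtype.ext (bookMap_zero ha)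
    obtain ⟨ε, hε, hball⟩ := Metric.mem_nhds_iff.1 (hγ.continuousAt.preimage_mem_nhds
      (hγ0 ▸ chartDisc_mem_nhds hx h0 hr : chartDisc φ r ∈ nhds (γ 0)))
    refine ⟨γ, min (ε / 2) (1 / 4), by positivity, (min_le_right _ _).trans_lt (by norm_num),
      hγ, fun z => rfl, fun ε' h0' hε' z hz => ?_⟩
    rw [mem_sphere_zero_iff_norm] at hz
    have h1 : ε' ≤ ε / 2 := hε'.trans (min_le_left _ _)
    have h2 : ε' ≤ 1 / 4 := hε'.trans (min_le_right _ _)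
    refine ⟨hball (by rw [mem_ball_zero_iff, hz]; linarith), fun hzx => ?_⟩
    have hzn : ‖z‖ < 1 / 2 := by rw [hz]; linarith
    have hp1 := congrArg (fun y : S.carrier => alongCoord e y) hzx
    have hp2 := congrArg (fun y : S.carrier => heightCoord e (fun _ => 1) y) hzx
    simp only [γ, x, alongCoord_bookMap ha hb hzn, heightCoord_bookMap ha hb _ hzn,
      alongCoord_midPt] at hp1 hp2
    rw [midPt, heightCoord_edgeMap] at hp2
    have him : z.im = 0 := by split_ifs at hp2 <;> linarith
    have : z = 0 := Complex.ext hp1 him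
    rw [this, norm_zero] at hz
    linarith
  -- the circle in the facets `f` and `g`
  obtain ⟨γ, ε, hε, hε2, hγ, hγb, hγm⟩ := hloop f g i j hf hg hi hj
  have hγm := hγm ε hε le_rfl
  have hlt : ∀ z ∈ Metric.sphere (0 : ℂ) ε, ‖z‖ < 1 / 2 := fun z hz => by
    rwa [mem_sphere_zero_iff_norm.1 hz]
  -- On this circle the two page functions are `z` and its conjugate `ε ^ 2 / z`, so the relation
  -- gives a logarithm of `z ^ (m + n)`.
  have hmn : m + n = 0 := by
    refine eq_zero_of_continuousOn_log_sphere hε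
      (L := fun z => n * Complex.log (ε ^ 2 : ℝ) + (m * l (γ z) - n * l' (γ z))) ?_ ?_
    · exact continuousOn_const.add ((continuousOn_const.mul (hl.comp hγ.continuousOn hγm)).sub
        (continuousOn_const.mul (hl'.comp hγ.continuousOn hγm)))
    · intro z hz
      have hz0 : z ≠ 0 := by
        rintro rfl
        simp at hz
        linarith
      have := hrel _ (hγm hz)
      rw [hγb, pageFun_bookMap_left hi hj hfg.symm (hlt z hz),
        pageFun_bookMap_right hi hj hfg (hlt z hz)] at this
      have hconj : (starRingEnd ℂ) z = ((ε ^ 2 : ℝ) : ℂ) * z⁻¹ := by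
        rw [← mem_sphere_zero_iff_norm.1 hz, eq_mul_inv_iff_mul_eq₀ hz0, mul_comm,
          Complex.mul_conj, Complex.normSq_eq_norm_sq]
      rw [Complex.exp_add, Complex.exp_int_mul, Complex.exp_log (by
        exact_mod_cast (pow_pos hε 2).ne'), zpow_add₀ hz0, this, hconj, mul_zpow, inv_zpow]
      field_simp [zpow_ne_zero n hz0]
  -- the circle in the facets `g` and `h`
  have hn : n = 0 := by
    obtain ⟨γ, ε, hε, hε2, hγ, hγb, hγm⟩ := hloop g h j k hg hh hj hk
    have hγm := hγm ε hε le_rfl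
    have hlt : ∀ z ∈ Metric.sphere (0 : ℂ) ε, ‖z‖ < 1 / 2 := fun z hz => by
      rwa [mem_sphere_zero_iff_norm.1 hz]
    -- Multiplication by `I` takes the closed lower half plane without zero into the slit plane,
    -- where the principal logarithm is continuous. Hence the relation gives a logarithm of `z ^ n`.
    have hslit : ∀ z ∈ Metric.sphere (0 : ℂ) ε,
        Complex.I * pageFun e f (γ z) ∈ Complex.slitPlane := by
      intro z hz
      obtain ⟨h1, h2⟩ := pageFun_bookMap_of_ne hj hk hfg.symm hfh.symm (hlt z hz)
      rw [← hγb] at h1 h2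
      rw [mem_sphere_zero_iff_norm.1 hz] at h2
      rw [Complex.mem_slitPlane_iff]
      rcases h1.eq_or_lt with h3 | h3
      · right
        intro h4
        have : pageFun e f (γ z) = 0 := Complex.ext (by simpa using h4) h3
        rw [this, norm_zero] at h2
        linarith
      · left
        simpa using h3
    refine eq_zero_of_continuousOn_log_sphere hε (L := fun z =>
      m * (Complex.log (Complex.I * pageFun e f (γ z)) - Complex.log Complex.I) -
        (m * l (γ z) - n * l' (γ z))) ?_ ?_
    · have hc : ContinuousOn (fun z => pageFun e f (γ z)) (Metric.sphere 0 ε) :=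
        (continuousOn_pageFun e f).comp (continuous_subtype_val.comp hγ).continuousOn
          fun z hz => hsub (hγm hz).1
      exact (continuousOn_const.mul (((continuousOn_const.mul hc).clog hslit).sub
        continuousOn_const)).sub ((continuousOn_const.mul (hl.comp hγ.continuousOn hγm)).sub
          (continuousOn_const.mul (hl'.comp hγ.continuousOn hγm)))
    · intro z hz
      have := hrel _ (hγm hz)
      have hz' : pageFun e g (γ z) = z := by
        rw [hγb, pageFun_bookMap_left hj hk hgh.symm (hlt z hz)]
      rw [hz'] at this
      rw [Complex.exp_sub, Complex.exp_int_mul, Complex.exp_sub,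
        Complex.exp_log (Complex.slitPlane_ne_zero (hslit z hz)), Complex.exp_log Complex.I_ne_zero,
        mul_div_cancel_left₀ _ Complex.I_ne_zero, this]
      exact mul_div_cancel_right₀ _ (Complex.exp_ne_zero _)
  -- With `n = 0` the page function of `f` has a logarithm on the punctured disc, but on the circle
  -- in `f` and `g` it is the identity.
  refine one_ne_zero (eq_zero_of_continuousOn_log_sphere hε (L := fun z => l (γ z))
    (hl.comp hγ.continuousOn hγm) (n := 1) fun z hz => ?_)
  have := hfl _ (hγm hz)
  rw [hγb, pageFun_bookMap_left hi hj hfg.symm (hlt z hz), hn, zpow_zero, one_mul] at this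
  rw [zpow_one, ← this]

/-- An edge of a surface lies in exactly two facets of the surface. -/
theorem Subcomplex.exists_two_facets (S : K.Subcomplex)
    (hS : IsConnectedTopologicalSurface S.carrier) {e : K.E} {f : K.F} (hf : f ∈ S.facets)
    (hfe : K.FacetContains f e) : ∃ g ∈ S.facets, K.FacetContains g e ∧ g ≠ f ∧
      ∀ h ∈ S.facets, K.FacetContains h e → h = f ∨ h = g := by
  obtain ⟨g, hg, hge, hgf⟩ := S.exists_facet_ne hS hf hfe
  refine ⟨g, hg, hge, hgf, fun h hh hhe => ?_⟩
  by_contra hcon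
  push Not at hcon
  exact S.not_three_facets hS hf hg hh hfe hge hhe hgf.symm hcon.1.symm hcon.2.symm

end DeltaComplex

/-! ### Nodal sets on a cycle with branches

Links of vertices are described by finite types `ι` of edges and `Φ` of facets at a vertex, and an
incidence relation `I`, such that a facet is incident to no edge or to exactly two. -/

/-- Every facet is incident to no edge or to exactly two edges. -/
def IsLinkIncidence {ι Φ : Type*} (I : Φ → ι → Prop) : Prop :=
  ∀ f i, I f i → ∃ j, j ≠ i ∧ I f j ∧ ∀ k, I f k → k = i ∨ k = j

/-- The edges `Si` and facets `Sf` form a cycle. -/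
structure IsCycleIn {ι Φ : Type*} (I : Φ → ι → Prop) (Si : ι → Prop) (Sf : Φ → Prop) : Prop where
  of_incident : ∀ f i, Sf f → I f i → Si i
  two_facets : ∀ f i, Sf f → I f i → ∃ g, Sf g ∧ I g i ∧ g ≠ f ∧ ∀ h, Sf h → I h i → h = f ∨ h = g
  connected : ∀ A : ι → Prop, (∀ f, Sf f → ∀ i j, I f i → I f j → A i → A j) →
    ∀ i j, Si i → Si j → A i → A j

section Link

variable {ι Φ : Type*} {I : Φ → ι → Prop}

open Classical in
theorem IsLinkIncidence.card_eq_two [Fintype ι] (hI : IsLinkIncidence I) {f : Φ} {i : ι}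
    (hi : I f i) : (Finset.univ.filter fun j => I f j).card = 2 := by
  obtain ⟨j, hji, hj, h⟩ := hI f i hi
  rw [Finset.card_eq_two]
  refine ⟨i, j, hji.symm, ?_⟩
  ext k
  simp only [Finset.mem_filter, Finset.mem_univ, true_and, Finset.mem_insert, Finset.mem_singleton]
  exact ⟨h k, by rintro (rfl | rfl) <;> assumption⟩

open Classical in
/-- In a finite set of facets, the number of edges of odd degree is even. -/
theorem IsLinkIncidence.exists_odd [Fintype ι] (hI : IsLinkIncidence I) (Z : Finset Φ) {e : ι}
    (he : Odd (Z.filter fun f => I f e).card) :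
    ∃ r, r ≠ e ∧ Odd (Z.filter fun f => I f r).card := by
  by_contra hcon
  push Not at hcon
  -- Double counting of incidences, as in the handshake lemma: each facet contributes `0` or `2`.
  have h1 := Finset.sum_card_bipartiteAbove_eq_sum_card_bipartiteBelow (s := Z)
    (t := (Finset.univ : Finset ι)) I
  have h2 : Even (∑ f ∈ Z, (Finset.bipartiteAbove I Finset.univ f).card) := by
    refine Finset.even_sum _ fun f _ => ?_
    by_cases h : ∃ i, I f i
    · obtain ⟨i, hi⟩ := h
      have := hI.card_eq_two hi
      rw [Finset.bipartiteAbove, this]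
      decide
    · push Not at h
      simp [Finset.bipartiteAbove, h]
  rw [h1, ← Nat.not_odd_iff_even, Finset.odd_sum_iff_odd_card_odd] at h2
  apply h2
  have : ((Finset.univ : Finset ι).filter fun r =>
      Odd (Finset.bipartiteBelow I Z r).card) = {e} := by
    ext r
    simp only [Finset.mem_filter, Finset.mem_univ, true_and, Finset.mem_singleton]
    refine ⟨fun h => ?_, ?_⟩
    · by_contra hr
      exact hcon r hr h
    · rintro rfl
      exact he
  rw [this]
  simp

/-- The edges that can be reached from `a` along facets of the cycle, avoiding `e` and `z`. -/
def ReachAvoiding (I : Φ → ι → Prop) (Sf : Φ → Prop) (e z a : ι) : ι → Prop :=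
  Relation.ReflTransGen (fun b c => ∃ f, Sf f ∧ I f b ∧ I f c ∧ c ≠ e ∧ c ≠ z) a

open Classical in
/-- Two edges separate a cycle. -/
theorem IsCycleIn.not_reachAvoiding [Fintype ι] [Fintype Φ] (hI : IsLinkIncidence I)
    {Si : ι → Prop} {Sf : Φ → Prop} (hS : IsCycleIn I Si Sf) {e z a b : ι} {f f' : Φ}
    (hz : Si z) (hez : z ≠ e) (hf : Sf f) (hfe : I f e) (hf' : Sf f')
    (hfe' : I f' e) (hff : f ≠ f') (ha : I f' a) (hae : a ≠ e) (haz : a ≠ z) (hb : I f b)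
    (hbe : b ≠ e) : ¬ ReachAvoiding I Sf e z a b := by
  intro hab
  set P := ReachAvoiding I Sf e z a with hP
  have hPa : P a := Relation.ReflTransGen.refl
  have hPne : ∀ i, P i → i ≠ e ∧ i ≠ z := by
    intro i hi
    rcases Relation.ReflTransGen.cases_tail hi with rfl | ⟨c, _, g, _, _, _, h1, h2⟩
    · exact ⟨hae, haz⟩
    · exact ⟨h1, h2⟩
  have hPS : ∀ i, P i → Si i := by
    intro i hi
    rcases Relation.ReflTransGen.cases_tail hi with rfl | ⟨c, _, g, hg, _, h1, _⟩
    · exact hS.of_incident f' _ hf' ha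
    · exact hS.of_incident g _ hg h1
  have hPstep : ∀ g i j, Sf g → I g i → I g j → P i → j ≠ e → j ≠ z → P j :=
    fun g i j hg hi hj hPi h1 h2 => Relation.ReflTransGen.tail hPi ⟨g, hg, hi, hj, h1, h2⟩
  let S : Finset Φ := Finset.univ.filter Sf
  let Kf : Finset ι := Finset.univ.filter P
  -- the edge `z` is adjacent to the reached edges
  obtain ⟨h, hh, hhz, k, hhk, hPk⟩ : ∃ h, Sf h ∧ I h z ∧ ∃ k, I h k ∧ P k := by
    by_contra hcon
    push Not at hcon
    have : z = e ∨ P z := hS.connected (fun i => i = e ∨ P i) (by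
      rintro g hg i j hgi hgj (rfl | hi)
      · obtain ⟨g', -, -, -, huniq⟩ := hS.two_facets f i hf hfe
        by_cases hji : j = i
        · exact .inl hji
        right
        have h1 := huniq f' hf' hfe'
        have h2 := huniq g hg hgi
        rcases h1 with h1 | h1
        · exact absurd h1.symm hff
        · rcases h2 with rfl | h2
          · obtain ⟨l, -, -, hl⟩ := hI g i hfe
            have : j = b := by
              rcases hl j hgj with h | h
              · exact absurd h hji
              · rcases hl b hb with h' | h'
                · exact absurd h' hbe
                · rw [h, h']
            rwa [this]
          · rw [← h1] at h2
            subst h2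
            obtain ⟨l, -, -, hl⟩ := hI g i hfe'
            have : j = a := by
              rcases hl j hgj with h | h
              · exact absurd h hji
              · rcases hl a ha with h' | h'
                · exact absurd h' hae
                · rw [h, h']
            rwa [this]
      · by_cases h1 : j = e
        · exact .inl h1
        · refine .inr (hPstep g i j hg hgi hgj hi h1 fun h2 => ?_)
          subst h2
          exact hcon g hg hgj i hgi hi) e z (hS.of_incident f e hf hfe) hz (.inl rfl)
    rcases this with h | h
    · exact hez h
    · exact (hPne z h).2 rfl
  -- count incidences
  let cnt : Φ → ℕ := fun g => (Finset.bipartiteAbove I Kf g).card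
  have h1 := Finset.sum_card_bipartiteAbove_eq_sum_card_bipartiteBelow (s := S) (t := Kf) I
  have h2 : ∑ i ∈ Kf, (Finset.bipartiteBelow I S i).card = 2 * Kf.card := by
    rw [Finset.sum_const_nat (m := 2), mul_comm]
    intro i hi
    have hPi : P i := (Finset.mem_filter.1 hi).2
    obtain ⟨g, hg, hgi⟩ : ∃ g, Sf g ∧ I g i := by
      rcases Relation.ReflTransGen.cases_tail hPi with rfl | ⟨c, _, g, hg, _, h1, _⟩
      · exact ⟨f', hf', ha⟩
      · exact ⟨g, hg, h1⟩
    obtain ⟨g', hg', hgi', hne, huniq⟩ := hS.two_facets g i hg hgi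
    rw [Finset.card_eq_two]
    refine ⟨g, g', hne.symm, ?_⟩
    ext l
    simp only [Finset.bipartiteBelow, S, Finset.mem_filter, Finset.mem_univ, true_and,
      Finset.mem_insert, Finset.mem_singleton]
    refine ⟨fun hl => huniq l hl.1 hl.2, ?_⟩
    rintro (rfl | rfl)
    · exact ⟨hg, hgi⟩
    · exact ⟨hg', hgi'⟩
  have hcnt : ∀ g, cnt g ≤ 2 := by
    intro g
    by_cases hg : ∃ i, I g i
    · obtain ⟨i, hi⟩ := hg
      rw [← hI.card_eq_two hi]
      exact Finset.card_le_card (Finset.filter_subset_filter _ (Finset.subset_univ _))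
    · push Not at hg
      simp [cnt, Finset.bipartiteAbove, hg]
  let B2 := S.filter fun g => cnt g = 2
  have hcnt1 : ∀ g c d, I g c → I g d → P c → ¬ P d → cnt g = 1 := by
    intro g c d hc hd hPc hPd
    rw [Finset.card_eq_one]
    refine ⟨c, ?_⟩
    ext l
    simp only [Finset.bipartiteAbove, Kf, Finset.mem_filter, Finset.mem_univ, true_and,
      Finset.mem_singleton]
    constructor
    · rintro ⟨hl, hgl⟩
      obtain ⟨m, -, -, hm⟩ := hI g d hd
      have e1 : l = m := (hm l hgl).resolve_left (by rintro rfl; exact hPd hl)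
      have e2 : c = m := (hm c hc).resolve_left (by rintro rfl; exact hPd hPc)
      rw [e1, e2]
    · rintro rfl
      exact ⟨hPc, hc⟩
  have hnPe : ¬ P e := fun h => (hPne e h).1 rfl
  have hnPz : ¬ P z := fun h => (hPne z h).2 rfl
  have hhf : h ≠ f := by
    rintro rfl
    obtain ⟨m, -, -, hm⟩ := hI h e hfe
    have e1 : z = m := (hm z hhz).resolve_left hez
    have e2 : b = m := (hm b hb).resolve_left hbe
    exact hnPz (by rw [e1, ← e2]; exact hab)
  have hhf' : h ≠ f' := by
    rintro rfl
    obtain ⟨m, -, -, hm⟩ := hI h e hfe'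
    have e1 : z = m := (hm z hhz).resolve_left hez
    have e2 : a = m := (hm a ha).resolve_left hae
    exact haz (by rw [e1, ← e2])
  -- The facets `f`, `f'` at `e` and the facet `h` at `z` each have exactly one edge in the reached
  -- set `P`.
  have hB1 : 3 ≤ (S.filter fun g => cnt g = 1).card := by
    have : ({f, f', h} : Finset Φ) ⊆ S.filter fun g => cnt g = 1 := by
      intro g hg
      simp only [Finset.mem_insert, Finset.mem_singleton] at hg
      simp only [S, Finset.mem_filter, Finset.mem_univ, true_and]
      rcases hg with rfl | rfl | rfl
      · exact ⟨hf, hcnt1 _ b e hb hfe hab hnPe⟩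
      · exact ⟨hf', hcnt1 _ a e ha hfe' hPa hnPe⟩
      · exact ⟨hh, hcnt1 _ k z hhk hhz hPk hnPz⟩
    calc 3 = ({f, f', h} : Finset Φ).card := by
          rw [Finset.card_eq_three.2 ⟨f, f', h, hff, hhf.symm, hhf'.symm, rfl⟩]
      _ ≤ _ := Finset.card_le_card this
  have h3 : (S.filter fun g => cnt g = 1).card + 2 * B2.card ≤ ∑ g ∈ S, cnt g := by
    rw [← Finset.sum_filter_add_sum_filter_not S (fun g => cnt g = 1)]
    refine add_le_add ?_ ?_
    · rw [Finset.card_eq_sum_ones]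
      exact Finset.sum_le_sum fun g hg => (Finset.mem_filter.1 hg).2.ge
    · rw [mul_comm, ← smul_eq_mul, ← Finset.sum_const]
      calc ∑ g ∈ B2, 2 ≤ ∑ g ∈ B2, cnt g :=
            Finset.sum_le_sum fun g hg => (Finset.mem_filter.1 hg).2.ge
        _ ≤ _ := Finset.sum_le_sum_of_subset fun g hg => by
            obtain ⟨h1, h2⟩ := Finset.mem_filter.1 hg
            exact Finset.mem_filter.2 ⟨h1, by rw [h2]; decide⟩
  -- compare with the number of edges of a connected graph
  let G : SimpleGraph {i // P i} :=
    { Adj := fun i j => i ≠ j ∧ ∃ g, Sf g ∧ I g i ∧ I g j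
      symm := ⟨fun i j ⟨h, g, h1, h2, h3⟩ => ⟨h.symm, g, h1, h3, h2⟩⟩
      loopless := ⟨fun i h => h.1 rfl⟩ }
  have hreach : ∀ i (hi : P i), G.Reachable ⟨a, hPa⟩ ⟨i, hi⟩ := by
    intro i hi
    induction hi with
    | refl => exact SimpleGraph.Reachable.refl _
    | @tail c d hc hcd ih =>
      obtain ⟨g, hg, h1, h2, h3, h4⟩ := hcd
      have hPd : P d := hPstep g c d hg h1 h2 hc h3 h4
      by_cases hcd' : c = d
      · subst hcd'; exact ih
      · refine (ih).trans (SimpleGraph.Adj.reachable ⟨fun h => hcd' (congrArg Subtype.val h), ?_⟩)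
        exact ⟨g, hg, h1, h2⟩
  have hconn : G.Connected := by
    rw [SimpleGraph.connected_iff]
    exact ⟨fun i j => (hreach i.1 i.2).symm.trans (hreach j.1 j.2), ⟨⟨a, hPa⟩⟩⟩
  have h4 := hconn.card_vert_le_card_edgeSet_add_one
  have h5 : Nat.card {i // P i} = Kf.card := by
    rw [Nat.card_eq_fintype_card, Fintype.card_subtype]
  have hpick : ∀ s : G.edgeSet, ∃ g : B2, ∀ i : {i // P i}, i ∈ s.1 ↔ I g.1 i := by
    rintro ⟨s, hs⟩
    induction s with
    | _ i j =>
      obtain ⟨hij, g, hg, h1, h2⟩ := hs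
      have hij' : (i : ι) ≠ j := fun h => hij (Subtype.ext h)
      refine ⟨⟨g, Finset.mem_filter.2 ⟨Finset.mem_filter.2 ⟨Finset.mem_univ _, hg⟩, ?_⟩⟩, ?_⟩
      · refine le_antisymm (hcnt g) ?_
        rw [← Finset.card_pair hij']
        refine Finset.card_le_card fun l hl => ?_
        simp only [Finset.mem_insert, Finset.mem_singleton] at hl
        simp only [Finset.bipartiteAbove, Kf, Finset.mem_filter, Finset.mem_univ, true_and]
        rcases hl with rfl | rfl
        · exact ⟨i.2, h1⟩
        · exact ⟨j.2, h2⟩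
      · intro l
        simp only [Sym2.mem_iff]
        constructor
        · rintro (rfl | rfl) <;> assumption
        · intro hl
          obtain ⟨m, -, -, hm⟩ := hI g i h1
          have e2 := (hm j h2).resolve_left hij'.symm
          rcases hm l hl with h | h
          · exact .inl (Subtype.ext h)
          · exact .inr (Subtype.ext (h.trans e2.symm))
  choose π hπ using hpick
  have hinj : Function.Injective π := by
    intro s s' hss
    apply Subtype.ext
    apply Sym2.ext
    intro i
    rw [hπ s i, hπ s' i, hss]
  have h6 : Nat.card G.edgeSet ≤ B2.card := by
    have := Nat.card_le_card_of_injective π hinj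
    rwa [Nat.card_eq_fintype_card (α := B2), Fintype.card_coe] at this
  -- The reached set carries `2 * Kf.card` incidences. The facets leaving it give at least `3`, and
  -- those inside it number at least `Kf.card - 1` by connectedness and give `2` each, which is one
  -- too many.
  change ∑ g ∈ S, cnt g = _ at h1
  omega

end Link

section Link

variable {ι Φ : Type*} {I : Φ → ι → Prop}

/-- Two edges have a facet in common. -/
def LinkAdj (I : Φ → ι → Prop) (i j : ι) : Prop := ∃ f, I f i ∧ I f j

/-- Branches attached to a cycle: every facet outside the cycle lies in a branch, and the branches
have no edges in common. -/
structure AreBranches {N : Type*} (I : Φ → ι → Prop) (Sf : Φ → Prop) (L : N → ι → Prop) :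
    Prop where
  exists_branch : ∀ f, ¬ Sf f → ∃ n, ∀ i, I f i → L n i
  unique : ∀ m n i, L m i → L n i → m = n

/-- The support of `x` has a boundary point at `z`: one facet of the cycle at `z` is disjoint from
the support of `x`, and one is not. -/
def IsTransition (I : Φ → ι → Prop) (Sf : Φ → Prop) (x : ι → ℝ) (z : ι) : Prop :=
  (∃ g, Sf g ∧ I g z ∧ ∀ i, I g i → x i = 0) ∧ ∃ g, Sf g ∧ I g z ∧ ∃ i, I g i ∧ x i ≠ 0

theorem IsTransition.eq_zero {Sf : Φ → Prop} {x : ι → ℝ} {z : ι} (h : IsTransition I Sf x z) :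
    x z = 0 := by
  obtain ⟨⟨g, -, hz, h0⟩, -⟩ := h
  exact h0 z hz

theorem IsTransition.neg {Sf : Φ → Prop} {x : ι → ℝ} {z : ι} :
    IsTransition I Sf (-x) z ↔ IsTransition I Sf x z := by
  simp [IsTransition]

open Matrix in
/-- A zero of a vector in the kernel that is adjacent to a point of the support has a neighbour
of negative sign. -/
theorem Matrix.exists_neg_of_mem_ker [Fintype ι] {M : Matrix ι ι ℝ}
    (hoff : ∀ i j, i ≠ j → 0 ≤ M i j) (hadj : ∀ i j, i ≠ j → (M i j ≠ 0 ↔ LinkAdj I i j))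
    {x : ι → ℝ} (hMx : M *ᵥ x = 0) {b k : ι} (hb : x b = 0) (hbk : LinkAdj I b k) (hk : x k ≠ 0) :
    ∃ j, j ≠ b ∧ LinkAdj I b j ∧ x j < 0 := by
  by_contra hcon
  push Not at hcon
  have h0 : ∑ j, M b j * x j = 0 := congrFun hMx b
  have hnn : ∀ j ∈ Finset.univ, 0 ≤ M b j * x j := by
    intro j _
    by_cases hj : j = b
    · simp [hj, hb]
    · by_cases hM : M b j = 0
      · simp [hM]
      · exact mul_nonneg (hoff b j (Ne.symm hj)) (hcon j hj ((hadj b j (Ne.symm hj)).1 hM))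
  rw [Finset.sum_eq_zero_iff_of_nonneg hnn] at h0
  have hkb : b ≠ k := by rintro rfl; exact hk hb
  rcases mul_eq_zero.1 (h0 k (Finset.mem_univ k)) with h | h
  · exact (hadj b k hkb).2 hbk h
  · exact hk h

variable [Fintype ι] {M : Matrix ι ι ℝ} {Si : ι → Prop} {Sf : Φ → Prop} {N : Type*}
  {L : N → ι → Prop} {x : ι → ℝ}

open Matrix in
/-- A boundary point of the support lies in a branch. -/
theorem IsTransition.exists_branch (hI : IsLinkIncidence I) (hS : IsCycleIn I Si Sf)
    (hL : AreBranches I Sf L) (hoff : ∀ i j, i ≠ j → 0 ≤ M i j)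
    (hadj : ∀ i j, i ≠ j → (M i j ≠ 0 ↔ LinkAdj I i j)) (hMx : M *ᵥ x = 0) {e : ι}
    (he : IsTransition I Sf x e) : ∃ n, L n e := by
  have he0 := he.eq_zero
  obtain ⟨⟨f, hf, hfe, hf0⟩, f', hf', hfe', a, ha, hxa⟩ := he
  have hff : f ≠ f' := by rintro rfl; exact hxa (hf0 a ha)
  obtain ⟨g, hg, hge, -, huniq⟩ := hS.two_facets f e hf hfe
  have hae : a ≠ e := by rintro rfl; exact hxa he0
  -- Of the two cycle facets at `e`, one carries only zeros and the other leads only to `a`. A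
  -- neighbour with the sign opposite to `x a`, needed to balance row `e`, must therefore be reached
  -- through a branch.
  have key : ∀ j, LinkAdj I e j → j ≠ e → x j * x a < 0 → ∃ n, L n e := by
    rintro j ⟨h, he, hj⟩ hje hneg
    by_cases hh : Sf h
    · exfalso
      have h1 := (huniq f' hf' hfe').resolve_left hff.symm
      rcases huniq h hh he with rfl | h2
      · simp [hf0 j hj] at hneg
      · rw [← h1] at h2
        subst h2
        obtain ⟨m, -, -, hm⟩ := hI h e he
        rw [(hm j hj).resolve_left hje, (hm a ha).resolve_left hae] at hneg
        exact absurd hneg (not_lt.2 (mul_self_nonneg _))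
    · obtain ⟨n, hn⟩ := hL.exists_branch h hh
      exact ⟨n, hn e he⟩
  rcases lt_or_gt_of_ne hxa with h | h
  · obtain ⟨j, hje, hj, hj0⟩ := Matrix.exists_neg_of_mem_ker hoff hadj (x := -x)
      (by rw [mulVec_neg, hMx, neg_zero]) (by simp [he0]) ⟨f', hfe', ha⟩ (by simpa using hxa)
    exact key j hj hje (mul_neg_of_pos_of_neg (by simpa using hj0) h)
  · obtain ⟨j, hje, hj, hj0⟩ := Matrix.exists_neg_of_mem_ker hoff hadj hMx he0
      ⟨f', hfe', ha⟩ hxa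
    exact key j hj hje (mul_neg_of_neg_of_pos hj0 h)

open Classical in
/-- The set of facets in a finite set `Z` of facets of the cycle that avoid the support of `x`
has another boundary point. -/
theorem IsCycleIn.exists_boundary (hI : IsLinkIncidence I) (hS : IsCycleIn I Si Sf)
    (Z : Finset Φ) (hZ : ∀ f ∈ Z, Sf f) {e : ι} {f : Φ}
    (hfZ : f ∈ Z) (hfe : I f e) (huniq : ∀ g ∈ Z, I g e → g = f) :
    ∃ b, b ≠ e ∧ ∃ g ∈ Z, I g b ∧ ∃ g', Sf g' ∧ I g' b ∧ g' ∉ Z := by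
  have he : Odd (Z.filter fun g => I g e).card := by
    have : (Z.filter fun g => I g e) = {f} := by
      ext g
      simp only [Finset.mem_filter, Finset.mem_singleton]
      exact ⟨fun h => huniq g h.1 h.2, by rintro rfl; exact ⟨hfZ, hfe⟩⟩
    rw [this]
    simp
  obtain ⟨b, hbe, hb⟩ := hI.exists_odd Z he
  refine ⟨b, hbe, ?_⟩
  obtain ⟨g, hg⟩ := Finset.card_pos.1 hb.pos
  obtain ⟨hgZ, hgb⟩ := Finset.mem_filter.1 hg
  obtain ⟨g', hg', hgb', hne, huniq'⟩ := hS.two_facets g b (hZ g hgZ) hgb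
  refine ⟨g, hgZ, hgb, g', hg', hgb', fun hgZ' => ?_⟩
  have : (Z.filter fun g => I g b) = {g, g'} := by
    ext h
    simp only [Finset.mem_filter, Finset.mem_insert, Finset.mem_singleton]
    refine ⟨fun h' => huniq' h (hZ h h'.1) h'.2, ?_⟩
    rintro (rfl | rfl)
    · exact ⟨hgZ, hgb⟩
    · exact ⟨hgZ', hgb'⟩
  rw [this, Finset.card_pair hne.symm] at hb
  exact absurd hb (by decide)

open Matrix in
/-- The case that the other edge of the branch in the cycle does not have the opposite sign. -/
theorem IsTransition.exists_ne_of_nonneg [Fintype Φ] (hI : IsLinkIncidence I)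
    (hS : IsCycleIn I Si Sf) (hL : AreBranches I Sf L) (hM : ∀ i j, M i j = M j i)
    (hoff : ∀ i j, i ≠ j → 0 ≤ M i j)
    (hadj : ∀ i j, i ≠ j → (M i j ≠ 0 ↔ LinkAdj I i j)) {u : ι → ℝ}
    (hu : ∀ z, u ⬝ᵥ z = 0 → z ⬝ᵥ M *ᵥ z ≤ 0 ∧ (z ⬝ᵥ M *ᵥ z = 0 → M *ᵥ z = 0))
    (hMx : M *ᵥ x = 0) {e a : ι} {n : N} {f f' : Φ} (hf : Sf f) (hfe : I f e)
    (hf0 : ∀ i, I f i → x i = 0) (hf' : Sf f') (hfe' : I f' e) (ha : I f' a) (hxa : 0 < x a)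
    (hn : L n e) (hpos : ∀ z, z ≠ e → Si z → L n z → 0 ≤ x z) :
    ∃ z, z ≠ e ∧ L n z ∧ IsTransition I Sf x z := by
  classical
  have he0 := hf0 e hfe
  have hff : f ≠ f' := by rintro rfl; exact hxa.ne' (hf0 a ha)
  obtain ⟨g, hg, hge, -, huniq⟩ := hS.two_facets f e hf hfe
  have hae : a ≠ e := by rintro rfl; exact hxa.ne' he0
  have hgf' := (huniq f' hf' hfe').resolve_left hff.symm
  -- The cycle facets on which `x` vanishes. Exactly one of them contains `e`, so by parity the set
  -- has a further boundary point `b`, which is a boundary point of the support of `x`.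
  let Z : Finset Φ := Finset.univ.filter fun g => Sf g ∧ ∀ i, I g i → x i = 0
  have hZ : ∀ g, g ∈ Z ↔ Sf g ∧ ∀ i, I g i → x i = 0 := by simp [Z]
  obtain ⟨b, hbe, h, hhZ, hhb, h', hh', hhb', hhZ'⟩ := hS.exists_boundary hI Z
    (fun f hf => ((hZ f).1 hf).1) ((hZ f).2 ⟨hf, hf0⟩) hfe (by
      intro h hh hhe
      refine (huniq h ((hZ h).1 hh).1 hhe).resolve_right fun h1 => ?_
      rw [← hgf'] at h1
      subst h1
      exact hxa.ne' (((hZ h).1 hh).2 a ha))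
  rw [hZ] at hhZ hhZ'
  have hh'' : ∃ i, I h' i ∧ x i ≠ 0 := by
    by_contra hcon
    push Not at hcon
    exact hhZ' ⟨hh', hcon⟩
  refine ⟨b, hbe, ?_, ⟨h, hhZ.1, hhb, hhZ.2⟩, h', hh', hhb', hh''⟩
  -- If `b` is not in the branch `n`, the negative entries inside and outside the branch contradict
  -- the nodal theorem: `e` sees a negative entry inside, while `b` sees only negative entries
  -- outside.
  by_contra hnb
  have hb0 : x b = 0 := hhZ.2 b hhb
  -- The negative entries of the branch are off the cycle, so all their neighbours belong to the
  -- same branch.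
  have hS0 : ∀ j, x j < 0 → L n j → ¬ Si j := fun j hj hnj hSj =>
    absurd (hpos j (by rintro rfl; exact hj.ne he0) hSj hnj) (not_le.2 hj)
  have hstep : ∀ j k, x j < 0 → L n j → LinkAdj I j k → L n k := by
    rintro j k hj hnj ⟨h, h1, h2⟩
    by_cases hh : Sf h
    · exact absurd (hS.of_incident h j hh h1) (hS0 j hj hnj)
    · obtain ⟨m, hm⟩ := hL.exists_branch h hh
      rw [hL.unique n m j hnj (hm j h1)]
      exact hm k h2
  have hadj0 : ∀ j k, j ≠ k → ¬ LinkAdj I j k → M j k = 0 := fun j k hjk h => by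
    by_contra hne
    exact h ((hadj j k hjk).1 hne)
  obtain ⟨i, hi, hxi⟩ := hh''
  obtain ⟨j, hjb, hj, hxj⟩ := Matrix.exists_neg_of_mem_ker hoff hadj hMx hb0 ⟨h', hhb', hi⟩ hxi
  obtain ⟨k, hke, ⟨p, hpe, hpk⟩, hxk⟩ := Matrix.exists_neg_of_mem_ker hoff hadj hMx he0
    ⟨f', hfe', ha⟩ hxa.ne'
  refine Matrix.nodal_contradiction hM hoff hu hMx (L n) ?_ he0 ⟨k, hxk, ?_, ?_⟩ hb0
    ⟨j, hxj, ?_, (hadj b j hjb.symm).2 hj⟩ ?_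
  · intro j k hj hnj hk hnk
    exact hadj0 j k (by rintro rfl; exact hnk hnj) fun h => hnk (hstep j k hj hnj h)
  · by_cases hp : Sf p
    · exfalso
      rcases huniq p hp hpe with rfl | h2
      · exact hxk.ne (hf0 k hpk)
      · rw [← hgf'] at h2
        subst h2
        obtain ⟨m, -, -, hm⟩ := hI p e hpe
        rw [(hm k hpk).resolve_left hke, ← (hm a ha).resolve_left hae] at hxk
        exact lt_asymm hxa hxk
    · obtain ⟨m, hm⟩ := hL.exists_branch p hp
      rw [hL.unique n m e hn (hm e hpe)]
      exact hm k hpk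
  · exact (hadj e k hke.symm).2 ⟨p, hpe, hpk⟩
  · intro hnj
    obtain ⟨q, h1, h2⟩ := hj
    exact hnb (hstep j b hxj hnj ⟨q, h2, h1⟩)
  · intro j hj hnj
    refine hadj0 b j (by rintro rfl; exact hnb hnj) fun ⟨q, h1, h2⟩ => ?_
    exact hnb (hstep j b hj hnj ⟨q, h2, h1⟩)

open Matrix in
/-- The case that the other edge of the branch in the cycle has the opposite sign. -/
theorem IsTransition.false_of_pos [Fintype Φ] (hI : IsLinkIncidence I)
    (hS : IsCycleIn I Si Sf) (hL : AreBranches I Sf L) (hM : ∀ i j, M i j = M j i)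
    (hoff : ∀ i j, i ≠ j → 0 ≤ M i j)
    (hadj : ∀ i j, i ≠ j → (M i j ≠ 0 ↔ LinkAdj I i j)) {u : ι → ℝ}
    (hu : ∀ z, u ⬝ᵥ z = 0 → z ⬝ᵥ M *ᵥ z ≤ 0 ∧ (z ⬝ᵥ M *ᵥ z = 0 → M *ᵥ z = 0))
    (hMx : M *ᵥ x = 0) {e a z : ι} {n : N} {f f' : Φ} (hf : Sf f) (hfe : I f e)
    (hf0 : ∀ i, I f i → x i = 0) (hf' : Sf f') (hfe' : I f' e) (ha : I f' a) (hxa : x a < 0)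
    (hze : z ≠ e) (hz : Si z) (hxz : 0 < x z)
    (hn1 : ∀ i, Si i → L n i → i = e ∨ i = z)
    (hn2 : ∀ m, m ≠ n → ∀ i j, Si i → Si j → L m i → L m j → i = j) : False := by
  classical
  have he0 := hf0 e hfe
  have hff : f ≠ f' := by rintro rfl; exact hxa.ne (hf0 a ha)
  have hae : a ≠ e := by rintro rfl; exact hxa.ne he0
  have haz : a ≠ z := by rintro rfl; exact lt_asymm hxa hxz
  -- The arc of the cycle cut out by `e` and `z` that contains `a`. The facet `f` lies beyond it on
  -- the other side of `e`, by `IsCycleIn.not_reachAvoiding`.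
  set P := ReachAvoiding I Sf e z a with hP
  have hPa : P a := Relation.ReflTransGen.refl
  have hPne : ∀ i, P i → i ≠ e ∧ i ≠ z := by
    intro i hi
    rcases Relation.ReflTransGen.cases_tail hi with rfl | ⟨c, _, g, _, _, _, h1, h2⟩
    · exact ⟨hae, haz⟩
    · exact ⟨h1, h2⟩
  have hPS : ∀ i, P i → Si i := by
    intro i hi
    rcases Relation.ReflTransGen.cases_tail hi with rfl | ⟨c, _, g, hg, _, h1, _⟩
    · exact hS.of_incident f' _ hf' ha
    · exact hS.of_incident g _ hg h1
  have hPstep : ∀ g i j, Sf g → I g i → I g j → P i → j ≠ e → j ≠ z → P j :=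
    fun g i j hg hi hj hPi h1 h2 => Relation.ReflTransGen.tail hPi ⟨g, hg, hi, hj, h1, h2⟩
  let Z : Finset Φ :=
    Finset.univ.filter fun g => Sf g ∧ ∀ i, I g i → x i = 0 ∧ ¬ P i
  have hZ : ∀ g, g ∈ Z ↔ Sf g ∧ ∀ i, I g i → x i = 0 ∧ ¬ P i := by simp [Z]
  have hfP : ∀ i, I f i → ¬ P i := by
    intro i hi
    by_cases hie : i = e
    · rintro hPi
      exact (hPne i hPi).1 hie
    · exact hS.not_reachAvoiding hI hz hze hf hfe hf' hfe' hff ha hae haz hi hie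
  obtain ⟨g, hg, hge, -, huniq⟩ := hS.two_facets f e hf hfe
  have hgf' := (huniq f' hf' hfe').resolve_left hff.symm
  obtain ⟨b, hbe, h, hhZ, hhb, h', hh', hhb', hhZ'⟩ := hS.exists_boundary hI Z
    (fun f hf => ((hZ f).1 hf).1) ((hZ f).2 ⟨hf, fun i hi => ⟨hf0 i hi, hfP i hi⟩⟩) hfe (by
      intro h hh hhe
      refine (huniq h ((hZ h).1 hh).1 hhe).resolve_right fun h1 => ?_
      rw [← hgf'] at h1
      subst h1
      exact (((hZ h).1 hh).2 a ha).2 hPa)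
  rw [hZ] at hhZ hhZ'
  obtain ⟨hb0, hPb⟩ := hhZ.2 b hhb
  have hbz : b ≠ z := by rintro rfl; exact hxz.ne' hb0
  have hSb : Si b := hS.of_incident h b hhZ.1 hhb
  -- A facet at `b` fails to be in `Z` either because `x` is nonzero on it or because it meets the
  -- arc `P`; the latter would put `b` itself on the arc.
  obtain ⟨i, hi, hxi⟩ : ∃ i, I h' i ∧ x i ≠ 0 := by
    by_contra hcon
    push Not at hcon
    exact hhZ' ⟨hh', fun i hi => ⟨hcon i hi, fun hPi =>
      hPb (hPstep h' i b hh' hi hhb' hPi hbe hbz)⟩⟩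
  -- The arc together with the branches attached to it. The branch `n` meets the cycle only in `e`
  -- and `z`, and any other branch meets it at most once, so `R` can be left only through `e` or
  -- `z`, where `x` is not negative.
  let R : ι → Prop := fun j => ∃ q, P q ∧ (j = q ∨ ∃ l, L l j ∧ L l q)
  have hRS : ∀ j, R j → Si j → P j := by
    rintro j ⟨q, hq, rfl | ⟨l, h1, h2⟩⟩ hj
    · exact hq
    · have hln : l ≠ n := by
        rintro rfl
        rcases hn1 q (hPS q hq) h2 with h | h
        · exact (hPne q hq).1 h
        · exact (hPne q hq).2 h
      rwa [hn2 l hln j q hj (hPS q hq) h1 h2]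
  have hRstep : ∀ j k, R j → LinkAdj I j k → k ≠ e → k ≠ z → R k := by
    rintro j k hRj ⟨g, hgj, hgk⟩ h1 h2
    by_cases hg : Sf g
    · have hPj := hRS j hRj (hS.of_incident g j hg hgj)
      exact ⟨k, hPstep g j k hg hgj hgk hPj h1 h2, .inl rfl⟩
    · obtain ⟨l, hl⟩ := hL.exists_branch g hg
      obtain ⟨q, hq, rfl | ⟨l', h3, h4⟩⟩ := hRj
      · exact ⟨j, hq, .inr ⟨l, hl k hgk, hl j hgj⟩⟩
      · rw [hL.unique l' l j h3 (hl j hgj)] at h4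
        exact ⟨q, hq, .inr ⟨l, hl k hgk, h4⟩⟩
  have hRb : ∀ j, R j → ¬ LinkAdj I b j := fun j hRj ⟨q, h1, h2⟩ =>
    hPb (hRS b (hRstep j b hRj ⟨q, h2, h1⟩ hbe hbz) hSb)
  have hadj0 : ∀ j k, j ≠ k → ¬ LinkAdj I j k → M j k = 0 := fun j k hjk h => by
    by_contra hne
    exact h ((hadj j k hjk).1 hne)
  obtain ⟨j, hjb, hj, hxj⟩ := Matrix.exists_neg_of_mem_ker hoff hadj hMx hb0 ⟨h', hhb', hi⟩ hxi
  refine Matrix.nodal_contradiction hM hoff hu hMx R ?_ he0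
    ⟨a, hxa, ⟨a, hPa, .inl rfl⟩, (hadj e a hae.symm).2 ⟨f', hfe', ha⟩⟩ hb0
    ⟨j, hxj, fun hRj => hRb j hRj hj, (hadj b j hjb.symm).2 hj⟩ ?_
  · intro j k hj hRj hk hRk
    refine hadj0 j k (by rintro rfl; exact hRk hRj) fun h => hRk (hRstep j k hRj h ?_ ?_)
    · rintro rfl; exact hk.ne he0
    · rintro rfl; exact lt_asymm hk hxz
  · intro j hj hRj
    refine hadj0 b j (by rintro rfl; exact hPb (hRS b hRj hSb)) (hRb j hRj)

open Matrix in
/-- If the support of a vector in the kernel has a boundary point in a branch, then it has another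
boundary point in the same branch. -/
theorem IsTransition.exists_ne [Fintype Φ] (hI : IsLinkIncidence I)
    (hS : IsCycleIn I Si Sf) (hL : AreBranches I Sf L) (hM : ∀ i j, M i j = M j i)
    (hoff : ∀ i j, i ≠ j → 0 ≤ M i j)
    (hadj : ∀ i j, i ≠ j → (M i j ≠ 0 ↔ LinkAdj I i j)) {u : ι → ℝ}
    (hu : ∀ z, u ⬝ᵥ z = 0 → z ⬝ᵥ M *ᵥ z ≤ 0 ∧ (z ⬝ᵥ M *ᵥ z = 0 → M *ᵥ z = 0))
    (hMx : M *ᵥ x = 0) {e : ι} {n : N} (he : IsTransition I Sf x e) (hn : L n e)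
    (hn1 : ∀ i j, i ≠ e → j ≠ e → Si i → Si j → L n i → L n j → i = j)
    (hn2 : ∀ z, z ≠ e → Si z → L n z →
      ∀ m, m ≠ n → ∀ i j, Si i → Si j → L m i → L m j → i = j) :
    ∃ z, z ≠ e ∧ L n z ∧ IsTransition I Sf x z := by
  obtain ⟨⟨f, hf, hfe, hf0⟩, f', hf', hfe', a, ha, hxa⟩ := he
  -- up to a sign, the vector is positive at `a`
  have main : ∀ x : ι → ℝ, M *ᵥ x = 0 → (∀ i, I f i → x i = 0) → 0 < x a →
      ∃ z, z ≠ e ∧ L n z ∧ IsTransition I Sf x z := by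
    intro x hMx hf0 hxa
    by_cases hz : ∃ z, z ≠ e ∧ Si z ∧ L n z ∧ x z < 0
    · exfalso
      obtain ⟨z, hze, hz, hnz, hxz⟩ := hz
      refine IsTransition.false_of_pos (x := -x) hI hS hL hM hoff hadj hu
        (by rw [mulVec_neg, hMx, neg_zero]) hf hfe (fun i hi => by simp [hf0 i hi]) hf' hfe' ha
        (by simpa using hxa) hze hz (by simpa using hxz) (n := n) (fun i hi hni => ?_)
        (hn2 z hze hz hnz)
      by_cases hie : i = e
      · exact .inl hie
      · exact .inr (hn1 i z hie hze hi hz hni hnz)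
    · push Not at hz
      exact IsTransition.exists_ne_of_nonneg hI hS hL hM hoff hadj hu hMx hf hfe hf0 hf' hfe' ha
        hxa hn hz
  rcases lt_or_gt_of_ne hxa with h | h
  · obtain ⟨z, h1, h2, h3⟩ := main (-x) (by rw [mulVec_neg, hMx, neg_zero])
      (fun i hi => by simp [hf0 i hi]) (by simpa using h)
    exact ⟨z, h1, h2, IsTransition.neg.1 h3⟩
  · exact main x hMx hf0 h

end Link

theorem Fin.exists_third : ∀ i j : Fin 3, i ≠ j →
    ∃ m : Fin 3, m ≠ i ∧ m ≠ j ∧ ∀ l, l ≠ j → l = i ∨ l = m := by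
  decide

/-! ### Vanishing of balanced cocycles on the manifold. -/

namespace DeltaComplex

variable {K : DeltaComplex.{u}}

theorem edgeContains_faceEdge_iff {f : K.F} {i j : Fin 3} :
    K.EdgeContains (K.faceEdge f i) (K.faceVert f j) ↔ i ≠ j := by
  refine ⟨?_, edgeContains_faceEdge⟩
  rintro ⟨k, hk⟩ rfl
  rw [K.edgeVert_faceEdge] at hk
  exact Fin.succAbove_ne i k (K.faceVert_injective f hk)

theorem exists_faceVert_of_contains {f : K.F} {e : K.E} {v : K.V} (hf : K.FacetContains f e)
    (hv : K.EdgeContains e v) : ∃ i j, i ≠ j ∧ K.faceEdge f i = e ∧ K.faceVert f j = v := by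
  obtain ⟨i, rfl⟩ := hf
  obtain ⟨k, rfl⟩ := hv
  exact ⟨i, i.succAbove k, (Fin.succAbove_ne i k).symm, rfl, (K.edgeVert_faceEdge f i k).symm⟩

theorem isLinkIncidence (v : K.V) :
    IsLinkIncidence fun (f : K.F) (e : {e : K.E // K.EdgeContains e v}) =>
      K.FacetContains f e.1 := by
  rintro f ⟨e, he⟩ hf
  obtain ⟨i, j, hij, rfl, rfl⟩ := exists_faceVert_of_contains hf he
  obtain ⟨m, hmi, hmj, hm⟩ := Fin.exists_third i j hij
  refine ⟨⟨K.faceEdge f m, edgeContains_faceEdge hmj⟩, fun h => hmi ?_, ⟨m, rfl⟩, ?_⟩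
  · exact faceEdge_injective f (congrArg Subtype.val h)
  · rintro ⟨_, hl⟩ ⟨l, rfl⟩
    rcases hm l (edgeContains_faceEdge_iff.1 hl) with rfl | rfl
    · exact .inl rfl
    · exact .inr rfl

theorem Subcomplex.isCycleIn (S : K.Subcomplex) (hS : IsConnectedTopologicalSurface S.carrier)
    (v : K.V) :
    IsCycleIn (fun (f : K.F) (e : {e : K.E // K.EdgeContains e v}) => K.FacetContains f e.1)
      (fun e => e.1 ∈ S.edges) (fun f => f ∈ S.facets) where
  of_incident := by
    rintro f ⟨e, he⟩ hf ⟨i, rfl⟩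
    exact S.faceEdge_mem f hf i
  two_facets f e hf hfe := S.exists_two_facets hS hf hfe
  connected A hA e e' he he' hAe := by
    obtain ⟨h, h'⟩ := S.link_connected hS (v := v) (fun e => ∃ h : K.EdgeContains e v, A ⟨e, h⟩)
      (by
        rintro f hf i j hi hj ⟨h, hAi⟩
        exact ⟨hj, hA f hf ⟨_, hi⟩ ⟨_, hj⟩ ⟨i, rfl⟩ ⟨j, rfl⟩ hAi⟩) he e.2 he' e'.2 ⟨e.2, hAe⟩
    exact h'

namespace ManifoldWithFins

variable (M : K.ManifoldWithFins)

theorem eq_of_mem_edges {m n : Fin M.n} {e : K.E} (hm : e ∈ (M.fins m).edges)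
    (hn : e ∈ (M.fins n).edges) : m = n := by
  rcases lt_trichotomy m n with h | h | h
  · exact absurd (show e ∈ ((M.fins m).inter (M.fins n)).edges from ⟨hm, hn⟩)
      (by rw [M.edges_inter n m h]; exact Set.notMem_empty e)
  · exact h
  · exact absurd (show e ∈ ((M.fins n).inter (M.fins m)).edges from ⟨hn, hm⟩)
      (by rw [M.edges_inter m n h]; exact Set.notMem_empty e)

theorem areBranches (v : K.V) :
    AreBranches (fun (f : K.F) (e : {e : K.E // K.EdgeContains e v}) => K.FacetContains f e.1)
      (fun f => f ∈ M.S.facets) (fun n e => e.1 ∈ (M.fins n).edges) where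
  exists_branch f hf := by
    obtain ⟨n, hn⟩ := (M.facets_cover f).resolve_left hf
    refine ⟨n, ?_⟩
    rintro ⟨e, he⟩ ⟨i, rfl⟩
    exact (M.fins n).faceEdge_mem f hn i
  unique m n e hm hn := M.eq_of_mem_edges hm hn

end ManifoldWithFins

/-- This bounds the number of edges in which a later fin meets the cycle at a vertex of an earlier
one, since such a vertex is an end point of the path of the later fin. -/
theorem eq_of_edge_at_path_end {n : ℕ} {p : Fin (n + 1) → K.V} {q : Fin n → K.E}
    (hp : Function.Injective p)
    (hq : ∀ k, Set.range (K.edgeVert (q k)) = {p k.castSucc, p k.succ}) {v : K.V}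
    (hv : v = p 0 ∨ v = p (Fin.last n)) {k l : Fin n} (hk : K.EdgeContains (q k) v)
    (hl : K.EdgeContains (q l) v) : k = l := by
  have key : ∀ k, K.EdgeContains (q k) v → v = p k.castSucc ∨ v = p k.succ := by
    intro k hk
    have : v ∈ Set.range (K.edgeVert (q k)) := hk
    rwa [hq k] at this
  have hk := key k hk
  have hl := key l hl
  rcases hv with rfl | rfl <;> simp only [hp.eq_iff, Fin.ext_iff, Fin.val_zero, Fin.val_castSucc,
    Fin.val_succ, Fin.val_last] at hk hl ⊢ <;> omega

/-- The facets on whose edges a cocycle vanishes. -/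
def ZeroFacet (c : K.E → ℤ) (f : K.F) : Prop := ∀ i, c (K.faceEdge f i) = 0

theorem IsCocycle.zeroFacet {c : K.E → ℤ} (hc : IsCocycle c) {f : K.F} {j : Fin 3}
    (h : ∀ i, i ≠ j → c (K.faceEdge f i) = 0) : ZeroFacet c f := by
  intro i
  have := hc f
  by_cases hij : i = j
  · subst hij
    fin_cases i
    · have h1 := h 1 (by decide); have h2 := h 2 (by decide); simp only [Fin.zero_eta]; omega
    · have h1 := h 0 (by decide); have h2 := h 2 (by decide); simp only [Fin.mk_one]; omega
    · have h1 := h 0 (by decide); have h2 := h 1 (by decide); simp only [Fin.reduceFinMk]; omega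
  · exact h i hij

end DeltaComplex

namespace WeakTropicalSurface

open DeltaComplex

variable {T : WeakTropicalSurface.{u}}

open Classical in
/-- The value of a cocycle on an edge, oriented away from the vertex `v`. -/
noncomputable def slope (c : T.E → ℤ) (v : T.V) (e : T.E) : ℤ :=
  if T.edgeVert e 0 = v then c e else -c e

theorem slope_eq_zero {c : T.E → ℤ} {v : T.V} {e : T.E} : slope c v e = 0 ↔ c e = 0 := by
  rw [slope]
  split_ifs <;> simp

open Classical Matrix in
/-- The cocycles that come from sections of the sheaf of linear functions modulo constants. -/
def IsBalanced (c : T.E → ℤ) : Prop :=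
  ∀ v, T.localMatrix v *ᵥ (fun e => (slope c v e.1 : ℝ)) = 0

theorem localMatrix_symm (v : T.V) (i j) : T.localMatrix v i j = T.localMatrix v j i := by
  have := (T.isHermitian_localMatrix v).apply j i
  simpa using this

theorem localMatrix_nonneg (v : T.V) (i j) (hij : i ≠ j) : 0 ≤ T.localMatrix v i j := by
  simp [localMatrix, hij]

theorem localMatrix_ne_zero (v : T.V) (i j) (hij : i ≠ j) : T.localMatrix v i j ≠ 0 ↔
    LinkAdj (fun (f : T.F) (e : T.EdgesAt v) => T.FacetContains f e.1) i j := by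
  classical
  simp only [localMatrix, Matrix.of_apply, if_neg hij, ne_eq, Nat.cast_eq_zero]
  rw [← ne_eq, ← Nat.pos_iff_ne_zero, Fintype.card_pos_iff]
  exact ⟨fun ⟨f, h⟩ => ⟨f, h⟩, fun ⟨f, h⟩ => ⟨f, h⟩⟩

/-- A cocycle that vanishes on two edges of a facet vanishes on the third. The right side does not
depend on `v`, so a boundary edge found in the link of one of its ends can be used in the link of
the other; this lets the argument move along a path. -/
theorem isTransition_iff {c : T.E → ℤ} (hc : IsCocycle c) (S : T.Subcomplex) {v : T.V}
    (e : T.EdgesAt v) :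
    IsTransition (fun (f : T.F) (e : T.EdgesAt v) => T.FacetContains f e.1)
      (fun f => f ∈ S.facets) (fun e => (slope c v e.1 : ℝ)) e ↔
    (∃ f ∈ S.facets, T.FacetContains f e.1 ∧ ZeroFacet c f) ∧
      ∃ f ∈ S.facets, T.FacetContains f e.1 ∧ ¬ ZeroFacet c f := by
  have key : ∀ f, T.FacetContains f e.1 → ((∀ i : T.EdgesAt v, T.FacetContains f i.1 →
      (slope c v i.1 : ℝ) = 0) ↔ ZeroFacet c f) := by
    intro f hf
    obtain ⟨i, j, hij, hi, rfl⟩ := exists_faceVert_of_contains hf e.2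
    constructor
    · intro h
      refine hc.zeroFacet (j := j) fun l hl => ?_
      have := h ⟨T.faceEdge f l, edgeContains_faceEdge hl⟩ ⟨l, rfl⟩
      rwa [Int.cast_eq_zero, slope_eq_zero] at this
    · rintro h ⟨_, hl⟩ ⟨l, rfl⟩
      rw [Int.cast_eq_zero, slope_eq_zero]
      exact h l
  refine and_congr (exists_congr fun f => and_congr_right fun _ => and_congr_right fun hf =>
    key f hf) (exists_congr fun f => and_congr_right fun _ => and_congr_right fun hf => ?_)
  rw [← key f hf]
  push Not
  rfl

/-- Two facets of the manifold that share an edge are both zero facets or both not. -/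
theorem zeroFacet_of_adjacent (hT : T.IsTropicalSurface) (M : T.ManifoldWithFins)
    {c : T.E → ℤ} (hc : IsCocycle c) (hb : IsBalanced c) {e : T.E} {f g : T.F} (hf : f ∈ M.S.facets)
    (hfe : T.FacetContains f e) (hg : g ∈ M.S.facets) (hge : T.FacetContains g e)
    (h0 : ZeroFacet c f) : ZeroFacet c g := by
  classical
  by_contra hg0
  let G : T.E → Prop := fun e => (∃ f ∈ M.S.facets, T.FacetContains f e ∧ ZeroFacet c f) ∧
      ∃ f ∈ M.S.facets, T.FacetContains f e ∧ ¬ ZeroFacet c f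
  have hG : ∀ {v : T.V} (e : T.EdgesAt v), _ ↔ G e.1 := isTransition_iff hc M.S
  have hGS : ∀ e, G e → e ∈ M.S.edges := by
    rintro _ ⟨⟨f, hf, ⟨i, rfl⟩, _⟩, _⟩
    exact M.S.faceEdge_mem f hf i
  have hGe : G e := ⟨⟨f, hf, hfe, h0⟩, g, hg, hge, hg0⟩
  obtain ⟨n, hn⟩ := IsTransition.exists_branch (isLinkIncidence _)
    (M.S.isCycleIn M.isSurface (T.edgeVert e 0)) (M.areBranches _) (localMatrix_nonneg _)
    (localMatrix_ne_zero _) (hb (T.edgeVert e 0)) (e := ⟨e, 0, rfl⟩) ((hG _).2 hGe)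
  obtain ⟨m, p, q, hp, hp0, hpm, hq, hverts, hedges, -⟩ := M.isPath n
  have hmem : ∀ {e}, G e → e ∈ (M.fins n).edges → e ∈ Set.range q := by
    intro e he hen
    rw [← hedges]
    exact ⟨hen, hGS e he⟩
  obtain ⟨k, hk⟩ := hmem hGe hn
  -- The last boundary edge on the path in which the fin meets the manifold. At its far end `v`, the
  -- only other edge of this path can be the next one.
  obtain ⟨a, ha, hmax⟩ := Finset.exists_max_image (Finset.univ.filter fun k => G (q k)) id
    ⟨k, by simpa [hk] using hGe⟩
  have hGa : G (q a) := (Finset.mem_filter.1 ha).2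
  set v := p a.succ with hv
  have hcont : ∀ k, T.EdgeContains (q k) v ↔ k.castSucc = a.succ ∨ k = a := by
    intro k
    change v ∈ Set.range (T.edgeVert (q k)) ↔ _
    rw [hq k, Set.mem_insert_iff, Set.mem_singleton_iff, hv, hp.eq_iff, hp.eq_iff,
      Fin.succ_inj, eq_comm, eq_comm (a := a)]
  have hqS : ∀ k, q k ∈ (M.fins n).edges ∧ q k ∈ M.S.edges := by
    intro k
    have : q k ∈ ((M.fins n).inter M.S).edges := by rw [hedges]; exact ⟨k, rfl⟩
    exact this
  have hrange : ∀ i : T.EdgesAt v, i.1 ∈ M.S.edges → i.1 ∈ (M.fins n).edges →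
      i.1 ≠ q a → ∃ k, i.1 = q k ∧ k.castSucc = a.succ := by
    intro i hi hin hne
    have : i.1 ∈ Set.range q := by rw [← hedges]; exact ⟨hin, hi⟩
    obtain ⟨k, hk⟩ := this
    refine ⟨k, hk.symm, ((hcont k).1 (hk ▸ i.2)).resolve_right ?_⟩
    rintro rfl
    exact hne hk.symm
  obtain ⟨u, -, hu⟩ := (T.isHermitian_localMatrix v).exists_of_existsUnique_pos (hT v)
  obtain ⟨z, hze, hzn, hz⟩ := IsTransition.exists_ne (isLinkIncidence _)
    (M.S.isCycleIn M.isSurface v) (M.areBranches _) (localMatrix_symm _) (localMatrix_nonneg _)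
    (localMatrix_ne_zero _) hu (hb v) (e := ⟨q a, (hcont a).2 (.inr rfl)⟩) (n := n)
    ((hG _).2 hGa) (hqS a).1
    (by
      intro i j hi hj hiS hjS hin hjn
      obtain ⟨k, hk, hka⟩ := hrange i hiS hin fun h => hi (Subtype.ext h)
      obtain ⟨l, hl, hla⟩ := hrange j hjS hjn fun h => hj (Subtype.ext h)
      have : k = l := Fin.castSucc_injective _ (hka.trans hla.symm)
      exact Subtype.ext (by rw [hk, hl, this]))
    (by
      intro z hz hzS hzn l hln i j hi hj hil hjl
      obtain ⟨k, hk, hka⟩ := hrange z hzS hzn fun h => hz (Subtype.ext h)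
      have hvn : v ∈ (M.fins n).verts := by
        obtain ⟨r, hr⟩ := z.2
        rw [← hr]
        exact (M.fins n).edgeVert_mem _ hzn r
      have hvl : v ∈ (M.fins l).verts := by
        obtain ⟨r, hr⟩ := i.2
        rw [← hr]
        exact (M.fins l).edgeVert_mem _ hil r
      -- Here `v` is an inner vertex of the path of the fin `n`. An earlier fin meets the fin `n`
      -- only in end points of that path, so it cannot contain `v`. A later one contains `v` only as
      -- an end point of its own path, which has at most one edge there.
      rcases lt_or_gt_of_ne hln with h | h
      · exfalso
        rcases M.verts_inter n l h ⟨hvl, hvn⟩ with h1 | h1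
        · rw [← hp0, hv] at h1
          exact Fin.succ_ne_zero a (hp h1)
        · rw [Set.mem_singleton_iff, ← hpm, hv, ← hka] at h1
          exact (Fin.castSucc_lt_last k).ne (hp h1)
      · have hend := M.verts_inter l n h ⟨hvn, hvl⟩
        obtain ⟨m', p', q', hp', hp0', hpm', hq', -, hedges', -⟩ := M.isPath l
        have hi' : i.1 ∈ Set.range q' := by rw [← hedges']; exact ⟨hil, hi⟩
        have hj' : j.1 ∈ Set.range q' := by rw [← hedges']; exact ⟨hjl, hj⟩
        obtain ⟨k1, hk1⟩ := hi'
        obtain ⟨k2, hk2⟩ := hj'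
        have : k1 = k2 := eq_of_edge_at_path_end hp' hq' (v := v) (by
          rw [hp0', hpm']; exact hend) (by rw [hk1]; exact i.2) (by rw [hk2]; exact j.2)
        exact Subtype.ext (by rw [← hk1, ← hk2, this]))
  have hGz := (hG z).1 hz
  obtain ⟨k, hk, hka⟩ := hrange z (hGS _ hGz) hzn fun h => hze (Subtype.ext h)
  have := hmax k (by simpa [← hk] using hGz)
  simp only [id] at this
  have h1 := congrArg Fin.val hka
  simp only [Fin.val_castSucc, Fin.val_succ] at h1
  rw [Fin.le_def] at this
  omega

/-- A balanced cocycle that vanishes on a facet of the manifold vanishes on the manifold. -/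
theorem eq_zero_on_surface (hT : T.IsTropicalSurface) (M : T.ManifoldWithFins)
    {c : T.E → ℤ} (hc : IsCocycle c) (hb : IsBalanced c) {s : T.F} (hs : s ∈ M.S.facets)
    (h0 : ZeroFacet c s) {e : T.E}
    (he : e ∈ M.S.edges) : c e = 0 := by
  have hadj := fun {e f g} => zeroFacet_of_adjacent hT M hc hb (e := e) (f := f) (g := g)
  -- Zero facets spread around a vertex because its link in the surface is connected, and from
  -- vertex to vertex along edges because the surface is.
  let P : T.V → Prop := fun v => ∀ f ∈ M.S.facets, (∃ i, T.faceVert f i = v) → ZeroFacet c f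
  have hP : ∀ v, ∀ f ∈ M.S.facets, (∃ i, T.faceVert f i = v) → ZeroFacet c f → P v := by
    rintro _ f hf ⟨i, rfl⟩ hf0 g hg ⟨j, hj⟩
    obtain ⟨i', hi'⟩ : ∃ i' : Fin 3, i' ≠ i := exists_ne i
    obtain ⟨j', hj'⟩ : ∃ j' : Fin 3, j' ≠ j := exists_ne j
    have := M.S.link_connected M.isSurface (v := T.faceVert f i)
      (fun e => ∀ g ∈ M.S.facets, T.FacetContains g e → ZeroFacet c g)
      (fun g hg k l _ _ h h' hh' hl => hadj hg ⟨l, rfl⟩ hh' hl (h g hg ⟨k, rfl⟩))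
      (M.S.faceEdge_mem f hf i') (edgeContains_faceEdge hi')
      (M.S.faceEdge_mem g hg j') (hj ▸ edgeContains_faceEdge hj')
      (fun g hg hge => hadj hf ⟨i', rfl⟩ hg hge hf0)
    exact this g hg ⟨j', rfl⟩
  have : PreconnectedSpace M.S.carrier := M.isSurface.1.toPreconnectedSpace
  have hstep : ∀ e ∈ M.S.edges, ∀ k l, P (T.edgeVert e k) → P (T.edgeVert e l) := by
    intro e he k l hk
    obtain ⟨f, hf, i, rfl⟩ := M.S.exists_facet M.isSurface he
    exact hP _ f hf ⟨_, (T.edgeVert_faceEdge f i l).symm⟩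
      (hk f hf ⟨_, (T.edgeVert_faceEdge f i k).symm⟩)
  obtain ⟨f, hf, i, rfl⟩ := M.S.exists_facet M.isSurface he
  refine M.S.of_preconnected P (fun e he => ⟨hstep e he 0 1, hstep e he 1 0⟩)
    (M.S.faceVert_mem hs 0) (M.S.faceVert_mem hf 0) (hP _ s hs ⟨0, rfl⟩ h0) f hf ⟨0, rfl⟩ i

end WeakTropicalSurface

/-! ### Fins: vertices joined to the manifold while avoiding a given vertex. -/

namespace DeltaComplex

variable {K : DeltaComplex.{u}}

theorem EdgeContains.exists_other {e : K.E} {v : K.V} (h : K.EdgeContains e v) :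
    ∃ w, w ≠ v ∧ K.EdgeContains e w := by
  obtain ⟨k, rfl⟩ := h
  obtain ⟨l, hl⟩ := exists_ne k
  exact ⟨_, fun h => hl (K.edgeVert_injective e h), l, rfl⟩

theorem EdgeContains.eq_or_eq {e : K.E} {v w x : K.V} (hv : K.EdgeContains e v)
    (hw : K.EdgeContains e w) (hx : K.EdgeContains e x) (hwv : w ≠ v) : x = v ∨ x = w := by
  obtain ⟨k, rfl⟩ := hv
  obtain ⟨l, rfl⟩ := hw
  obtain ⟨r, rfl⟩ := hx
  have hlk : l ≠ k := fun h => hwv (by rw [h])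
  have : r = k ∨ r = l := by omega
  exact this.imp (congrArg _) (congrArg _)

namespace Subcomplex

variable {F : K.Subcomplex}

theorem mem_verts_of_contains {e : K.E} {v : K.V} (he : e ∈ F.edges)
    (hv : K.EdgeContains e v) : v ∈ F.verts := by
  obtain ⟨k, rfl⟩ := hv
  exact F.edgeVert_mem e he k

variable (F) in
/-- The vertices that are joined to `a` by a sequence of edges of `F` that do not contain `v`. -/
def JoinedAvoiding (v a : K.V) : K.V → Prop :=
  Relation.ReflTransGen (fun x y => x ≠ v ∧ y ≠ v ∧
    ∃ e ∈ F.edges, K.EdgeContains e x ∧ K.EdgeContains e y) a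

theorem JoinedAvoiding.ne {v a w : K.V} (h : F.JoinedAvoiding v a w) (ha : a ≠ v) : w ≠ v := by
  cases h with
  | refl => exact ha
  | tail _ h => exact h.2.1

theorem JoinedAvoiding.step {v a w x : K.V} {e : K.E} (h : F.JoinedAvoiding v a w) (ha : a ≠ v)
    (he : e ∈ F.edges) (hw : K.EdgeContains e w) (hx : K.EdgeContains e x) (hxv : x ≠ v) :
    F.JoinedAvoiding v a x :=
  h.tail ⟨h.ne ha, hxv, e, he, hw, hx⟩

/-- A sequence that avoids `v` and passed through `w` would join `a` to `w`. -/
theorem JoinedAvoiding.of_not_joined {v a w x : K.V} (hw : ¬ F.JoinedAvoiding v a w)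
    (h : F.JoinedAvoiding v a x) : F.JoinedAvoiding w a x := by
  induction h with
  | refl => exact .refl
  | tail h hs ih =>
    refine ih.tail ⟨?_, ?_, hs.2.2⟩
    · rintro rfl
      exact hw h
    · rintro rfl
      exact hw (h.tail hs)

theorem JoinedAvoiding.eq_of_const {v a w : K.V} {ψ : K.V → ℤ}
    (hψ : ∀ e ∈ F.edges, ¬ K.EdgeContains e v → ψ (K.edgeVert e 1) = ψ (K.edgeVert e 0))
    (h : F.JoinedAvoiding v a w) : ψ w = ψ a := by
  have key : ∀ {x y : K.V}, x ≠ v → y ≠ v → (∃ e ∈ F.edges, K.EdgeContains e x ∧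
      K.EdgeContains e y) → ψ y = ψ x := by
    rintro x y hx hy ⟨e, he, hex, hey⟩
    by_cases hxy : y = x
    · rw [hxy]
    have := hψ e he fun hv => by
      rcases hex.eq_or_eq hey hv hxy with h | h
      · exact hx h.symm
      · exact hy h.symm
    have h2 : ∀ k, ψ (K.edgeVert e k) = ψ (K.edgeVert e 0) := by
      intro k
      fin_cases k
      · rfl
      · exact this
    obtain ⟨k, rfl⟩ := hex
    obtain ⟨l, rfl⟩ := hey
    rw [h2 k, h2 l]
  induction h with
  | refl => rfl
  | tail _ hs ih => rw [← ih, key hs.1 hs.2.1 hs.2.2]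

/-- Otherwise the vertices joined to `a` would be closed under all edges of `F`, including those at
`v`, and connectedness would put `v` among them. -/
theorem exists_joinedAvoiding [PreconnectedSpace F.carrier] {v a : K.V} (ha : a ∈ F.verts)
    (hv : v ∈ F.verts) (hav : a ≠ v) : ∃ e ∈ F.edges, ∃ w, w ≠ v ∧ K.EdgeContains e v ∧
      K.EdgeContains e w ∧ F.JoinedAvoiding v a w := by
  by_contra! hcon
  refine (F.of_preconnected (F.JoinedAvoiding v a) (fun e he => ?_) ha hv .refl).ne hav rfl
  by_cases hev : K.EdgeContains e v
  · have : ∀ x, K.EdgeContains e x → ¬ F.JoinedAvoiding v a x := fun x hx h =>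
      hcon e he x (h.ne hav) hev hx h
    exact iff_of_false (this _ ⟨0, rfl⟩) (this _ ⟨1, rfl⟩)
  · exact ⟨fun h => h.step hav he ⟨0, rfl⟩ ⟨1, rfl⟩ fun h => hev ⟨1, h⟩,
      fun h => h.step hav he ⟨1, rfl⟩ ⟨0, rfl⟩ fun h => hev ⟨0, h⟩⟩

theorem IsPath.induction {S : K.Subcomplex} {a b : K.V} (h : S.IsPath a b) (P : K.V → Prop)
    (ha : P a) (hP : ∀ e ∈ S.edges, ∀ x y, K.EdgeContains e x → K.EdgeContains e y → P x → P y)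
    {v : K.V} (hv : v ∈ S.verts) : P v := by
  obtain ⟨m, p, q, -, rfl, -, hq, hverts, hedges, -⟩ := h
  rw [hverts] at hv
  obtain ⟨k, rfl⟩ := hv
  induction k using Fin.induction with
  | zero => exact ha
  | succ k ih =>
    have hmem : ∀ x, x ∈ ({p k.castSucc, p k.succ} : Set K.V) → K.EdgeContains (q k) x := by
      intro x hx
      rw [← hq k] at hx
      exact hx
    exact hP (q k) (hedges ▸ ⟨k, rfl⟩) _ _ (hmem _ (.inl rfl)) (hmem _ (.inr rfl)) ih

end Subcomplex

namespace ManifoldWithFins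

variable (M : K.ManifoldWithFins) (i : Fin M.n)

theorem src_mem : M.src i ∈ ((M.fins i).inter M.S).verts := by
  obtain ⟨m, p, q, -, h, -, -, hverts, -, -⟩ := M.isPath i
  rw [hverts, ← h]
  exact ⟨0, rfl⟩

theorem tgt_mem : M.tgt i ∈ ((M.fins i).inter M.S).verts := by
  obtain ⟨m, p, q, -, -, h, -, hverts, -, -⟩ := M.isPath i
  rw [hverts, ← h]
  exact ⟨_, rfl⟩

variable {i}

theorem eq_of_mem_verts {j : Fin M.n} {v : K.V} (hi : v ∈ (M.fins i).verts)
    (hj : v ∈ (M.fins j).verts) (hv : v ∉ M.S.verts) : i = j := by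
  have key : ∀ i j, j < i → v ∈ (M.fins i).verts → v ∈ (M.fins j).verts → False := by
    intro i j hij hi hj
    rcases M.verts_inter i j hij ⟨hj, hi⟩ with rfl | rfl
    · exact hv (M.src_mem i).2
    · exact hv (M.tgt_mem i).2
  rcases lt_trichotomy i j with h | h | h
  · exact (key j i h hj hi).elim
  · exact h
  · exact (key i j h hi hj).elim

theorem mem_edges_of_contains {e : K.E} {v : K.V} (hv : v ∈ (M.fins i).verts) (hvS : v ∉ M.S.verts)
    (he : K.EdgeContains e v) : e ∈ (M.fins i).edges := by
  rcases M.edges_cover e with h | ⟨j, h⟩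
  · exact absurd (M.S.mem_verts_of_contains h he) hvS
  · rwa [M.eq_of_mem_verts hv (Subcomplex.mem_verts_of_contains h he) hvS]

/-- The path in which the fin meets the manifold misses `v`, so one can walk along it. -/
theorem joinedAvoiding_of_mem {v w : K.V} (hvS : v ∉ M.S.verts) (hw : w ∈ (M.fins i).verts)
    (hwS : w ∈ M.S.verts) : (M.fins i).JoinedAvoiding v (M.src i) w := by
  have hne : M.src i ≠ v := fun h => hvS (h ▸ (M.src_mem i).2)
  refine (M.isPath i).induction ((M.fins i).JoinedAvoiding v (M.src i)) .refl ?_ ⟨hw, hwS⟩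
  intro e he x y hx hy h
  refine h.step hne he.1 hx hy ?_
  rintro rfl
  exact hvS (Subcomplex.mem_verts_of_contains he.2 hy)

/-- Induction along a chain of facets from `s`. Consecutive facets share an edge, which has an end
point other than `v`. If the preceding facet is in the manifold, this point is on the path of the
fin; otherwise the facet is in the same fin, as different fins share no edge. Within a triangle, the
third vertex is then reached without using `v`. -/
theorem joinedAvoiding_of_facet (hconn : K.ConnectedThroughCodimOne) {s : K.F}
    (hs : s ∈ M.S.facets) {v : K.V} (hvS : v ∉ M.S.verts) {f : K.F} (hf : f ∈ (M.fins i).facets)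
    {k : Fin 3} (hk : K.faceVert f k ≠ v) :
    (M.fins i).JoinedAvoiding v (M.src i) (K.faceVert f k) := by
  have hne : M.src i ≠ v := fun h => hvS (h ▸ (M.src_mem i).2)
  have hdisj : ∀ f, f ∈ (M.fins i).facets → f ∉ M.S.facets := by
    intro f hf hfS
    obtain ⟨m, p, q, -, -, -, -, -, -, h⟩ := M.isPath i
    exact Set.notMem_empty f (h ▸ ⟨hf, hfS⟩)
  have := hconn s f
  induction this generalizing k with
  | refl => exact absurd hs (hdisj _ hf)
  | @tail a b _ hab ih =>
    obtain ⟨e, ⟨r, hr⟩, ⟨l, hl⟩⟩ := hab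
    have heF : e ∈ (M.fins i).edges := hl ▸ (M.fins i).faceEdge_mem b hf l
    have hx : ∃ x, x ≠ v ∧ K.EdgeContains e x := by
      by_cases h : K.edgeVert e 0 = v
      · exact ⟨_, fun h' => absurd (K.edgeVert_injective e (h'.trans h.symm)) one_ne_zero, 1, rfl⟩
      · exact ⟨_, h, 0, rfl⟩
    have hin : ∃ x, K.EdgeContains e x ∧ (M.fins i).JoinedAvoiding v (M.src i) x := by
      obtain ⟨x, hxv, hx⟩ := hx
      refine ⟨x, hx, ?_⟩
      rcases M.facets_cover a with ha | ⟨j, ha⟩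
      · have : e ∈ M.S.edges := hr ▸ M.S.faceEdge_mem a ha r
        exact M.joinedAvoiding_of_mem hvS (Subcomplex.mem_verts_of_contains heF hx)
          (Subcomplex.mem_verts_of_contains this hx)
      · obtain rfl : i = j := M.eq_of_mem_edges heF (hr ▸ (M.fins j).faceEdge_mem a ha r)
        obtain ⟨t, rfl⟩ := hx
        rw [← hr, K.edgeVert_faceEdge] at hxv ⊢
        exact ih ha hxv
    obtain ⟨x, hx, hjx⟩ := hin
    obtain ⟨t, rfl⟩ := hx
    rw [← hl, K.edgeVert_faceEdge] at hjx
    by_cases htk : l.succAbove t = k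
    · rwa [htk] at hjx
    · obtain ⟨n, hn, hn'⟩ : ∃ n : Fin 3, n ≠ l.succAbove t ∧ n ≠ k := by
        generalize l.succAbove t = p
        clear * -
        revert p k
        decide
      exact hjx.step hne ((M.fins i).faceEdge_mem b hf n) (edgeContains_faceEdge hn)
        (edgeContains_faceEdge hn') hk

end ManifoldWithFins

end DeltaComplex

/-! ### The maximum principle for potentials on fins. -/

namespace WeakTropicalSurface

open DeltaComplex Matrix

variable {T : WeakTropicalSurface.{u}}

theorem otherα_add {e : T.E} {v w : T.V} (hv : T.EdgeContains e v) (hw : T.EdgeContains e w)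
    (hwv : w ≠ v) : T.otherα v e + T.otherα w e = T.degree e := by
  rw [← T.sum_α e]
  obtain ⟨k, rfl⟩ := hv
  obtain ⟨l, rfl⟩ := hw
  have hlk : l ≠ k := fun h => hwv (by rw [h])
  have h10 : T.edgeVert e 1 ≠ T.edgeVert e 0 :=
    fun h => absurd (T.edgeVert_injective e h) one_ne_zero
  have h01 := h10.symm
  fin_cases k <;> fin_cases l <;> simp_all [otherα, add_comm]

theorem degree_eq_zero {e : T.E} : T.degree e = 0 ↔ ∀ f, ¬ T.FacetContains f e := by
  classical
  rw [degree, Fintype.card_eq_zero_iff, isEmpty_subtype]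

theorem slope_of_potential {F : T.Subcomplex} {c : T.E → ℤ} {ψ : T.V → ℤ}
    (hψ : ∀ e ∈ F.edges, ψ (T.edgeVert e 1) - ψ (T.edgeVert e 0) = c e) {e : T.E}
    (he : e ∈ F.edges) {v w : T.V} (hv : T.EdgeContains e v) (hw : T.EdgeContains e w)
    (hwv : w ≠ v) : slope c v e = ψ w - ψ v := by
  rw [slope, ← hψ e he]
  obtain ⟨k, rfl⟩ := hv
  obtain ⟨l, rfl⟩ := hw
  have hlk : l ≠ k := fun h => hwv (by rw [h])
  have h10 : T.edgeVert e 1 ≠ T.edgeVert e 0 :=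
    fun h => absurd (T.edgeVert_injective e h) one_ne_zero
  have h01 := h10.symm
  clear hψ
  fin_cases k <;> fin_cases l <;> simp_all

theorem localMatrix_self (v : T.V) (e : T.EdgesAt v) : T.localMatrix v e e = -T.otherα v e.1 := by
  simp [localMatrix]

theorem localMatrix_eq_zero {v : T.V} {e e' : T.EdgesAt v} (he : e ≠ e')
    (h : ∀ f, ¬ T.FacetContains f e.1) : T.localMatrix v e e' = 0 := by
  by_contra hne
  obtain ⟨f, hf, -⟩ := (localMatrix_ne_zero v e e' he).1 hne
  exact h f hf

-- Such a vector makes the local matrix negative semidefinite, against the existence of a positive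
-- eigenvalue.
open Classical in
theorem IsTropicalSurface.false_of_mulVec_nonpos (hT : T.IsTropicalSurface) {v : T.V}
    {x : T.EdgesAt v → ℝ} (hx : ∀ e, 0 < x e) (h : ∀ e, (T.localMatrix v *ᵥ x) e ≤ 0) : False := by
  obtain ⟨u, hu, -⟩ := (T.isHermitian_localMatrix v).exists_of_existsUnique_pos (hT v)
  exact absurd (dotProduct_mulVec_nonpos_of_mulVec_nonpos (localMatrix_symm v)
    (localMatrix_nonneg v) hx h u) (not_le.2 hu)

open Classical in
theorem mulVec_apply_of_isolated {v : T.V} {e : T.EdgesAt v} (h : ∀ f, ¬ T.FacetContains f e.1)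
    (x : T.EdgesAt v → ℝ) : (T.localMatrix v *ᵥ x) e = -T.otherα v e.1 * x e := by
  rw [mulVec, dotProduct, Finset.sum_eq_single e, localMatrix_self]
  · intro e' _ he
    rw [localMatrix_eq_zero he.symm h, zero_mul]
  · simp


/-- The edges that lead from a vertex of a fin outside of the manifold to a vertex not joined to the
manifold otherwise are not contained in any facet. -/
theorem isolated_of_not_joinedAvoiding (M : T.ManifoldWithFins) (hconn : T.ConnectedThroughCodimOne)
    {i : Fin M.n} {s : T.F} (hs : s ∈ M.S.facets) {v : T.V} (hv : v ∈ (M.fins i).verts)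
    (hvS : v ∉ M.S.verts) {e : T.E} (hev : T.EdgeContains e v) {w : T.V} (hwv : w ≠ v)
    (hew : T.EdgeContains e w) (hw : ¬ (M.fins i).JoinedAvoiding v (M.src i) w) (f : T.F) :
    ¬ T.FacetContains f e := by
  rintro ⟨k, rfl⟩
  obtain ⟨l, rfl⟩ := hew
  rw [T.edgeVert_faceEdge] at hw hwv
  rcases M.facets_cover f with hf | ⟨j, hf⟩
  · exact hvS (M.S.mem_verts_of_contains (M.S.faceEdge_mem f hf k) hev)
  · obtain rfl := M.eq_of_mem_verts hv
      ((M.fins j).mem_verts_of_contains ((M.fins j).faceEdge_mem f hf k) hev) hvS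
    exact hw (M.joinedAvoiding_of_facet hconn hs hvS hf hwv)

open Classical in
theorem isCocycle_single {e : T.E} (h : ∀ f, ¬ T.FacetContains f e) :
    IsCocycle (K := T.toDeltaComplex) (Pi.single e (1 : ℤ)) := by
  intro f
  have : ∀ i, (Pi.single e (1 : ℤ) : T.E → ℤ) (T.faceEdge f i) = 0 := fun i =>
    Pi.single_eq_of_ne (fun hi => h f ⟨i, hi⟩) _
  simp [this]

/-- The edge `e` is a bridge without facets, so its two structure constants add up to zero. All
other edges at `w` lead further away, and by induction the structure constants at their far ends are
positive. The matrix at `w` is then diagonal, and its one positive entry has to belong to `e`. -/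
theorem otherα_pos_of_not_joinedAvoiding (hT : T.IsTropicalSurface) (M : T.ManifoldWithFins)
    (hconn : T.ConnectedThroughCodimOne) {i : Fin M.n} {s : T.F} (hs : s ∈ M.S.facets) {v : T.V}
    (hv : v ∈ (M.fins i).verts) (hvS : v ∉ M.S.verts) {e : T.E} (hev : T.EdgeContains e v) {w : T.V}
    (hwv : w ≠ v) (hew : T.EdgeContains e w)
    (hw : ¬ (M.fins i).JoinedAvoiding v (M.src i) w) : 0 < T.otherα v e := by
  classical
  -- Induction on the number of vertices not joined to the path avoiding `v`. Passing from `v` to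
  -- `w` makes this set smaller: `v` itself leaves it.
  induction hn : {x | ¬ (M.fins i).JoinedAvoiding v (M.src i) x}.ncard using Nat.strong_induction_on
    generalizing v e w with
  | _ n ih =>
  subst hn
  have := M.contractible i
  have hsrc := M.src_mem i
  have hsv : M.src i ≠ v := fun h => hvS (h ▸ hsrc.2)
  have heF := M.mem_edges_of_contains hv hvS hev
  have hwF := (M.fins i).mem_verts_of_contains heF hew
  have hwS : w ∉ M.S.verts := fun h => hw (M.joinedAvoiding_of_mem hvS hwF h)
  have hsw : M.src i ≠ w := fun h => hwS (h ▸ hsrc.2)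
  have hiso := isolated_of_not_joinedAvoiding M hconn hs hv hvS hev hwv hew hw
  -- As `e` is in no facet, its indicator is a cocycle. Its potential on the contractible fin
  -- changes only across `e`, which shows that no way around `e` exists.
  obtain ⟨ψ, hψ⟩ := (isCocycle_single hiso).exists_potential (M.fins i)
  have hψ' : ∀ {g x y}, g ∈ (M.fins i).edges → T.EdgeContains g x → T.EdgeContains g y → g ≠ e →
      ψ x = ψ y := by
    intro g x y hg hx hy hge
    by_cases hxy : y = x
    · rw [hxy]
    have := slope_of_potential hψ hg hx hy hxy
    rw [slope_eq_zero.2 (Pi.single_eq_of_ne hge _)] at this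
    omega
  have hψe : ψ w ≠ ψ v := by
    have h1 := slope_of_potential hψ heF hev hew hwv
    have h2 : slope (Pi.single e (1 : ℤ)) v e ≠ 0 := by
      rw [ne_eq, slope_eq_zero]
      simp
    omega
  obtain ⟨g, hg, x, hxv, hgv, hgx, hx⟩ := Subcomplex.exists_joinedAvoiding hsrc.1 hv hsv
  have hxw : x ≠ w := fun h => hw (h ▸ hx)
  have hψv : ψ v = ψ (M.src i) := by
    rw [hψ' hg hgv hgx, hx.eq_of_const (ψ := ψ)]
    · exact fun g hg hgv => hψ' hg ⟨1, rfl⟩ ⟨0, rfl⟩ fun h => hgv (h ▸ hev)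
    · rintro rfl
      rcases hev.eq_or_eq hew hgx hwv with h | h
      · exact hxv h
      · exact hxw h
  have hpos : ∀ g y, T.EdgeContains g w → T.EdgeContains g y → y ≠ w → g ≠ e →
      (∀ f, ¬ T.FacetContains f g) ∧ 0 < T.otherα w g := by
    intro g y hgw hgy hyw hge
    have hgF := M.mem_edges_of_contains hwF hwS hgw
    have hy : ¬ (M.fins i).JoinedAvoiding w (M.src i) y := by
      intro hy
      have h1 : ψ y = ψ (M.src i) := hy.eq_of_const fun g hg hgw =>
        hψ' hg ⟨1, rfl⟩ ⟨0, rfl⟩ fun h => hgw (h ▸ hew)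
      have h2 := hψ' hgF hgw hgy hge
      exact hψe (by rw [h2, h1, hψv])
    refine ⟨isolated_of_not_joinedAvoiding M hconn hs hwF hwS hgw hyw hgy hy,
      ih _ (Set.ncard_lt_ncard ⟨?_, fun h => ?_⟩) hwF hwS hgw hyw hgy hy rfl⟩
    · exact fun x hx hx' => hx (.of_not_joined hw hx')
    · exact h (fun h' => h'.ne hsv rfl)
        ((Subcomplex.JoinedAvoiding.of_not_joined hw hx).step hsw hg hgx hgv hwv.symm)
  -- If the claim failed, the constant at `v` would be nonnegative, every row of the diagonal matrix
  -- at `w` would be nonpositive, and the vector of ones would give a contradiction.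
  by_contra hneg
  refine hT.false_of_mulVec_nonpos (v := w) (x := fun _ => 1) (fun _ => one_pos) fun g => ?_
  obtain ⟨y, hyw, hgy⟩ := g.2.exists_other
  by_cases hge : g.1 = e
  · rw [mulVec_apply_of_isolated (by rw [hge]; exact hiso), hge]
    have h1 := otherα_add hev hew hwv
    rw [degree_eq_zero.2 hiso] at h1
    have : (0 : ℝ) ≤ T.otherα w e := by
      have : 0 ≤ T.otherα w e := by push_cast at h1; omega
      exact_mod_cast this
    linarith
  · obtain ⟨h1, h2⟩ := hpos g.1 y g.2 hgy hyw hge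
    rw [mulVec_apply_of_isolated h1]
    have : (0 : ℝ) < T.otherα w g.1 := by exact_mod_cast h2
    linarith

open Classical in
/-- The coboundary of the indicator function of a vertex, restricted to the edges on which another
cocycle vanishes. -/
noncomputable def zeroPart (c : T.E → ℤ) (v : T.V) (e : T.E) : ℤ :=
  if c e = 0 then (if T.edgeVert e 0 = v then 1 else 0) - (if T.edgeVert e 1 = v then 1 else 0)
  else 0

/-- In a facet at `v`, the hypothesis keeps both or neither of the two edges at `v`, so the
restricted coboundary still sums to zero there. -/
theorem isCocycle_zeroPart {c : T.E → ℤ} {v : T.V}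
    (h : ∀ e e' f, T.EdgeContains e v → T.EdgeContains e' v → T.FacetContains f e →
      T.FacetContains f e' → c e = 0 → c e' = 0) : IsCocycle (zeroPart c v) := by
  classical
  intro f
  have h' : ∀ i j k, i ≠ k → j ≠ k → T.faceVert f k = v → c (T.faceEdge f i) = 0 →
      c (T.faceEdge f j) = 0 := by
    rintro i j k hi hj rfl
    exact h _ _ f (edgeContains_faceEdge hi) (edgeContains_faceEdge hj) ⟨i, rfl⟩ ⟨j, rfl⟩
  have h01 := T.faceVert_injective f |>.ne (show (0 : Fin 3) ≠ 1 by decide)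
  have h02 := T.faceVert_injective f |>.ne (show (0 : Fin 3) ≠ 2 by decide)
  have h12 := T.faceVert_injective f |>.ne (show (1 : Fin 3) ≠ 2 by decide)
  have a0 := h' 1 2 0 (by decide) (by decide)
  have a0' := h' 2 1 0 (by decide) (by decide)
  have a1 := h' 0 2 1 (by decide) (by decide)
  have a1' := h' 2 0 1 (by decide) (by decide)
  have a2 := h' 0 1 2 (by decide) (by decide)
  have a2' := h' 1 0 2 (by decide) (by decide)
  have s00 : (0 : Fin 3).succAbove (0 : Fin 2) = 1 := rfl
  have s01 : (0 : Fin 3).succAbove (1 : Fin 2) = 2 := rfl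
  have s10 : (1 : Fin 3).succAbove (0 : Fin 2) = 0 := rfl
  have s11 : (1 : Fin 3).succAbove (1 : Fin 2) = 2 := rfl
  have s20 : (2 : Fin 3).succAbove (0 : Fin 2) = 0 := rfl
  have s21 : (2 : Fin 3).succAbove (1 : Fin 2) = 1 := rfl
  simp only [zeroPart, T.edgeVert_faceEdge, s00, s01, s10, s11, s20, s21]
  by_cases e0 : T.faceVert f 0 = v
  · have e1 : T.faceVert f 1 ≠ v := fun h => h01 (e0.trans h.symm)
    have e2 : T.faceVert f 2 ≠ v := fun h => h02 (e0.trans h.symm)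
    by_cases hz : c (T.faceEdge f 1) = 0
    · simp [e0, e1, e2, hz, a0 e0 hz]
    · have : c (T.faceEdge f 2) ≠ 0 := fun h => hz (a0' e0 h)
      simp [e1, e2, hz, this]
  by_cases e1 : T.faceVert f 1 = v
  · have e2 : T.faceVert f 2 ≠ v := fun h => h12 (e1.trans h.symm)
    by_cases hz : c (T.faceEdge f 0) = 0
    · simp [e0, e1, e2, hz, a1 e1 hz]
    · have : c (T.faceEdge f 2) ≠ 0 := fun h => hz (a1' e1 h)
      simp [e0, e2, hz, this]
  by_cases e2 : T.faceVert f 2 = v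
  · by_cases hz : c (T.faceEdge f 0) = 0
    · simp [e0, e1, e2, hz, a2 e2 hz]
    · have : c (T.faceEdge f 1) ≠ 0 := fun h => hz (a2' e2 h)
      simp [e0, e1, hz, this]
  simp [e0, e1, e2]


end WeakTropicalSurface

namespace WeakTropicalSurface

open DeltaComplex Matrix

variable {T : WeakTropicalSurface.{u}}

/-- At a local maximum of a potential of a balanced cocycle, adjacent edges on one of which the
cocycle vanishes. -/
theorem IsBalanced.eq_zero_of_nonpos {c : T.E → ℤ} (hb : IsBalanced c) {v : T.V}
    (hneg : ∀ e, T.EdgeContains e v → slope c v e ≤ 0) {e e' : T.E} {f : T.F}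
    (he : T.EdgeContains e v) (he' : T.EdgeContains e' v) (hf : T.FacetContains f e)
    (hf' : T.FacetContains f e') (h0 : c e = 0) : c e' = 0 := by
  classical
  by_contra hne
  have hee : (⟨e, he⟩ : T.EdgesAt v) ≠ ⟨e', he'⟩ := by
    intro h
    rw [Subtype.mk.injEq] at h
    exact hne (h ▸ h0)
  have hx : ∀ g : T.EdgesAt v, (slope c v g.1 : ℝ) ≤ 0 := fun g => by
    exact_mod_cast hneg g.1 g.2
  have hrow := congrFun (hb v) ⟨e, he⟩
  -- In the row of `e` the unknown diagonal term is multiplied by zero and all other terms are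
  -- nonpositive, so each of them vanishes.
  rw [mulVec, dotProduct, Pi.zero_apply, Finset.sum_eq_zero_iff_of_nonpos] at hrow
  · have h1 := hrow ⟨e', he'⟩ (Finset.mem_univ _)
    rcases mul_eq_zero.1 h1 with h | h
    · exact (localMatrix_ne_zero v _ _ hee).2 ⟨f, hf, hf'⟩ h
    · rw [Int.cast_eq_zero, slope_eq_zero] at h
      exact hne h
  · intro g _
    by_cases hg : ⟨e, he⟩ = g
    · subst hg
      simp [slope_eq_zero.2 h0]
    · exact mul_nonpos_of_nonneg_of_nonpos (localMatrix_nonneg v _ _ hg) (hx g)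

/-- A local maximum of a potential outside of the manifold is attained at all neighbours. -/
theorem eq_zero_of_local_max (hT : T.IsTropicalSurface) (M : T.ManifoldWithFins)
    (hconn : T.ConnectedThroughCodimOne) {s : T.F} (hs : s ∈ M.S.facets) {c : T.E → ℤ}
    (hb : IsBalanced c) {i : Fin M.n} {v : T.V}
    (hv : v ∈ (M.fins i).verts) (hvS : v ∉ M.S.verts)
    (hneg : ∀ e, T.EdgeContains e v → slope c v e ≤ 0) {e : T.E} (he : T.EdgeContains e v) :
    c e = 0 := by
  classical
  have := M.contractible i
  have hsrc := M.src_mem i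
  have hsv : M.src i ≠ v := fun h => hvS (h ▸ hsrc.2)
  -- Zero and nonzero edges at `v` share no facet. The cocycle `zeroPart` shows, through
  -- contractibility, that they cannot both lead to vertices joined to the manifold avoiding `v`.
  have hκ : IsCocycle (zeroPart c v) :=
    isCocycle_zeroPart fun e e' f he he' hf hf' => hb.eq_zero_of_nonpos hneg he he' hf hf'
  obtain ⟨ψ, hψ⟩ := hκ.exists_potential (M.fins i)
  have hjoin : ∀ w, (M.fins i).JoinedAvoiding v (M.src i) w → ψ w = ψ (M.src i) := by
    intro w hw
    refine hw.eq_of_const fun g hg hgv => ?_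
    have h0 : T.edgeVert g 0 ≠ v := fun h => hgv ⟨0, h⟩
    have h1 : T.edgeVert g 1 ≠ v := fun h => hgv ⟨1, h⟩
    have := hψ g hg
    simp only [zeroPart, h0, h1, if_false, sub_self, ite_self] at this
    omega
  -- The difference on the left does not depend on the edge, so all edges leading to joined vertices
  -- are of the same kind.
  have hval : ∀ g w, w ≠ v → T.EdgeContains g v → T.EdgeContains g w →
      (M.fins i).JoinedAvoiding v (M.src i) w → ψ (M.src i) - ψ v = if c g = 0 then 1 else 0 := by
    intro g w hwv hgv hgw hw
    rw [← hjoin w hw, ← slope_of_potential hψ (M.mem_edges_of_contains hv hvS hgv) hgv hgw hwv]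
    have h10 : T.edgeVert g 1 ≠ T.edgeVert g 0 :=
      fun h => absurd (T.edgeVert_injective g h) one_ne_zero
    by_cases hg0 : T.edgeVert g 0 = v
    · have hg1 : T.edgeVert g 1 ≠ v := fun h => h10 (h.trans hg0.symm)
      rw [slope, if_pos hg0, zeroPart, if_pos hg0, if_neg hg1, sub_zero]
    · have hg1 : T.edgeVert g 1 = v := by
        obtain ⟨k, hk⟩ := hgv
        have : k = 1 := by
          have : k ≠ 0 := fun h => hg0 (h ▸ hk)
          omega
        exact this ▸ hk
      rw [slope, if_neg hg0, zeroPart, if_pos hg1, if_neg hg0]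
      split_ifs <;> rfl
  by_contra hce
  obtain ⟨w, hwv, hew⟩ := he.exists_other
  -- The row of an edge without facets has only its diagonal entry.
  have hrow : ∀ g : T.EdgesAt v, (∀ f, ¬ T.FacetContains f g.1) → T.otherα v g.1 ≠ 0 →
      c g.1 = 0 := by
    intro g hg hα
    have := congrFun (hb v) g
    rw [mulVec_apply_of_isolated hg] at this
    simpa [hα, slope_eq_zero] using this
  have hout : ∀ g w, w ≠ v → T.EdgeContains g v → T.EdgeContains g w →
      ¬ (M.fins i).JoinedAvoiding v (M.src i) w → (∀ f, ¬ T.FacetContains f g) ∧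
        0 < T.otherα v g := fun g w hwv hgv hgw hw =>
    ⟨isolated_of_not_joinedAvoiding M hconn hs hv hvS hgv hwv hgw hw,
      otherα_pos_of_not_joinedAvoiding hT M hconn hs hv hvS hgv hwv hgw hw⟩
  have hw : (M.fins i).JoinedAvoiding v (M.src i) w := by
    by_contra hw
    obtain ⟨h1, h2⟩ := hout e w hwv he hew hw
    exact hce (hrow ⟨e, he⟩ h1 h2.ne')
  have hψv := hval e w hwv he hew hw
  rw [if_neg hce] at hψv
  have hA : ∀ g, T.EdgeContains g v → c g = 0 → (∀ f, ¬ T.FacetContains f g) ∧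
      0 < T.otherα v g := by
    intro g hg hg0
    obtain ⟨y, hyv, hgy⟩ := hg.exists_other
    refine hout g y hyv hg hgy fun hy => ?_
    have := hval g y hyv hg hgy hy
    rw [if_pos hg0] at this
    omega
  -- Minus the slopes is a nonnegative kernel vector, and it vanishes only on edges without facets.
  -- Putting `1` there makes it positive and changes the product only in those rows, where it
  -- becomes negative.
  refine hT.false_of_mulVec_nonpos (v := v)
    (x := fun g => if c g.1 = 0 then 1 else -(slope c v g.1 : ℝ)) (fun g => ?_) fun g => ?_
  · split_ifs with h
    · exact one_pos
    · have h1 := hneg g.1 g.2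
      have h2 : slope c v g.1 ≠ 0 := fun h' => h (slope_eq_zero.1 h')
      have : slope c v g.1 < 0 := lt_of_le_of_ne h1 h2
      have : (slope c v g.1 : ℝ) < 0 := by exact_mod_cast this
      linarith
  · by_cases hg : c g.1 = 0
    · obtain ⟨h1, h2⟩ := hA g.1 g.2 hg
      rw [mulVec_apply_of_isolated h1, if_pos hg, mul_one]
      have : (0 : ℝ) < T.otherα v g.1 := by exact_mod_cast h2
      linarith
    · have := congrFun (hb v) g
      rw [mulVec, dotProduct, Pi.zero_apply] at this
      rw [mulVec, dotProduct]
      refine (Eq.trans ?_ (neg_eq_zero.2 this)).le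
      rw [← Finset.sum_neg_distrib]
      refine Finset.sum_congr rfl fun j _ => ?_
      split_ifs with hj
      · have hgj : j ≠ g := fun h => hg (h ▸ hj)
        rw [slope_eq_zero.2 hj, localMatrix_symm, localMatrix_eq_zero hgj (hA j.1 j.2 hj).1]
        simp
      · ring

theorem potential_le (hT : T.IsTropicalSurface) (M : T.ManifoldWithFins)
    (hconn : T.ConnectedThroughCodimOne) {s : T.F} (hs : s ∈ M.S.facets) {c : T.E → ℤ}
    (hb : IsBalanced c) (h0 : ∀ e ∈ M.S.edges, c e = 0) {i : Fin M.n} {φ : T.V → ℤ}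
    (hφ : ∀ e ∈ (M.fins i).edges, φ (T.edgeVert e 1) - φ (T.edgeVert e 0) = c e) {v : T.V}
    (hv : v ∈ (M.fins i).verts) : φ v ≤ φ (M.src i) := by
  have := M.contractible i
  have hsrc := M.src_mem i
  obtain ⟨w, hw, hmax⟩ := Set.exists_max_image (M.fins i).verts φ (Set.toFinite _) ⟨v, hv⟩
  refine (hmax v hv).trans ?_
  by_contra! hlt
  -- The potential is constant on the path in the manifold, so a maximum exceeding its value at
  -- `M.src i` is attained only off the manifold, where the maximum principle applies.
  have hP : ∀ x ∈ (M.fins i).verts, φ x = φ w → x ∉ M.S.verts := by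
    intro x hx hxw hxS
    refine hlt.ne' (hxw.symm.trans ((M.isPath i).induction (fun x => φ x = φ (M.src i)) rfl ?_
      ⟨hx, hxS⟩))
    intro e he x y hx hy h
    by_cases hxy : y = x
    · rwa [hxy]
    · have := slope_of_potential hφ he.1 hx hy hxy
      rw [slope_eq_zero.2 (h0 e he.2)] at this
      omega
  have hstep : ∀ e ∈ (M.fins i).edges, ∀ k, φ (T.edgeVert e k) = φ w → c e = 0 := by
    intro e he k hk
    have hx := (M.fins i).edgeVert_mem e he k
    refine eq_zero_of_local_max hT M hconn hs hb hx (hP _ hx hk) (fun g hg => ?_) ⟨k, rfl⟩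
    have hgF := M.mem_edges_of_contains hx (hP _ hx hk) hg
    obtain ⟨y, hy, hgy⟩ := hg.exists_other
    rw [slope_of_potential hφ hgF hg hgy hy, hk]
    have := hmax y ((M.fins i).mem_verts_of_contains hgF hgy)
    omega
  refine hlt.ne ((M.fins i).of_preconnected (fun x => φ x = φ w) (fun e he => ?_) hw hsrc.1 rfl)
  have := hφ e he
  constructor <;> intro h <;> have := hstep e he _ h <;> omega

/-- After the vanishing on the manifold, the maximum principle for `c` and for `-c` makes every
potential on a fin constant. -/
theorem eq_zero_of_zeroFacet (hT : T.IsTropicalSurface) (M : T.ManifoldWithFins)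
    (hconn : T.ConnectedThroughCodimOne) {s : T.F} (hs : s ∈ M.S.facets) {c : T.E → ℤ}
    (hc : IsCocycle c) (hb : IsBalanced c) (h0 : ZeroFacet c s) : c = 0 := by
  have hS : ∀ e ∈ M.S.edges, c e = 0 := fun e he => eq_zero_on_surface hT M hc hb hs h0 he
  classical
  funext e
  rcases M.edges_cover e with he | ⟨i, he⟩
  · exact hS e he
  have := M.contractible i
  obtain ⟨φ, hφ⟩ := hc.exists_potential (M.fins i)
  have hneg : IsBalanced (-c) := by
    intro v
    have := hb v
    have h : (fun e : T.EdgesAt v => (slope (-c) v e.1 : ℝ)) = -fun e => (slope c v e.1 : ℝ) := by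
      funext e
      simp only [slope, Pi.neg_apply]
      split_ifs <;> simp
    rw [h, mulVec_neg, this, neg_zero]
  have hφ' : ∀ e ∈ (M.fins i).edges, (-φ) (T.edgeVert e 1) - (-φ) (T.edgeVert e 0) = (-c) e := by
    intro e he
    simp only [Pi.neg_apply, ← hφ e he]
    ring
  have key : ∀ k, φ (T.edgeVert e k) = φ (M.src i) := by
    intro k
    have hk := (M.fins i).edgeVert_mem e he k
    have h1 := potential_le hT M hconn hs hb hS hφ hk
    have h2 := potential_le hT M hconn hs hneg (fun e he => by simp [hS e he]) hφ' hk
    simp only [Pi.neg_apply] at h2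
    omega
  rw [← hφ e he, key, key, sub_self, Pi.zero_apply]

end WeakTropicalSurface

/-! ### Sections of the quotient sheaf and their local slopes. -/

theorem CategoryTheory.Limits.cokernel.exists_app_eq_of_π_eq_zero {X : TopCat.{u}}
    {F G : TopCat.Sheaf AddCommGrpCat.{u} X} (f : F ⟶ G) [Mono f] (U : Opens X)
    (a : G.presheaf.obj (op U)) (h : (Limits.cokernel.π f).hom.app (op U) a = 0) :
    ∃ b : F.presheaf.obj (op U), f.hom.app (op U) b = a := by
  let S := ShortComplex.mk f (Limits.cokernel.π f) (Limits.cokernel.condition f)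
  have hS : S.Exact := ShortComplex.exact_of_g_is_cokernel S (Limits.cokernelIsCokernel f)
  let Ψ := sheafToPresheaf (Opens.grothendieckTopology X) AddCommGrpCat.{u} ⋙
    (evaluation _ _).obj (op U)
  -- Taking sections over `U` preserves limits, so it keeps the sequence exact at `G` although the
  -- map to the cokernel need not stay surjective.
  let Φ : TopCat.Sheaf AddCommGrpCat.{u} X ⥤ AddCommGrpCat.{u} := Ψ
  have : Φ.PreservesZeroMorphisms := ⟨fun _ _ => rfl⟩
  have hlim : Limits.PreservesLimits Φ := inferInstanceAs (Limits.PreservesLimits Ψ)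
  have hΦ := hS.map_of_mono_of_preservesKernel Φ inferInstance inferInstance
  exact (ShortComplex.ab_exact_iff _).1 hΦ a h

namespace WeakTropicalSurface

variable (T : WeakTropicalSurface.{u})

/-- The group of linear functions on `U`. -/
abbrev LinearFun (U : Opens T.top) : AddSubgroup (U → ℝ) := T.isAddGroupPredicate_linear.sections U

/-- The class of a linear function in the quotient sheaf. -/
noncomputable def proj (U : Opens T.top) : T.LinearFun U →+ T.H0D U :=
  ((Limits.cokernel.π T.incl).hom.app (op U)).hom

variable {T}

/-- Restriction of linear functions. -/
def LinearFun.res {U V : Opens T.top} (h : V ≤ U) (φ : T.LinearFun U) : T.LinearFun V :=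
  ⟨fun x => φ.1 ⟨x.1, h x.2⟩, T.linear.res (homOfLE h) φ.1 φ.2⟩

/-- Restriction of sections of the quotient sheaf. -/
noncomputable def res {U V : Opens T.top} (h : V ≤ U) : T.H0D U →+ T.H0D V :=
  (T.sheafD.presheaf.map (homOfLE h).op).hom

theorem res_proj {U V : Opens T.top} (h : V ≤ U) (φ : T.LinearFun U) :
    res h (T.proj U φ) = T.proj V (LinearFun.res h φ) :=
  (ConcreteCategory.congr_hom ((Limits.cokernel.π T.incl).hom.naturality (homOfLE h).op) φ).symm

theorem res_res {U V W : Opens T.top} (h : V ≤ U) (h' : W ≤ V) (ω : T.H0D U) :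
    res h' (res h ω) = res (h'.trans h) ω :=
  (ConcreteCategory.congr_hom (T.sheafD.presheaf.map_comp (homOfLE h).op (homOfLE h').op) ω).symm

theorem exists_proj_eq {U : Opens T.top} (ω : T.H0D U) {x : T.top} (hx : x ∈ U) :
    ∃ (V : Opens T.top) (h : V ≤ U) (φ : T.LinearFun V), x ∈ V ∧ T.proj V φ = res h ω := by
  have := (TopCat.Sheaf.isLocallySurjective_iff_epi (Limits.cokernel.π T.incl)).2 inferInstance
  obtain ⟨V, h, ⟨φ, hφ⟩, hxV⟩ := (TopCat.Presheaf.isLocallySurjective_iff _).1 this U ω x hx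
  exact ⟨V, h, φ, hxV, hφ⟩

instance : Mono T.incl := by
  have : Mono T.incl.hom := by
    have : ∀ U, Mono (T.incl.hom.app U) := fun U => by
      rw [AddCommGrpCat.mono_iff_injective]
      intro a b h
      have h' : (T.incl.hom.app U a : _).1 = (T.incl.hom.app U b : _).1 := congrArg Subtype.val h
      exact Subtype.ext h'
    exact NatTrans.mono_of_mono_app _
  exact Sheaf.Hom.mono_of_presheaf_mono _ _ _

theorem proj_eq_zero_iff {U : Opens T.top} (φ : T.LinearFun U) :
    T.proj U φ = 0 ↔ IsLocallyConstant φ.1 := by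
  constructor
  · intro h
    obtain ⟨b, hb⟩ := Limits.cokernel.exists_app_eq_of_π_eq_zero T.incl U φ h
    have : b.1 = φ.1 := congrArg Subtype.val hb
    exact this ▸ b.2
  · intro h
    have h1 := congrArg (fun f => f.hom.app (op U)) (Limits.cokernel.condition T.incl)
    exact ConcreteCategory.congr_hom h1 ⟨φ.1, h⟩

theorem eq_zero_of_locally {U : Opens T.top} (ω : T.H0D U)
    (h : ∀ x ∈ U, ∃ (V : Opens T.top) (h : V ≤ U), x ∈ V ∧ res h ω = 0) : ω = 0 := by
  choose V hV hx hω using fun x : U => h x.1 x.2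
  refine T.sheafD.eq_of_locally_eq' V U (fun x => homOfLE (hV x))
    (fun x hxU => Opens.mem_iSup.2 ⟨⟨x, hxU⟩, hx ⟨x, hxU⟩⟩) ω 0 fun x => ?_
  rw [map_zero]
  exact hω x

end WeakTropicalSurface

namespace stdSimplex

open Filter Topology

/-- An affine function that is locally constant at an interior point of a simplex takes the same
value at all vertices. -/
theorem eq_of_eventually_sum_mul_eq {ι : Type*} [Fintype ι] {t : stdSimplex ℝ ι} {y : ι → ℝ}
    {k : ℝ} (h : ∀ᶠ t' in 𝓝 t, (∀ i, 0 < t' i) → ∑ i, t' i * y i = k) (ht : ∀ i, 0 < t i) (i : ι) :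
    y i = k := by
  classical
  let a : ℕ → ℝ := fun n => 1 / ((n : ℝ) + 2)
  have ha : ∀ n, 0 < a n ∧ a n < 1 := fun n => by
    have : (0 : ℝ) ≤ n := Nat.cast_nonneg n
    refine ⟨by positivity, ?_⟩
    rw [div_lt_one (by positivity)]
    linarith
  let γ : ℕ → stdSimplex ℝ ι := fun n =>
    ⟨(1 - a n) • t.1 + a n • (stdSimplex.vertex (S := ℝ) i).1,
      convex_stdSimplex ℝ ι t.2 (stdSimplex.vertex i).2 (by linarith [(ha n).2]) (ha n).1.le
        (by ring)⟩
  have hlim : Tendsto γ atTop (𝓝 t) := by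
    rw [tendsto_subtype_rng]
    have h0 : Tendsto a atTop (𝓝 0) := by
      have := (tendsto_one_div_add_atTop_nhds_zero_nat (𝕜 := ℝ)).comp (tendsto_add_atTop_nat 1)
      refine this.congr fun n => ?_
      simp only [a, Function.comp_apply]
      push_cast
      ring
    have : Tendsto (fun n => (1 - a n) • t.1 + a n • (stdSimplex.vertex (S := ℝ) i).1) atTop
        (𝓝 (((1 : ℝ) - 0) • t.1 + (0 : ℝ) • (stdSimplex.vertex (S := ℝ) i).1)) :=
      ((tendsto_const_nhds.sub h0).smul_const _).add (h0.smul_const _)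
    simpa using this
  obtain ⟨n, hn⟩ := (hlim.eventually h).exists
  have hpos : ∀ j, 0 < γ n j := fun j => by
    have h1 : γ n j = (1 - a n) * t j + a n * stdSimplex.vertex (S := ℝ) i j := rfl
    have h2 : (0 : ℝ) ≤ stdSimplex.vertex (S := ℝ) i j := stdSimplex.zero_le _ _
    rw [h1]
    have h3 := mul_pos (sub_pos.2 (ha n).2) (ht j)
    have h4 := mul_nonneg (ha n).1.le h2
    linarith
  have h1 := hn hpos
  have h2 := h.self_of_nhds ht
  have h3 : ∑ j, γ n j * y j = (1 - a n) * ∑ j, t j * y j + a n * y i := by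
    have : ∀ j, γ n j * y j = (1 - a n) * (t j * y j) + if i = j then a n * y j else 0 := by
      intro j
      have h1 : γ n j = (1 - a n) * t j + a n * stdSimplex.vertex (S := ℝ) i j := rfl
      rw [h1, stdSimplex.vertex_coe, Pi.single_apply]
      simp only [eq_comm (a := j)]
      split_ifs <;> ring
    rw [Finset.sum_congr rfl fun j _ => this j, Finset.sum_add_distrib, ← Finset.mul_sum]
    simp
  rw [h1, h2] at h3
  have : a n * (y i - k) = 0 := by linarith
  rcases mul_eq_zero.1 this with h | h
  · exact absurd h (ha n).1.ne'
  · linarith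

theorem isPreconnected_interior (ι : Type*) [Fintype ι] :
    _root_.IsPreconnected {t : stdSimplex ℝ ι | ∀ i, 0 < t i} := by
  have hind : Topology.IsInducing (Subtype.val : stdSimplex ℝ ι → ι → ℝ) := ⟨rfl⟩
  rw [← hind.isPreconnected_image]
  have : Subtype.val '' {t : stdSimplex ℝ ι | ∀ i, 0 < t i} =
      stdSimplex ℝ ι ∩ {x | ∀ i, 0 < x i} := by
    ext x
    exact ⟨fun ⟨t, ht, h⟩ => h ▸ ⟨t.2, ht⟩, fun h => ⟨⟨x, h.1⟩, h.2, rfl⟩⟩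
  rw [this]
  suffices hconv : Convex ℝ {x : ι → ℝ | ∀ i, 0 < x i} from
    ((convex_stdSimplex ℝ ι).inter hconv).isPreconnected
  intro x hx y hy a b ha hb hab i
  have h1 := hx i
  have h2 := hy i
  simp only [Pi.add_apply, Pi.smul_apply, smul_eq_mul]
  rcases ha.eq_or_lt with rfl | ha
  · have : b = 1 := by linarith
    simpa [this] using h2
  · exact add_pos_of_pos_of_nonneg (mul_pos ha h1) (mul_nonneg hb h2.le)

end stdSimplex

namespace WeakTropicalSurface

open Filter Topology

variable {T : WeakTropicalSurface.{u}}

theorem exists_pred_lift {U : Opens T.top} (ω : T.H0D U) {x : T.top} (hx : x ∈ U) :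
    ∃ (V : Opens T.top) (h : V ≤ U) (φ : T.LinearFun V), x ∈ V ∧ T.linearPrelocal.pred φ.1 ∧
      T.proj V φ = res h ω := by
  obtain ⟨V, h, φ, hxV, hφ⟩ := exists_proj_eq ω hx
  obtain ⟨W, hxW, i, hW⟩ := φ.2 ⟨x, hxV⟩
  refine ⟨W, i.le.trans h, LinearFun.res i.le φ, hxW, hW, ?_⟩
  rw [← res_proj, hφ, res_res]

/-- Near the image of `t` under the characteristic map `g` of a cell, a section of the quotient
sheaf is represented by a function that is affine linear on the interior of the cell, with values
`y` at the vertices. -/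
def HasSlopes {U : Opens T.top} (ω : T.H0D U) {ι : Type*} [Fintype ι] (g : stdSimplex ℝ ι → T.top)
    (t : stdSimplex ℝ ι) (y : ι → ℝ) : Prop :=
  ∃ (V : Opens T.top) (h : V ≤ U) (φ : T.LinearFun V), g t ∈ V ∧ T.proj V φ = res h ω ∧
    ∀ (t' : stdSimplex ℝ ι) (h' : g t' ∈ V), (∀ i, 0 < t' i) → φ.1 ⟨g t', h'⟩ = ∑ i, t' i * y i

section

variable {U : Opens T.top} {ω : T.H0D U} {ι : Type*} [Fintype ι] {g : stdSimplex ℝ ι → T.top}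
  {t t' : stdSimplex ℝ ι} {y y' : ι → ℝ}

theorem HasSlopes.eventually (h : HasSlopes ω g t y) (hg : Continuous g) :
    ∀ᶠ t' in 𝓝 t, HasSlopes ω g t' y := by
  obtain ⟨V, hV, φ, ht, hφ, hy⟩ := h
  filter_upwards [hg.continuousAt.eventually_mem (V.isOpen.mem_nhds ht)] with t' ht'
  exact ⟨V, hV, φ, ht', hφ, hy⟩

/-- Two representatives differ by a locally constant function, and an affine function that is
constant near an interior point has equal values at all vertices. -/
theorem HasSlopes.sub_eq_sub (h : HasSlopes ω g t y) (h' : HasSlopes ω g t y')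
    (hg : Continuous g) (ht : ∀ i, 0 < t i) (i j : ι) : y i - y j = y' i - y' j := by
  obtain ⟨V, hV, φ, htV, hφ, hy⟩ := h
  obtain ⟨W, hW, ψ, htW, hψ, hy'⟩ := h'
  have hsub : T.proj (V ⊓ W) (LinearFun.res inf_le_left φ - LinearFun.res inf_le_right ψ) = 0 := by
    rw [map_sub, ← res_proj, ← res_proj, hφ, hψ, res_res, res_res, sub_self]
  have hloc := (proj_eq_zero_iff _).1 hsub
  obtain ⟨N, hN, htN, hc⟩ := (IsLocallyConstant.iff_exists_open _).1 hloc ⟨g t, htV, htW⟩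
  have hN' := ((V ⊓ W).isOpen.isOpenMap_subtype_val N hN).mem_nhds ⟨_, htN, rfl⟩
  have key := stdSimplex.eq_of_eventually_sum_mul_eq (t := t) (y := fun i => y i - y' i)
    (k := φ.1 ⟨g t, htV⟩ - ψ.1 ⟨g t, htW⟩) (by
      filter_upwards [hg.continuousAt.eventually_mem hN'] with t' ht' hpos
      obtain ⟨z, hz, hzt⟩ := ht'
      have hm : g t' ∈ V ⊓ W := hzt ▸ z.2
      have hz' : (⟨g t', hm⟩ : ↥(V ⊓ W)) ∈ N := by
        convert! hz
        exact hzt.symm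
      have h1 : φ.1 ⟨g t', hm.1⟩ - ψ.1 ⟨g t', hm.2⟩ = φ.1 ⟨g t, htV⟩ - ψ.1 ⟨g t, htW⟩ := hc _ hz'
      rw [← h1, hy t' _ hpos, hy' t' _ hpos, ← Finset.sum_sub_distrib]
      exact Finset.sum_congr rfl fun i _ => mul_sub _ _ _) ht
  have := key i
  have := key j
  dsimp only at *
  linarith

/-- Slopes are locally constant along the interior of a cell, and this interior is connected. -/
theorem HasSlopes.sub_eq_sub_of_forall (h : HasSlopes ω g t y) (h' : HasSlopes ω g t' y')
    (hg : Continuous g) (hex : ∀ t, (∀ i, 0 < t i) → ∃ y, HasSlopes ω g t y)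
    (ht : ∀ i, 0 < t i) (ht' : ∀ i, 0 < t' i) (i j : ι) : y i - y j = y' i - y' j := by
  let P : stdSimplex ℝ ι → Prop := fun s => ∀ z, HasSlopes ω g s z → ∀ i j, z i - z j = y i - y j
  have hP : ∀ s, (∀ i, 0 < s i) → ∀ z, HasSlopes ω g s z → (P s ↔ ∀ i j, z i - z j = y i - y j) :=
    fun s hs z hz => ⟨fun h => h z hz, fun h z' hz' i j => by
      rw [hz'.sub_eq_sub hz hg hs i j, h i j]⟩
  have hopen : ∀ s, (∀ i, 0 < s i) → ∀ᶠ s' in 𝓝 s, (∀ i, 0 < s' i) → (P s' ↔ P s) := by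
    intro s hs
    obtain ⟨z, hz⟩ := hex s hs
    filter_upwards [hz.eventually hg] with s' hs' hpos
    rw [hP s hs z hz, hP s' hpos z hs']
  have hpre : _root_.IsPreconnected {t : stdSimplex ℝ ι | ∀ i, 0 < t i} :=
    stdSimplex.isPreconnected_interior ι
  classical
  have hcont : ContinuousOn (fun s => decide (P s)) {t : stdSimplex ℝ ι | ∀ i, 0 < t i} := by
    intro s hs
    refine (continuousWithinAt_const (b := decide (P s))).congr_of_eventuallyEq ?_ rfl
    filter_upwards [nhdsWithin_le_nhds (hopen s hs), self_mem_nhdsWithin] with s' h1 h2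
    exact decide_eq_decide.2 (h1 h2)
  have h1 : decide (P t') = decide (P t) := hpre.constant hcont ht' ht
  have : P t' := (decide_eq_decide.1 h1).2 ((hP t ht y h).2 fun i j => rfl)
  exact (this y' h' i j).symm

end

end WeakTropicalSurface

/-! ### From global sections to balanced cocycles. -/

namespace WeakTropicalSurface

open DeltaComplex Matrix Topology

variable {T : WeakTropicalSurface.{u}}

-- A facet containing `e` has exactly one other edge `o p` at `v`. The off-diagonal part of the row
-- can thus be summed over facets instead of edges, which takes care of several facets sharing the
-- same two edges.
open Classical in
theorem mulVec_localMatrix_apply {v : T.V} (e : T.EdgesAt v) (x : T.EdgesAt v → ℝ)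
    (o : T.Star e.1 → T.EdgesAt v) (ho : ∀ p, o p ≠ e ∧ T.FacetContains p.1.1 (o p).1) :
    (T.localMatrix v *ᵥ x) e = -T.otherα v e.1 * x e + ∑ p, x (o p) := by
  have huniq : ∀ p, ∀ g : T.EdgesAt v, g ≠ e → T.FacetContains p.1.1 g.1 → g = o p := by
    intro p g hge hg
    obtain ⟨j, -, -, h3⟩ := isLinkIncidence v p.1.1 e ⟨p.1.2, p.2⟩
    rw [(h3 g hg).resolve_left hge, (h3 (o p) (ho p).2).resolve_left (ho p).1]
  have hcard : ∀ g : T.EdgesAt v, g ≠ e →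
      T.localMatrix v e g = ∑ p : T.Star e.1, if g = o p then 1 else 0 := by
    intro g hge
    rw [localMatrix, of_apply, if_neg hge.symm, Finset.sum_boole, ← Fintype.card_subtype,
      Nat.cast_inj]
    symm
    refine Fintype.card_of_bijective (f := fun p => ⟨p.1.1.1, ⟨p.1.1.2, p.1.2⟩, by
      have := (ho p.1).2
      rwa [← p.2] at this⟩) ⟨?_, ?_⟩
    · rintro ⟨⟨⟨f, i⟩, hi⟩, hp⟩ ⟨⟨⟨f', j⟩, hj⟩, hp'⟩ h
      obtain rfl : f = f' := congrArg Subtype.val h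
      obtain rfl : i = j := faceEdge_injective f (hi.trans hj.symm)
      rfl
    · rintro ⟨f, ⟨i, hi⟩, hg⟩
      exact ⟨⟨⟨(f, i), hi⟩, huniq _ g hge hg⟩, rfl⟩
  rw [mulVec, dotProduct, ← Finset.add_sum_erase _ _ (Finset.mem_univ e), localMatrix_self]
  congr 1
  rw [Finset.sum_congr rfl fun g hg => by rw [hcard g (Finset.ne_of_mem_erase hg), Finset.sum_mul],
    Finset.sum_comm]
  refine Finset.sum_congr rfl fun p _ => ?_
  rw [Finset.sum_eq_single_of_mem (o p) (Finset.mem_erase.2 ⟨(ho p).1, Finset.mem_univ _⟩)]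
  · simp
  · intro g _ hg
    simp [hg]

theorem slope_faceEdge {c : T.E → ℤ} {f : T.F} {y : Fin 3 → ℝ}
    (hy : ∀ i : Fin 3, y (i.succAbove 1) - y (i.succAbove 0) = c (T.faceEdge f i)) {a b m : Fin 3}
    (hab : a ≠ b) (hma : m ≠ a) (hmb : m ≠ b) :
    (slope c (T.faceVert f b) (T.faceEdge f m) : ℝ) = y a - y b := by
  obtain ⟨k, rfl⟩ := Fin.exists_succAbove_eq hma.symm
  obtain ⟨l, rfl⟩ := Fin.exists_succAbove_eq hmb.symm
  have h : T.edgeVert (T.faceEdge f m) 0 = T.faceVert f (m.succAbove l) ↔ l = 0 := by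
    rw [← T.edgeVert_faceEdge, (T.edgeVert_injective _).eq_iff, eq_comm]
  have hkl : k ≠ l := fun h => hab (by rw [h])
  have := hy m
  rw [slope]
  simp only [h]
  have hcases : l = 0 ∧ k = 1 ∨ l = 1 ∧ k = 0 := by omega
  rcases hcases with ⟨rfl, rfl⟩ | ⟨rfl, rfl⟩
  · simp [← this]
  · simp [← this]

theorem continuous_facetMap' (f : T.F) :
    Continuous (fun t => T.facetMap f t : stdSimplex ℝ (Fin 3) → T.top) :=
  T.continuous_facetMap f

theorem continuous_edgeMap' (e : T.E) :
    Continuous (fun t => T.edgeMap e t : stdSimplex ℝ (Fin 2) → T.top) :=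
  T.continuous_edgeMap e

theorem exists_hasSlopes_facet {U : Opens T.top} (ω : T.H0D U) (f : T.F)
    (t : stdSimplex ℝ (Fin 3)) (hU : T.facetMap f t ∈ U) :
    ∃ y : Fin 3 → ℝ, HasSlopes ω (fun t => T.facetMap f t) t y ∧
      ∀ i j, ∃ n : ℤ, y i - y j = n := by
  obtain ⟨V, h, φ, hxV, ⟨-, hφ, -⟩, hπ⟩ := exists_pred_lift ω hU
  obtain ⟨y, hy, hyφ⟩ := hφ f
  exact ⟨y, ⟨V, h, φ, hxV, hπ, hyφ⟩, hy⟩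

/-- One linear form `l` describes the section on the edge and on all facets around it; this is what
ties their slopes together. The points `t'` are taken in the interior of the facets, close to the
given point of the edge. -/
theorem exists_hasSlopes_edge {U : Opens T.top} (ω : T.H0D U) (e : T.E)
    (t : stdSimplex ℝ (Fin 2)) (ht : ∀ i, 0 < t i) (hU : T.edgeMap e t ∈ U) :
    ∃ l : T.Target e →ₗ[ℝ] ℝ, (∀ i j, ∃ n : ℤ, l (T.basisVec e i) - l (T.basisVec e j) = n) ∧
      HasSlopes ω (fun t => T.edgeMap e t) t (fun k => l (T.basisVec e (.inr k))) ∧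
      ∀ p : T.Star e, ∃ t' : stdSimplex ℝ (Fin 3), (∀ i, 0 < t' i) ∧
        HasSlopes ω (fun t => T.facetMap p.1.1 t) t' (Fin.insertNth (α := fun _ => ℝ) p.1.2
          (l (T.basisVec e (.inl p))) fun k => l (T.basisVec e (.inr k))) := by
  obtain ⟨V, h, φ, hxV, ⟨-, -, hφ⟩, hπ⟩ := exists_pred_lift ω hU
  obtain ⟨l, hl, hle, hlf⟩ := hφ e ⟨t, ht, hxV⟩
  refine ⟨l, hl, ⟨V, h, φ, hxV, hπ, fun t' h' ht' => ?_⟩, fun p => ?_⟩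
  · rw [hle t' h' ht']
    simp [φEdge]
  · have hV : T.facetMap p.1.1 (stdSimplex.map p.1.2.succAbove t) ∈ V := by
      rw [T.facetMap_map, p.2]
      exact hxV
    have hn := (continuous_facetMap' p.1.1).continuousAt.eventually_mem
      (x := stdSimplex.map p.1.2.succAbove t) (V.isOpen.mem_nhds hV)
    obtain ⟨t', h1, h2⟩ := mem_closure_iff_nhds.1 (stdSimplex.dense_interior 2 _) _ hn
    refine ⟨t', h2, V, h, φ, h1, hπ, fun s hs hpos => ?_⟩
    rw [hlf p s hs hpos, Fin.sum_univ_succAbove _ p.1.2]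
    simp [φFacet]

end WeakTropicalSurface

namespace WeakTropicalSurface

open DeltaComplex Matrix Topology

variable {T : WeakTropicalSurface.{u}}

/-- The class of `relVec` is zero in the quotient, so `l` kills it. -/
theorem sum_star_eq (e : T.E) (l : T.Target e →ₗ[ℝ] ℝ) :
    ∑ p, l (T.basisVec e (.inl p)) = ∑ k, T.α e k * l (T.basisVec e (.inr k)) := by
  classical
  have h : (Submodule.Quotient.mk (T.relVec e) : T.Target e) = 0 :=
    (Submodule.Quotient.mk_eq_zero _).2 (Submodule.mem_span_singleton_self _)
  have h1 : T.relVec e = ∑ i, T.relVec e i • (Pi.single i 1 : T.Vec e) := by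
    rw [← pi_eq_sum_univ' (T.relVec e)]
  have h2 : ∑ i, T.relVec e i * l (T.basisVec e i) = 0 := by
    have h3 := congrArg (fun x => l (Submodule.Quotient.mk x)) h1
    rw [h, map_zero] at h3
    have h4 := h3.symm
    rw [← Submodule.mkQ_apply, map_sum, map_sum] at h4
    simpa [basisVec, -Fintype.sum_sum_type] using h4
  rw [Fintype.sum_sum_type] at h2
  simp only [relVec, Sum.elim_inl, Sum.elim_inr, one_mul, neg_mul, Finset.sum_neg_distrib] at h2
  linarith

/-- The slopes of a global section of the quotient sheaf along the edges. -/
theorem exists_cocycle (ω : T.H0D ⊤) : ∃ c : T.E → ℤ, IsCocycle c ∧ IsBalanced c ∧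
    (∀ e t y, (∀ i, 0 < t i) → HasSlopes ω (fun t => T.edgeMap e t) t y → y 1 - y 0 = c e) ∧
    ∀ f t y, (∀ i, 0 < t i) → HasSlopes ω (fun t => T.facetMap f t) t y →
      ∀ i : Fin 3, y (i.succAbove 1) - y (i.succAbove 0) = c (T.faceEdge f i) := by
  classical
  have hbary : ∀ {n : ℕ} (i : Fin (n + 1)),
      (0 : ℝ) < (stdSimplex.barycenter : stdSimplex ℝ (Fin (n + 1))) i := fun {n} i => by
    change (0 : ℝ) < (Fintype.card (Fin (n + 1)) : ℝ)⁻¹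
    positivity
  choose l hl hle hlf using fun e => exists_hasSlopes_edge ω e stdSimplex.barycenter hbary trivial
  choose c hc using fun e => hl e (.inr 1) (.inr 0)
  have hE : ∀ e t y, (∀ i, 0 < t i) → HasSlopes ω (fun t => T.edgeMap e t) t y →
      y 1 - y 0 = c e := by
    intro e t y ht hy
    rw [← hc e]
    refine hy.sub_eq_sub_of_forall (hle e) (continuous_edgeMap' e) (fun t ht => ?_) ht hbary 1 0
    obtain ⟨l, -, h, -⟩ := exists_hasSlopes_edge ω e t ht trivial
    exact ⟨_, h⟩
  have hex : ∀ f t, ∃ y, HasSlopes ω (fun t => T.facetMap f t) t y := fun f t =>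
    (exists_hasSlopes_facet ω f t trivial).imp fun _ h => h.1
  have hstar : ∀ e (p : T.Star e) t y, (∀ i, 0 < t i) →
      HasSlopes ω (fun t => T.facetMap p.1.1 t) t y → ∀ k,
      y p.1.2 - y (p.1.2.succAbove k) = l e (T.basisVec e (.inl p)) -
        l e (T.basisVec e (.inr k)) := by
    intro e p t y ht hy k
    obtain ⟨t', ht', h⟩ := hlf e p
    have := hy.sub_eq_sub_of_forall h (continuous_facetMap' p.1.1) (fun t _ => hex p.1.1 t) ht ht'
      p.1.2 (p.1.2.succAbove k)
    rwa [Fin.insertNth_apply_same, Fin.insertNth_apply_succAbove] at this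
  have hF : ∀ f t y, (∀ i, 0 < t i) → HasSlopes ω (fun t => T.facetMap f t) t y →
      ∀ i : Fin 3, y (i.succAbove 1) - y (i.succAbove 0) = c (T.faceEdge f i) := by
    intro f t y ht hy i
    have h1 := hstar _ ⟨(f, i), rfl⟩ t y ht hy 1
    have h0 := hstar _ ⟨(f, i), rfl⟩ t y ht hy 0
    have := hc (T.faceEdge f i)
    simp only at h0 h1
    linarith
  refine ⟨c, fun f => ?_, fun v => ?_, hE, hF⟩
  · obtain ⟨y, hy⟩ := hex f stdSimplex.barycenter
    have h := hF f _ y hbary hy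
    have h0 : y 2 - y 1 = c (T.faceEdge f 0) := h 0
    have h1 : y 2 - y 0 = c (T.faceEdge f 1) := h 1
    have h2 : y 1 - y 0 = c (T.faceEdge f 2) := h 2
    have : (c (T.faceEdge f 1) : ℝ) = c (T.faceEdge f 2) + c (T.faceEdge f 0) := by linarith
    exact_mod_cast this
  · funext ⟨e, k, hk⟩
    subst hk
    have ho : ∀ p : T.Star e, ∃ o : T.EdgesAt (T.edgeVert e k), (o ≠ ⟨e, k, rfl⟩ ∧
        T.FacetContains p.1.1 o.1) ∧ (slope c (T.edgeVert e k) o.1 : ℝ) =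
        l e (T.basisVec e (.inl p)) - l e (T.basisVec e (.inr k)) := by
      rintro ⟨⟨f, i⟩, rfl⟩
      obtain ⟨m, hmi, hmk, -⟩ := Fin.exists_third i (i.succAbove k) (Fin.succAbove_ne i k).symm
      have hv := T.edgeVert_faceEdge f i k
      obtain ⟨y, hy⟩ := hex f stdSimplex.barycenter
      refine ⟨⟨T.faceEdge f m, hv ▸ edgeContains_faceEdge hmk⟩, ⟨fun h => hmi ?_, m, rfl⟩, ?_⟩
      · exact faceEdge_injective f (congrArg Subtype.val h)
      · have h1 := slope_faceEdge (hF f _ y hbary hy) (Fin.succAbove_ne i k).symm hmi hmk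
        rw [← hv] at h1
        rw [h1, hstar _ ⟨(f, i), rfl⟩ _ y hbary hy k]
    choose o ho1 ho2 using ho
    have hrow := mulVec_localMatrix_apply ⟨e, k, rfl⟩ (fun g => (slope c (T.edgeVert e k) g.1 : ℝ))
      o ho1
    refine hrow.trans ?_
    have hdeg : (Fintype.card (T.Star e) : ℝ) = T.α e 0 + T.α e 1 := by
      rw [T.card_star e]
      exact_mod_cast (T.sum_α e).symm
    -- Balancing of row `e`: the off-diagonal part is the sum of the values of `l` opposite to `e`
    -- minus the degree times its value at `v`. By `sum_star_eq` and the degree relation, this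
    -- equals the structure constant at the other end times the slope of `e`, which cancels the
    -- diagonal term.
    rw [Finset.sum_congr rfl fun p _ => ho2 p, Finset.sum_sub_distrib, sum_star_eq,
      Finset.sum_const, Finset.card_univ, nsmul_eq_mul, hdeg, Fin.sum_univ_two]
    have hce := hc e
    have h10 : T.edgeVert e 0 ≠ T.edgeVert e 1 :=
      fun h => absurd (T.edgeVert_injective e h) zero_ne_one
    have hk : k = 0 ∨ k = 1 := by omega
    rcases hk with rfl | rfl
    · simp only [slope, otherα, if_true, Pi.zero_apply, ← hce]
      ring
    · simp only [slope, otherα, if_neg h10, Pi.zero_apply, Int.cast_neg, ← hce]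
      ring

/-- A section of the quotient sheaf with vanishing slopes is zero. -/
theorem eq_zero_of_hasSlopes {ω : T.H0D ⊤}
    (hE : ∀ e t y, (∀ i, 0 < t i) → HasSlopes ω (fun t => T.edgeMap e t) t y → y 1 = y 0)
    (hF : ∀ f t y, (∀ i, 0 < t i) → HasSlopes ω (fun t => T.facetMap f t) t y →
      ∀ i j, y i = y j) : ω = 0 := by
  refine eq_zero_of_locally ω fun x hx => ?_
  obtain ⟨V, h, φ, hxV, ⟨hcont, hφF, hφE⟩, hφ⟩ := exists_pred_lift ω hx
  refine ⟨V, h, hxV, ?_⟩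
  rw [← hφ, proj_eq_zero_iff]
  -- A constant value on the interior extends to the part of the closed cell in `V` by density and
  -- continuity, even if that part is disconnected.
  have hcell : ∀ {n : ℕ} (g : stdSimplex ℝ (Fin (n + 1)) → T.top), Continuous g →
      (∃ k : ℝ, ∀ t (ht : g t ∈ V), (∀ i, 0 < t i) → φ.1 ⟨g t, ht⟩ = k) →
      ∀ t t' (ht : g t ∈ V) (ht' : g t' ∈ V), φ.1 ⟨g t, ht⟩ = φ.1 ⟨g t', ht'⟩ := by
    rintro n g hg ⟨k, hk⟩
    have : ∀ t (ht : g t ∈ V), φ.1 ⟨g t, ht⟩ = k := by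
      intro t ht
      have hopen : IsOpen (g ⁻¹' V) := V.isOpen.preimage hg
      have hcl := (stdSimplex.dense_interior n).open_subset_closure_inter hopen
      have hclosed : IsClosed {z : g ⁻¹' V | φ.1 ⟨g z, z.2⟩ = k} :=
        isClosed_eq (hcont.comp ((hg.comp continuous_subtype_val).subtype_mk _)) continuous_const
      have hmem : (⟨t, ht⟩ : g ⁻¹' V) ∈ closure {z : g ⁻¹' V | ∀ i, 0 < z.1 i} := by
        rw [closure_subtype]
        have := hcl ht
        convert! this using 2
        ext z
        exact ⟨fun ⟨z', h, hz⟩ => hz ▸ ⟨z'.2, h⟩, fun h => ⟨⟨z, h.1⟩, h.2, rfl⟩⟩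
      exact closure_minimal (fun (z : g ⁻¹' V) hz => hk z.1 z.2 hz) hclosed hmem
    intro t t' ht ht'
    rw [this t ht, this t' ht']
  have hedge : ∀ e t t' (ht : T.edgeMap e t ∈ V) (ht' : T.edgeMap e t' ∈ V),
      φ.1 ⟨T.edgeMap e t, ht⟩ = φ.1 ⟨T.edgeMap e t', ht'⟩ := by
    intro e
    refine hcell _ (continuous_edgeMap' e) ?_
    by_cases hm : T.EdgeMeets V e
    · obtain ⟨l, -, hl, -⟩ := hφE e hm
      obtain ⟨s, hs, hsV⟩ := hm
      have hsum : ∀ t (ht : T.edgeMap e t ∈ V), (∀ i, 0 < t i) → φ.1 ⟨T.edgeMap e t, ht⟩ =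
          ∑ i, t i * l (T.basisVec e (.inr i)) := fun t ht hpos => by
        rw [hl t ht hpos]
        simp [φEdge]
      have h0 := hE e s _ hs ⟨V, h, φ, hsV, hφ, hsum⟩
      refine ⟨l (T.basisVec e (.inr 0)), fun t ht hpos => ?_⟩
      rw [hsum t ht hpos, Fin.sum_univ_two, h0, ← add_mul, stdSimplex.add_eq_one, one_mul]
    · exact ⟨0, fun t ht hpos => absurd ⟨t, hpos, ht⟩ hm⟩
  have hfacet : ∀ f t t' (ht : T.facetMap f t ∈ V) (ht' : T.facetMap f t' ∈ V),
      φ.1 ⟨T.facetMap f t, ht⟩ = φ.1 ⟨T.facetMap f t', ht'⟩ := by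
    intro f
    refine hcell _ (continuous_facetMap' f) ?_
    obtain ⟨y, -, hy⟩ := hφF f
    refine ⟨y 0, fun t ht hpos => ?_⟩
    have h0 := hF f t y hpos ⟨V, h, φ, ht, hφ, hy⟩
    rw [hy t ht hpos, Finset.sum_congr rfl fun i _ => by rw [h0 i 0], ← Finset.sum_mul,
      stdSimplex.sum_eq_one, one_mul]
  rw [IsLocallyConstant.iff_exists_open]
  rintro ⟨x, hx⟩
  let k := φ.1 ⟨x, hx⟩
  -- In the quotient topology openness of a level set is tested on each closed cell. There it is
  -- either empty or the whole trace of `V`.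
  have hopen : IsOpen {z : T.Realization | ∃ hz : z ∈ V, φ.1 ⟨z, hz⟩ = k} := by
    have hq : IsQuotientMap (Quot.mk T.Glue : T.Cells → T.Realization) := isQuotientMap_quot_mk
    refine hq.isOpen_preimage.1 ?_
    have hall : ∀ {n : ℕ} (g : stdSimplex ℝ (Fin n) → T.top), Continuous g →
        (∀ t t' (ht : g t ∈ V) (ht' : g t' ∈ V), φ.1 ⟨g t, ht⟩ = φ.1 ⟨g t', ht'⟩) →
        IsOpen {t | ∃ ht : g t ∈ V, φ.1 ⟨g t, ht⟩ = k} := by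
      intro n g hg hconst
      rw [isOpen_iff_mem_nhds]
      rintro t ⟨ht, htk⟩
      filter_upwards [hg.continuousAt.eventually_mem (V.isOpen.mem_nhds ht)] with t' ht'
      exact ⟨ht', (hconst t' t ht' ht).trans htk⟩
    refine isOpen_sum_iff.2 ⟨isOpen_sigma_iff.2 fun v => ?_, isOpen_sum_iff.2
      ⟨isOpen_sigma_iff.2 fun e => ?_, isOpen_sigma_iff.2 fun f => ?_⟩⟩
    · exact isOpen_discrete _
    · exact hall _ (continuous_edgeMap' e) (hedge e)
    · exact hall _ (continuous_facetMap' f) (hfacet f)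
  refine ⟨Subtype.val ⁻¹' {z : T.Realization | ∃ hz : z ∈ V, φ.1 ⟨z, hz⟩ = k},
    hopen.preimage continuous_subtype_val, ⟨hx, rfl⟩, ?_⟩
  rintro ⟨z, hz⟩ ⟨_, hzk⟩
  exact hzk

end WeakTropicalSurface

/-! ### Sections over the interior of a facet, and the conclusion. -/

namespace DeltaComplex

variable {K : DeltaComplex.{u}}

open Classical in
theorem facetCoord_pos_of_mem {s : K.F} {x : K.top} (hx : x ∈ K.openFacet s) :
    0 < K.facetCoord (fun f => if f = s then 1 else 0) x := by
  obtain ⟨t, ht, rfl⟩ := hx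
  rw [facetCoord_facetMap, if_pos rfl, one_mul]
  exact Finset.prod_pos fun i _ => ht i

theorem edgeMap_notMem_openFacet (s : K.F) (e : K.E) (t : stdSimplex ℝ (Fin 2)) :
    (K.edgeMap e t : K.top) ∉ K.openFacet s := fun h => by
  classical
  have := facetCoord_pos_of_mem h
  rw [facetCoord_edgeMap] at this
  exact lt_irrefl _ this

theorem eq_of_facetMap_mem_openFacet {s f : K.F} {t : stdSimplex ℝ (Fin 3)}
    (h : (K.facetMap f t : K.top) ∈ K.openFacet s) : f = s := by
  classical
  by_contra hne
  have := facetCoord_pos_of_mem h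
  rw [facetCoord_facetMap, if_neg hne, zero_mul] at this
  exact lt_irrefl _ this

end DeltaComplex

namespace WeakTropicalSurface

open DeltaComplex Topology

variable {T : WeakTropicalSurface.{u}}

open Classical in
/-- The function on a facet that is affine linear with given values at the vertices. -/
noncomputable def affineFun (s : T.F) (y : Fin 3 → ℝ) (x : T.openFacet s) : ℝ :=
  ∑ i, y i * T.vertCoord (Pi.single (T.faceVert s i) 1) x.1

theorem affineFun_facetMap (s : T.F) (y : Fin 3 → ℝ) (t : stdSimplex ℝ (Fin 3))
    (h : (T.facetMap s t : T.top) ∈ T.openFacet s) :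
    affineFun s y ⟨T.facetMap s t, h⟩ = ∑ i, t i * y i := by
  classical
  rw [affineFun]
  refine Finset.sum_congr rfl fun i _ => ?_
  rw [vertCoord_facetMap, Finset.sum_eq_single i]
  · simp [mul_comm]
  · intro j _ hj
    rw [Pi.single_eq_of_ne ((T.faceVert_injective s).ne hj), mul_zero]
  · simp

/-- The open facet meets no edge and no other facet, so the only condition that is not vacuous is
the one on `s` itself. -/
theorem linear_affineFun (s : T.F) {y : Fin 3 → ℝ} (hy : ∀ i j, ∃ n : ℤ, y i - y j = n) :
    T.linear.pred (affineFun s y) := by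
  refine TopCat.PrelocalPredicate.sheafifyOf (P := T.linearPrelocal) ⟨?_, fun f => ?_, ?_⟩
  · exact continuous_finsetSum _ fun i _ =>
      continuous_const.mul ((T.continuous_vertCoord _).comp continuous_subtype_val)
  · by_cases hf : f = s
    · subst hf
      exact ⟨y, hy, fun t h _ => affineFun_facetMap f y t h⟩
    · exact ⟨0, fun _ _ => ⟨0, by simp⟩, fun t h _ => absurd (eq_of_facetMap_mem_openFacet h) hf⟩
  · rintro e ⟨t, -, h⟩
    exact absurd h (edgeMap_notMem_openFacet s e t)

/-- The class of the affine function on a facet with integral slopes `n`. -/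
noncomputable def affineSection (s : T.F) : ℤ × ℤ →+ T.H0D (T.openFacet s) :=
  (T.proj (T.openFacet s)).comp
    { toFun := fun n => ⟨affineFun s ![0, n.1, n.2], linear_affineFun s fun i j =>
        ⟨(![0, n.1, n.2] : Fin 3 → ℤ) i - (![0, n.1, n.2] : Fin 3 → ℤ) j, by
          fin_cases i <;> fin_cases j <;> simp⟩⟩
      map_zero' := by
        refine Subtype.ext (funext fun x => ?_)
        simp [affineFun, Fin.sum_univ_three]
      map_add' := fun m n => by
        refine Subtype.ext (funext fun x => ?_)
        simp [affineFun, Fin.sum_univ_three]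
        ring }

theorem affineSection_injective (s : T.F) : Function.Injective (affineSection (T := T) s) := by
  rw [injective_iff_map_eq_zero]
  intro n hn
  have hloc : IsLocallyConstant (affineFun s ![0, (n.1 : ℝ), (n.2 : ℝ)]) :=
    (proj_eq_zero_iff _).1 hn
  have hpos : ∀ i, (0 : ℝ) < (stdSimplex.barycenter : stdSimplex ℝ (Fin 3)) i := fun i => by
    change (0 : ℝ) < (Fintype.card (Fin 3) : ℝ)⁻¹
    positivity
  have hmem : ∀ t : stdSimplex ℝ (Fin 3), (∀ i, 0 < t i) →
      (T.facetMap s t : T.top) ∈ T.openFacet s := fun t ht => ⟨t, ht, rfl⟩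
  obtain ⟨N, hN, hb, hc⟩ := (IsLocallyConstant.iff_exists_open _).1 hloc ⟨_, hmem _ hpos⟩
  have hN' := ((T.openFacet s).isOpen.isOpenMap_subtype_val N hN).mem_nhds ⟨_, hb, rfl⟩
  have key := stdSimplex.eq_of_eventually_sum_mul_eq (t := stdSimplex.barycenter)
    (y := ![0, (n.1 : ℝ), (n.2 : ℝ)]) (by
      filter_upwards [(continuous_facetMap' s).continuousAt.eventually_mem hN'] with t ht hpos
      have ht' : (⟨T.facetMap s t, hmem t hpos⟩ : T.openFacet s) ∈ N := by
        obtain ⟨z, hz, hzt⟩ := ht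
        convert! hz
        exact hzt.symm
      rw [← affineFun_facetMap s _ t (hmem t hpos)]
      exact hc _ ht') hpos
  have h0 := key 0
  have h1 := (key 1).trans h0.symm
  have h2 := (key 2).trans h0.symm
  simp only [Matrix.cons_val] at h1 h2
  exact Prod.ext (by exact_mod_cast h1) (by exact_mod_cast h2)

/-- The slopes at the barycenter are the slopes everywhere in the open facet, so subtracting the
affine function with these slopes leaves a section that is locally represented by constants. -/
theorem affineSection_surjective (s : T.F) : Function.Surjective (affineSection (T := T) s) := by
  intro ω
  have hpos : ∀ i, (0 : ℝ) < (stdSimplex.barycenter : stdSimplex ℝ (Fin 3)) i := fun i => by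
    change (0 : ℝ) < (Fintype.card (Fin 3) : ℝ)⁻¹
    positivity
  obtain ⟨y, hy, hint⟩ := exists_hasSlopes_facet ω s stdSimplex.barycenter ⟨_, hpos, rfl⟩
  obtain ⟨a, ha⟩ := hint 1 0
  obtain ⟨b, hb⟩ := hint 2 0
  refine ⟨(a, b), sub_eq_zero.1 (eq_zero_of_locally _ fun x hx => ?_)⟩
  obtain ⟨t, ht, rfl⟩ := hx
  have hx : (T.facetMap s t : T.top) ∈ T.openFacet s := ⟨t, ht, rfl⟩
  obtain ⟨z, hz, -⟩ := exists_hasSlopes_facet ω s t hx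
  have hsub := hz.sub_eq_sub_of_forall hy (continuous_facetMap' s)
    (fun t ht => (exists_hasSlopes_facet ω s t ⟨t, ht, rfl⟩).imp fun _ h => h.1) ht hpos
  obtain ⟨V, hV, φ, hxV, hφ, hzφ⟩ := hz
  refine ⟨V, hV, hxV, ?_⟩
  rw [map_sub, ← hφ]
  have h1 : z 1 = z 0 + a := by have := hsub 1 0; linarith
  have h2 : z 2 = z 0 + b := by have := hsub 2 0; linarith
  have hres : res hV (affineSection s (a, b)) = T.proj V (LinearFun.res hV _) := res_proj hV _
  rw [hres, ← map_sub, proj_eq_zero_iff]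
  have hval : ∀ x : V, affineFun s ![0, (a : ℝ), (b : ℝ)] ⟨x.1, hV x.2⟩ - φ.1 x = -z 0 := by
    rintro ⟨x, hx⟩
    obtain ⟨t, ht, rfl⟩ := hV hx
    have e1 := affineFun_facetMap s ![0, (a : ℝ), (b : ℝ)] t (hV hx)
    have e2 : φ.1 ⟨T.facetMap s t, hx⟩ = ∑ i, t i * z i := hzφ t hx ht
    refine (congrArg₂ (· - ·) e1 e2).trans ?_
    have hsum := stdSimplex.sum_eq_one t
    simp only [Fin.sum_univ_three, h1, h2, Matrix.cons_val] at hsum ⊢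
    linear_combination (-z 0) * hsum
  have hconst : (fun x : V => affineFun s ![0, (a : ℝ), (b : ℝ)] ⟨x.1, hV x.2⟩ - φ.1 x) =
      fun _ => -z 0 := funext hval
  change IsLocallyConstant
    (fun x : V => affineFun s ![0, (a : ℝ), (b : ℝ)] ⟨x.1, hV x.2⟩ - φ.1 x)
  rw [hconst]
  exact IsLocallyConstant.const _

theorem restrict_injective (hT : T.IsTropicalSurface) (M : T.ManifoldWithFins)
    (hconn : T.ConnectedThroughCodimOne) {s : T.F} (hs : s ∈ M.S.facets) :
    Function.Injective (T.restrict (T.openFacet s)) := by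
  rw [injective_iff_map_eq_zero]
  intro ω hω
  obtain ⟨c, hc, hb, hE, hF⟩ := exists_cocycle ω
  have hpos : ∀ i, (0 : ℝ) < (stdSimplex.barycenter : stdSimplex ℝ (Fin 3)) i := fun i => by
    change (0 : ℝ) < (Fintype.card (Fin 3) : ℝ)⁻¹
    positivity
  -- Vanishing of the restriction means that the zero function represents `ω` on the open facet.
  have hs0 : HasSlopes ω (fun t => T.facetMap s t) stdSimplex.barycenter 0 := by
    refine ⟨T.openFacet s, le_top, 0, ⟨_, hpos, rfl⟩, ?_, fun t h _ => ?_⟩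
    · rw [map_zero]
      exact hω.symm
    · simp
  have hzero : ZeroFacet c s := by
    intro i
    have := hF s _ _ hpos hs0 i
    rw [Pi.zero_apply, Pi.zero_apply, sub_zero] at this
    exact_mod_cast this.symm
  have hc0 := eq_zero_of_zeroFacet hT M hconn hs hc hb hzero
  subst hc0
  refine eq_zero_of_hasSlopes (fun e t y ht hy => ?_) fun f t y ht hy => ?_
  · have := hE e t y ht hy
    simp only [Pi.zero_apply, Int.cast_zero] at this
    linarith
  · have h := hF f t y ht hy
    simp only [Pi.zero_apply, Int.cast_zero] at h
    have h1 : y 2 - y 0 = 0 := h 1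
    have h2 : y 1 - y 0 = 0 := h 2
    have : ∀ i, y i = y 0 := fun i => by
      fin_cases i
      · rfl
      · exact sub_eq_zero.1 h2
      · exact sub_eq_zero.1 h1
    exact fun i j => (this i).trans (this j).symm

end WeakTropicalSurface

theorem mainTheorem6 (T : WeakTropicalSurface.{u}) (hT : T.IsTropicalSurface)
    (M : T.ManifoldWithFins) (hc : T.ConnectedThroughCodimOne) (s : T.F) (hs : s ∈ M.S.facets) :
    Nonempty (T.H0D (T.openFacet s) ≃+ ℤ × ℤ) ∧
      Function.Injective (T.restrict (T.openFacet s)) := by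
  refine ⟨⟨(AddEquiv.ofBijective (WeakTropicalSurface.affineSection s)
    ⟨WeakTropicalSurface.affineSection_injective s,
      WeakTropicalSurface.affineSection_surjective s⟩).symm⟩, ?_⟩
  exact WeakTropicalSurface.restrict_injective hT M hc hs
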